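/- Let $r,s\ge 2$, write points of $\mathbb R^{r+s}$ as $(X,Y)\in\mathbb R^r\times\mathbb R^s$, and let $$C=C_{r-1,s-1}=\Big\{t x:\ t\ge 0,\ x\in S^{r-1}\big(\sqrt{\tfrac{r-1}{r+s-2}}\big)\times S^{s-1}\big(\sqrt{\tfrac{s-1}{r+s-2}}\big)\Big\}.$$ Suppose that $C$ is area-minimizing: the truncation of $C$ by the closed unit ball, as an oriented multiplicity-one current, has least mass among all integral $(r+s-1)$-currents with the same boundary. Then $C$ has a calibration $\omega$ whose only singularity is the origin. That is, $\omega$ is an $(r+s-1)$-form which on $\mathbb R^{r+s}\setminus\{0\}$ is smooth, closed and of comass at most $1$, and which restricts to a volume form ($\pm$ the oriented unit volume) on every tangent space of $C\setminus\{0\}$; and $\omega$ has no continuous extension to the origin. Moreover, $\omega$ can be taken of the following form. Let $\pi(X,Y)=(\|X\|,\|Y\|)$ be the projection to the quadrant, with polar coordinates $\|X\|=R\cos\theta$, $\|Y\|=R\sin\theta$. Put $\theta_0=\arctan\sqrt{(s-1)/(r-1)}$, $\alpha=r+s-1$, $p=2r-2$, $q=2s-2$, and $\tau=\cos^{p}\theta_0\,\sin^{q}\theta_0$.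 At points with $X\ne0$ and $Y\neq 0$ let $\Omega_0$ be the volume form of the orbit $S^{r-1}(\|X\|)\times S^{s-1}(\|Y\|)$, i.e. the wedge product of $\|X\|^{-1}\sum_i(-1)^{i-1}x_i\,dx_1\wedge\cdots\wedge\widehat{dx_i}\wedge\cdots\wedge dx_r$ and $\|Y\|^{-1}\sum_j(-1)^{j-1}y_j\,dy_1\wedge\cdots\wedge\widehat{dy_j}\wedge\cdots\wedge dy_s$, and let $V=\|X\|^{r-1}\|Y\|^{s-1}$. Then there are a real number $\beta$, numbers $0<\delta<\theta_0$ and $0<\varepsilon<\frac{\pi}{2}-\theta_0$, and smooth nonincreasing functions $\lambda,\eta:\mathbb R\to\mathbb R$, with $\lambda$ constant on $(-\infty,\delta/2]$ and zero on $[\delta,\infty)$, and $\eta$ constant on $(-\infty,\varepsilon/2]$ and zero on $[\varepsilon,\infty)$, such that, wherever $X\ne 0$ and $Y\ne 0$, $$\omega=\sqrt{\tau}\;\pi^*(d\tilde f)\wedge\frac{\Omega_0}{V},\qquad \tilde f(R,\theta)=\frac{1}{\alpha\,\tau^{\beta}}\,R^{\alpha}\,(\cos\theta)^{\beta p+\eta(\frac{\pi}{2}-\theta)}\,(\sin\theta)^{\beta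 q+\lambda(\theta)} .$$ -/

import Mathlib

open Real Set Filter Topology MeasureTheory
open scoped ContDiff ENNReal

noncomputable section

/-! ### Differential forms, comass, rectifiable currents -/

/-- Differential `k`-forms on `E`. -/
abbrev DiffForm (E : Type*) [NormedAddCommGroup E] [InnerProductSpace ℝ E] (k : ℕ) : Type _ :=
  E → E [⋀^Fin k]→L[ℝ] ℝ

/-- The comass of a `k`-covector: its supremum over unit simple `k`-vectors
`v₁ ∧ ⋯ ∧ v_k`, that is, over orthonormal `k`-frames. -/
def comass {E : Type*} [NormedAddCommGroup E] [InnerProductSpace ℝ E] {k : ℕ}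
    (φ : E [⋀^Fin k]→L[ℝ] ℝ) : ℝ :=
  ⨆ v : {v : Fin k → E // Orthonormal ℝ v}, |φ v.1|

/-- The forms on which currents are evaluated: smooth with compact support. -/
def IsTestForm {E : Type*} [NormedAddCommGroup E] [InnerProductSpace ℝ E] {k : ℕ}
    (φ : DiffForm E k) : Prop :=
  ContDiff ℝ ∞ φ ∧ HasCompactSupport φ

/-- The images `∂f/∂p₁, …, ∂f/∂p_k` of the standard basis of `ℝᵏ` under the derivative of `f`. -/
def coordFrame {E : Type*} [NormedAddCommGroup E] [InnerProductSpace ℝ E] {k : ℕ}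
    (f : (Fin k → ℝ) → E) (p : Fin k → ℝ) : Fin k → E :=
  fun i => fderiv ℝ f p (Pi.single i 1)

/-- The `k`-dimensional Jacobian `√det (⟪∂f/∂pᵢ, ∂f/∂pⱼ⟫)`. -/
def jacobian {E : Type*} [NormedAddCommGroup E] [InnerProductSpace ℝ E] {k : ℕ}
    (f : (Fin k → ℝ) → E) (p : Fin k → ℝ) : ℝ :=
  √(Matrix.of fun i j => inner ℝ (coordFrame f p i) (coordFrame f p j)).det

/-- The current `f_#⟦A⟧`, that is, `φ ↦ ∫_A f^*φ`. -/
def pushCurrent {E : Type*} [NormedAddCommGroup E] [InnerProductSpace ℝ E] {k : ℕ}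
    (f : (Fin k → ℝ) → E) (A : Set (Fin k → ℝ)) (φ : DiffForm E k) : ℝ :=
  ∫ p in A, φ (f p) (coordFrame f p)

/-- `T` is a (compactly supported, integer multiplicity) rectifiable `k`-current: on test forms it
is a countable sum of Lipschitz images of measurable sets in `ℝᵏ`, of finite total area and with
bounded support. Multiplicities arise from repetitions and signs from reflections of `ℝᵏ`. Such a
`T` is automatically linear and continuous on test forms. -/
def IsRectifiableCurrent {E : Type*} [NormedAddCommGroup E] [InnerProductSpace ℝ E] {k : ℕ}
    (T : DiffForm E k → ℝ) : Prop :=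
  ∃ (f : ℕ → (Fin k → ℝ) → E) (A : ℕ → Set (Fin k → ℝ)),
    (∀ j, ∃ K, LipschitzWith K (f j)) ∧ (∀ j, MeasurableSet (A j)) ∧
    Bornology.IsBounded (⋃ j, f j '' A j) ∧
    (∑' j, ∫⁻ p in A j, ENNReal.ofReal (jacobian (f j) p)) < ⊤ ∧
    ∀ φ : DiffForm E k, IsTestForm φ → HasSum (fun j => pushCurrent (f j) (A j) φ) (T φ)

/-- The mass of a current. -/
def currentMass {E : Type*} [NormedAddCommGroup E] [InnerProductSpace ℝ E] {k : ℕ}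
    (T : DiffForm E k → ℝ) : ℝ≥0∞ :=
  ⨆ (φ : DiffForm E k) (_ : IsTestForm φ ∧ ∀ x, comass (φ x) ≤ 1), ENNReal.ofReal (T φ)

/-- `T` and `S` have the same boundary, where `∂T (φ) = T (dφ)`. -/
def SameBoundary {E : Type*} [NormedAddCommGroup E] [InnerProductSpace ℝ E] {k : ℕ}
    (T S : DiffForm E (k + 1) → ℝ) : Prop :=
  ∀ φ : DiffForm E k, IsTestForm φ → T (extDeriv φ) = S (extDeriv φ)

/-- `S` has least mass among all rectifiable currents with the boundary of `S`. (If `∂S` is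
rectifiable, as for a truncated cone over a closed submanifold, these competitors are
exactly the integral currents with that boundary.) -/
def IsMassMinimizing {E : Type*} [NormedAddCommGroup E] [InnerProductSpace ℝ E] {k : ℕ}
    (S : DiffForm E (k + 1) → ℝ) : Prop :=
  ∀ T : DiffForm E (k + 1) → ℝ, IsRectifiableCurrent T → SameBoundary T S →
    currentMass S ≤ currentMass T

/-! ### The cone over a product of two spheres -/

/-- Euclidean space `ℝ^(m+1) × ℝ^(n+1)`, of dimension `m + n + 2`. -/
abbrev Amb (m n : ℕ) : Type := EuclideanSpace ℝ (Fin (m + 1) ⊕ Fin (n + 1))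

/-- The component `X` of a point `(X, Y)`, as a linear map. -/
def projX (m n : ℕ) : Amb m n →ₗ[ℝ] EuclideanSpace ℝ (Fin (m + 1)) where
  toFun x := WithLp.toLp 2 fun i => x (Sum.inl i)
  map_add' _ _ := rfl
  map_smul' _ _ := rfl

/-- The component `Y` of a point `(X, Y)`, as a linear map. -/
def projY (m n : ℕ) : Amb m n →ₗ[ℝ] EuclideanSpace ℝ (Fin (n + 1)) where
  toFun x := WithLp.toLp 2 fun j => x (Sum.inr j)
  map_add' _ _ := rfl
  map_smul' _ _ := rfl

/-- `√(m/(m+n))`, the radius of the first sphere of the link. -/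
def radX (m n : ℕ) : ℝ := √((m : ℝ) / (m + n))

/-- `√(n/(m+n))`, the radius of the second sphere of the link. -/
def radY (m n : ℕ) : ℝ := √((n : ℝ) / (m + n))

/-- The link `Sᵐ(√(m/(m+n))) × Sⁿ(√(n/(m+n)))`. -/
def link (m n : ℕ) : Set (Amb m n) :=
  {x | ‖projX m n x‖ = radX m n ∧ ‖projY m n x‖ = radY m n}

/-- The cone `{t x : 0 ≤ t < ∞, x ∈ M}` over a set `M`. -/
def coneOver {E : Type*} [AddCommGroup E] [Module ℝ E] (M : Set E) : Set E :=
  {y | ∃ t : ℝ, 0 ≤ t ∧ ∃ x ∈ M, y = t • x}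

/-- Inverse stereographic projection `ℝᵈ → Sᵈ ⊆ ℝ^(d+1)`; a bijection onto the
unit sphere without the point `(1, 0, …, 0)`. -/
def invStereo {d : ℕ} (y : Fin d → ℝ) : Fin (d + 1) → ℝ :=
  Fin.cons ((∑ i, y i ^ 2 - 1) / (∑ i, y i ^ 2 + 1)) fun i => 2 * y i / (∑ i, y i ^ 2 + 1)

/-- The parametrization `(y, z, t) ↦ t (√(m/(m+n)) σ(y), √(n/(m+n)) σ(z))` of the cone over the
link, where `y ∈ ℝᵐ`, `z ∈ ℝⁿ`, `t ∈ ℝ` and `σ` is inverse stereographic projection. -/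
def coneChart (m n : ℕ) (p : Fin (m + n + 1) → ℝ) : Amb m n :=
  WithLp.toLp 2 <| Sum.elim
    (fun i => p (Fin.last (m + n)) *
      (radX m n * invStereo (fun a : Fin m => p (Fin.castSucc (Fin.castAdd n a))) i))
    (fun j => p (Fin.last (m + n)) *
      (radY m n * invStereo (fun b : Fin n => p (Fin.castSucc (Fin.natAdd m b))) j))

/-- The current of integration over the cone over the link, truncated by the unit ball. The
parametrization is injective on `0 < t ≤ 1` and misses only a null set of the truncated cone. -/
def truncatedCone (m n : ℕ) : DiffForm (Amb m n) (m + n + 1) → ℝ :=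
  pushCurrent (coneChart m n) {p | 0 ≤ p (Fin.last (m + n)) ∧ p (Fin.last (m + n)) ≤ 1}

/-! ### Calibrations with one singular point -/

/-- `Φ` is a calibration of the hypersurface `C` (of dimension `k`) whose only singularity is the
origin: away from the origin it is smooth, closed and of comass at most one, and it restricts
to a volume form on the tangent spaces of `C`; and it does not extend continuously to the
origin. -/
structure IsCalibrationSingularOnlyAtZero {E : Type*} [NormedAddCommGroup E]
    [InnerProductSpace ℝ E] {k : ℕ} (Φ : DiffForm E k) (C : Set E) : Prop where
  smooth : ContDiffOn ℝ ∞ Φ {0}ᶜ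
  closed : ∀ x, x ≠ 0 → extDeriv Φ x = 0
  comass_le : ∀ x, x ≠ 0 → comass (Φ x) ≤ 1
  calibrates : ∀ x ∈ C, x ≠ 0 → ∀ v : Fin k → E, Orthonormal ℝ v →
    (∀ i, v i ∈ Submodule.span ℝ (tangentConeAt ℝ C x)) → |Φ x v| = 1
  singular : ¬ ∃ L, Tendsto Φ (𝓝[≠] 0) (𝓝 L)

/-! ### Lawson's potential with deformed exponents -/

/-- The exterior product of two alternating forms. -/
def wedge {M : Type*} [AddCommGroup M] [Module ℝ M] {a b : ℕ}
    (φ : M [⋀^Fin a]→ₗ[ℝ] ℝ) (ψ : M [⋀^Fin b]→ₗ[ℝ] ℝ) : M [⋀^Fin (a + b)]→ₗ[ℝ] ℝ :=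
  ((LinearMap.mul' ℝ ℝ).compAlternatingMap (φ.domCoprod ψ)).domDomCongr finSumFinEquiv

/-- The volume form of the sphere of radius `‖X‖` at `X ∈ ℝ^(d+1)`,
`‖X‖⁻¹ ∑ᵢ (-1)^(i-1) xᵢ dx₁ ∧ ⋯ ∧ (omit dxᵢ) ∧ ⋯ ∧ dx_(d+1)`. -/
def sphereForm {d : ℕ} (X : EuclideanSpace ℝ (Fin (d + 1))) :
    EuclideanSpace ℝ (Fin (d + 1)) [⋀^Fin d]→ₗ[ℝ] ℝ :=
  (EuclideanSpace.basisFun (Fin (d + 1)) ℝ).toBasis.det.curryLeft (‖X‖⁻¹ • X)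

/-- `Ω₀`: the volume form of the orbits `Sᵐ(‖X‖) × Sⁿ(‖Y‖)`. -/
def orbitForm (m n : ℕ) (x : Amb m n) : Amb m n [⋀^Fin (m + n)]→ₗ[ℝ] ℝ :=
  wedge ((sphereForm (projX m n x)).compLinearMap (projX m n))
    ((sphereForm (projY m n x)).compLinearMap (projY m n))

/-- `V`: the volume function of the orbits, up to the constant `vol(Sᵐ) vol(Sⁿ)`. -/
def orbitVolume (m n : ℕ) (x : Amb m n) : ℝ := ‖projX m n x‖ ^ m * ‖projY m n x‖ ^ n

/-- The projection `π` to the orbit space, the quadrant in `ℝ²`. -/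
def orbitMap (m n : ℕ) (x : Amb m n) : ℝ × ℝ := (‖projX m n x‖, ‖projY m n x‖)

/-- The angle of the ray of the quadrant that corresponds to the cone. -/
def coneAngle (m n : ℕ) : ℝ := arctan √((n : ℝ) / m)

/-- `τ = cos^(2m) θ₀ sin^(2n) θ₀`. -/
def tauConst (m n : ℕ) : ℝ := cos (coneAngle m n) ^ (2 * m) * sin (coneAngle m n) ^ (2 * n)

/-- Lawson's potential `α⁻¹ R^α (cos^(2m) θ sin^(2n) θ / τ)^β`, `α = m + n + 1`, in polar
coordinates `(R, θ)` of the quadrant, with the exponent of `sin θ` increased by `κ θ` and the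
exponent of `cos θ` increased by `η (π/2 - θ)`. -/
def deformedPotential (m n : ℕ) (β : ℝ) (κ η : ℝ → ℝ) (q : ℝ × ℝ) : ℝ :=
  let R := √(q.1 ^ 2 + q.2 ^ 2)
  let θ := arctan (q.2 / q.1)
  (m + n + 1 : ℝ)⁻¹ * R ^ (m + n + 1) *
    (cos θ ^ (2 * m * β + η (π / 2 - θ)) * sin θ ^ (2 * n * β + κ θ)) / tauConst m n ^ β

/-- `κ` is a smooth nonincreasing cutoff, constant on `(-∞, δ/2]` and zero on `[δ, ∞)`. -/
structure IsCutoff (κ : ℝ → ℝ) (δ : ℝ) : Prop where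
  smooth : ContDiff ℝ ∞ κ
  antitone : Antitone κ
  const : ∀ θ ≤ δ / 2, κ θ = κ 0
  zero : ∀ θ ≥ δ, κ θ = 0

/-- The `(m+n+1)`-form `√τ · π^*(df) ∧ Ω₀ / V` at a point. -/
def potentialForm (m n : ℕ) (f : ℝ × ℝ → ℝ) (x : Amb m n) :
    Amb m n [⋀^Fin (m + n + 1)]→ₗ[ℝ] ℝ :=
  (√(tauConst m n) / orbitVolume m n x) •
    (wedge (AlternatingMap.ofSubsingleton ℝ (Amb m n) ℝ (0 : Fin 1)
        (fderiv ℝ (f ∘ orbitMap m n) x : Amb m n →ₗ[ℝ] ℝ))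
      (orbitForm m n x)).domDomCongr (finCongr (Nat.add_comm 1 (m + n)))

end

/-! Write `m = r - 1`, `n = s - 1`, `α = m + n + 1`. Minimality is used only to exclude `m + n ≤ 5`
and the pairs (1,5), (5,1). For all other `m, n ≥ 1` the calibration is constructed outright.

Exclusion. The hypersurface swept out by the orbits `Sᵐ(x) × Sⁿ(y)` over a curve in the quadrant has
area `∫ xᵐ yⁿ ds` times a constant. If the curve starts at the origin or on an axis and ends at the
point of the link, the swept current has the same boundary as the truncated cone, since one sphere
collapses on an axis (`integral_extDeriv_slab`, `SmoothCurve.pushCurrent_extDeriv`). A curve shorter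
than the ray in this weighted length therefore contradicts minimality
(`not_isMassMinimizing_of_curves`). For `m + n ≤ 5` the second variation along the ray is negative
for an explicit oscillating field (`not_isMassMinimizing_of_add_le_five`). For (1,5) small
oscillations do not suffice, and the competitor leaves the axis `X = 0`, runs towards the cone and
meets it at the link (`exists_curves_one_five`). Its area is estimated by the homothety flux `R⁷ V
cos ψ / 7`, with `V` the orbit volume and `ψ` the angle between the curve and the ray.

Construction. A form of codimension one is `ι_W vol` for a vector field `W`. It is closed where `div
W = 0`, its comass is at most `‖W‖`, and it has value `±1` on orthonormal frames orthogonal to `W`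
where `‖W‖ = 1`. The required form `√τ π^*(df) ∧ Ω₀ / V` is of this kind, with `W` built from the
function `g` for which `√τ f = ‖X‖^(m+1) ‖Y‖^(n+1) g` (`wedge_orbitForm`,
`potentialForm_eq_fluxForm`). For Lawson's potential, `g` is a constant times `R⁻¹ (sin²θ)^c
(cos²θ)^c'` with `c = nβ - (n+1)/2` and `c' = mβ - (m+1)/2`. The bound `‖W‖ ≤ 1`, with equality on
the cone, becomes after taking logarithms a one-variable inequality, whose derivative is controlled
by a quadratic form (`IsLawsonExponent.log_le`). It holds with `β = 1` if `m, n ≥ 2`, and with `β =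
5/4` if one of them is 1.

This `g` need not be smooth on the axes. The cutoffs raise `c` and `c'` to the integers `n` and `m`
near the axes, which makes `g` smooth off the origin (`contDiff_profile`). Because `c, c' > 0`, the
field is small near the axes, and it remains so after the deformation if the cutoff angles are small
(`exists_forall_profile_mul_le`, `exists_norm_potField_le_one`). Finally `W` is odd and homogeneous
of degree zero, so the form has no limit at the origin. -/

noncomputable section

/-! ### Exterior products of linear functionals as determinants -/

section DetForm

variable {M : Type*} [AddCommGroup M] [Module ℝ M]

/-- The exterior product `ℓ₁ ∧ ⋯ ∧ ℓ_k` of linear functionals. -/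
def detForm {ι : Type*} [Fintype ι] [DecidableEq ι] (l : ι → M →ₗ[ℝ] ℝ) : M [⋀^ι]→ₗ[ℝ] ℝ :=
  Matrix.detRowAlternating.compLinearMap (LinearMap.pi l)

theorem detForm_apply {ι : Type*} [Fintype ι] [DecidableEq ι] (l : ι → M →ₗ[ℝ] ℝ) (v : ι → M) :
    detForm l v = (Matrix.of fun i j => l i (v j)).det := by
  rw [← Matrix.det_transpose]
  rfl

/-- The multilinear map `v ↦ ∏ ℓᵢ (vᵢ)`. -/
def prodForm {ι : Type*} [Fintype ι] (l : ι → M →ₗ[ℝ] ℝ) : MultilinearMap ℝ (fun _ : ι => M) ℝ :=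
  (MultilinearMap.mkPiAlgebra ℝ ι ℝ).compLinearMap l

/-- This is the Leibniz formula. It replaces wedge products of functionals by alternatizations of
tensor products. -/
theorem alternatization_prodForm {ι : Type*} [Fintype ι] [DecidableEq ι] (l : ι → M →ₗ[ℝ] ℝ) :
    MultilinearMap.alternatization (prodForm l) = detForm l := by
  ext v
  rw [MultilinearMap.alternatization_apply, detForm_apply, ← Matrix.det_transpose,
    Matrix.det_apply]
  simp [prodForm]

/-- The shuffle product of two alternatizations is the alternatization of the tensor product, with
no factorials, and a tensor product of products of functionals is again one such product. -/
theorem wedge_detForm {a b : ℕ} (l : Fin a → M →ₗ[ℝ] ℝ) (l' : Fin b → M →ₗ[ℝ] ℝ) :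
    wedge (detForm l) (detForm l') = detForm (Fin.append l l') := by
  have key : (LinearMap.mul' ℝ ℝ).compMultilinearMap
      (MultilinearMap.domCoprod (prodForm l) (prodForm l')) = prodForm (Sum.elim l l') := by
    ext v
    simp [prodForm, Fintype.prod_sum_type]
  have h2 : (LinearMap.mul' ℝ ℝ).compAlternatingMap ((detForm l).domCoprod (detForm l')) =
      detForm (Sum.elim l l') := by
    rw [← alternatization_prodForm, ← alternatization_prodForm, ← alternatization_prodForm,
      ← MultilinearMap.domCoprod_alternization, ← key,
      LinearMap.compMultilinearMap_alternatization]
  rw [wedge, h2]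
  ext v
  rw [AlternatingMap.domDomCongr_apply, detForm_apply, detForm_apply,
    ← Matrix.det_submatrix_equiv_self (finSumFinEquiv (m := a) (n := b))]
  congr 1
  ext i j
  rcases i with i | i <;> simp

/-- In the Laplace expansion along the first row, the minors do not involve that row. -/
theorem detForm_cons_add_smul {k : ℕ} (l l' : M →ₗ[ℝ] ℝ) (c c' : ℝ) (t : Fin k → M →ₗ[ℝ] ℝ) :
    detForm (Fin.cons (c • l + c' • l') t : Fin (k + 1) → M →ₗ[ℝ] ℝ) =
      c • detForm (Fin.cons l t : Fin (k + 1) → M →ₗ[ℝ] ℝ) +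
        c' • detForm (Fin.cons l' t : Fin (k + 1) → M →ₗ[ℝ] ℝ) := by
  ext v
  simp only [detForm_apply, AlternatingMap.add_apply, AlternatingMap.smul_apply, smul_eq_mul,
    Matrix.det_succ_row_zero, Finset.mul_sum, ← Finset.sum_add_distrib]
  refine Finset.sum_congr rfl fun j _ => ?_
  have hs : ∀ l : M →ₗ[ℝ] ℝ, (Matrix.of fun i j => (Fin.cons l t : Fin (k + 1) → M →ₗ[ℝ] ℝ) i
      (v j)).submatrix Fin.succ j.succAbove = Matrix.of fun i i' => t i (v (j.succAbove i')) := by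
    intro l; ext; simp
  rw [hs, hs, hs]
  simp
  ring

/-- Contracting `ℓ₁ ∧ ℓ₂ ∧ t` with a vector annihilated by all members of `t`. -/
theorem curryLeft_detForm {k : ℕ} (l₁ l₂ : M →ₗ[ℝ] ℝ) (t : Fin k → M →ₗ[ℝ] ℝ) (w : M)
    (hw : ∀ i, t i w = 0) :
    (detForm (Fin.cons l₁ (Fin.cons l₂ t : Fin (k + 1) → M →ₗ[ℝ] ℝ) :
        Fin (k + 1 + 1) → M →ₗ[ℝ] ℝ)).curryLeft w =
      detForm (Fin.cons (l₁ w • l₂ + (-l₂ w) • l₁) t : Fin (k + 1) → M →ₗ[ℝ] ℝ) := by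
  rw [detForm_cons_add_smul]
  ext v
  rw [AlternatingMap.curryLeft_apply_apply, detForm_apply, Matrix.det_succ_column_zero,
    Fin.sum_univ_succ, Fin.sum_univ_succ, Finset.sum_eq_zero]
  · simp only [AlternatingMap.add_apply, AlternatingMap.smul_apply, smul_eq_mul, detForm_apply]
    have h0 : (Matrix.of fun i j => (Fin.cons l₁ (Fin.cons l₂ t : Fin (k + 1) → M →ₗ[ℝ] ℝ) :
        Fin (k + 1 + 1) → M →ₗ[ℝ] ℝ) i (Matrix.vecCons w v j)).submatrix
        (Fin.succAbove 0) Fin.succ = Matrix.of fun i j =>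
          (Fin.cons l₂ t : Fin (k + 1) → M →ₗ[ℝ] ℝ) i (v j) := by
      ext i j; simp
    have h1 : (Matrix.of fun i j => (Fin.cons l₁ (Fin.cons l₂ t : Fin (k + 1) → M →ₗ[ℝ] ℝ) :
        Fin (k + 1 + 1) → M →ₗ[ℝ] ℝ) i (Matrix.vecCons w v j)).submatrix
        (Fin.succAbove (Fin.succ 0)) Fin.succ = Matrix.of fun i j =>
          (Fin.cons l₁ t : Fin (k + 1) → M →ₗ[ℝ] ℝ) i (v j) := by
      ext i j
      refine Fin.cases ?_ (fun i => ?_) i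
      · simp
      · simp
    rw [h0, h1]
    simp
  · intro i _
    simp [hw i]

end DetForm

/-! ### Hypersurface forms as contractions of the volume form -/

section Flux

variable {E : Type*} [NormedAddCommGroup E] [InnerProductSpace ℝ E] {k : ℕ}

theorem volumeForm_orientation_toBasis [Fact (Module.finrank ℝ E = k + 1)]
    (b : OrthonormalBasis (Fin (k + 1)) ℝ E) (v : Fin (k + 1) → E) :
    b.toBasis.orientation.volumeForm v = b.toBasis.det v := by
  rw [Orientation.volumeForm_robust _ b rfl]

/-- Hadamard's inequality, taken from the volume form of the orientation that the basis defines. -/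
theorem abs_det_le_prod_norm (b : OrthonormalBasis (Fin (k + 1)) ℝ E) (v : Fin (k + 1) → E) :
    |b.toBasis.det v| ≤ ∏ i, ‖v i‖ := by
  have : Fact (Module.finrank ℝ E = k + 1) :=
    ⟨by rw [Module.finrank_eq_card_basis b.toBasis, Fintype.card_fin]⟩
  rw [← volumeForm_orientation_toBasis]
  exact Orientation.abs_volumeForm_apply_le _ v

theorem abs_det_eq_prod_norm (b : OrthonormalBasis (Fin (k + 1)) ℝ E) {v : Fin (k + 1) → E}
    (hv : Pairwise fun i j => inner ℝ (v i) (v j) = 0) : |b.toBasis.det v| = ∏ i, ‖v i‖ := by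
  have : Fact (Module.finrank ℝ E = k + 1) :=
    ⟨by rw [Module.finrank_eq_card_basis b.toBasis, Fintype.card_fin]⟩
  rw [← volumeForm_orientation_toBasis]
  exact Orientation.abs_volumeForm_apply_of_pairwise_orthogonal _ hv

/-- The determinant in an orthonormal basis, as a continuous alternating map. -/
def volForm (b : OrthonormalBasis (Fin (k + 1)) ℝ E) : E [⋀^Fin (k + 1)]→L[ℝ] ℝ :=
  AlternatingMap.mkContinuous b.toBasis.det 1 fun v => by
    rw [one_mul]
    exact abs_det_le_prod_norm b v

/-- The hypersurface form `ι_w vol`. -/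
def fluxForm (b : OrthonormalBasis (Fin (k + 1)) ℝ E) : E →L[ℝ] E [⋀^Fin k]→L[ℝ] ℝ :=
  (volForm b).curryLeft

theorem fluxForm_apply (b : OrthonormalBasis (Fin (k + 1)) ℝ E) (w : E) (v : Fin k → E) :
    fluxForm b w v = b.toBasis.det (Fin.cons w v : Fin (k + 1) → E) := rfl

theorem abs_fluxForm_le (b : OrthonormalBasis (Fin (k + 1)) ℝ E) (w : E) (v : Fin k → E) :
    |fluxForm b w v| ≤ ‖w‖ * ∏ i, ‖v i‖ := by
  rw [fluxForm_apply]
  refine (abs_det_le_prod_norm b _).trans_eq ?_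
  simp [Fin.prod_univ_succ]

/-- The vectors `w, v₁, …, v_k` form an orthogonal system, which is a case of equality in Hadamard's
inequality. This is the mechanism by which the form calibrates hyperplanes normal to the field, and
it also evaluates the test form on the cone. -/
theorem abs_fluxForm_eq (b : OrthonormalBasis (Fin (k + 1)) ℝ E) (w : E) (v : Fin k → E)
    (hv : Pairwise fun i j => inner ℝ (v i) (v j) = 0) (hw : ∀ i, inner ℝ w (v i) = 0) :
    |fluxForm b w v| = ‖w‖ * ∏ i, ‖v i‖ := by
  rw [fluxForm_apply, abs_det_eq_prod_norm b]
  · simp [Fin.prod_univ_succ]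
  · intro i j
    refine Fin.cases ?_ (fun i => ?_) i <;> refine Fin.cases ?_ (fun j => ?_) j
    · simp
    · exact fun _ => by simpa using hw j
    · exact fun _ => by simpa [real_inner_comm] using hw i
    · intro h
      simpa using hv (fun e => h (by rw [e]))

theorem comass_fluxForm_le (b : OrthonormalBasis (Fin (k + 1)) ℝ E) (w : E) :
    comass (fluxForm b w) ≤ ‖w‖ := by
  refine Real.iSup_le (fun v => ?_) (norm_nonneg _)
  refine (abs_fluxForm_le b w v.1).trans_eq ?_
  simp [v.2.1]

theorem bddAbove_abs_apply_orthonormal (φ : E [⋀^Fin k]→L[ℝ] ℝ) :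
    BddAbove (range fun v : {v : Fin k → E // Orthonormal ℝ v} => |φ v.1|) := by
  refine ⟨‖φ‖, ?_⟩
  rintro _ ⟨v, rfl⟩
  have := φ.le_opNorm v.1
  simpa [v.2.1] using this

/-- Comass tests only orthonormal frames. An orthogonal frame without zero vectors is normalized,
and one with a zero vector gives zero. Orthogonal frames suffice because the parametrizations below
have orthogonal partial derivatives. -/
theorem abs_apply_le_comass_mul (φ : E [⋀^Fin k]→L[ℝ] ℝ) (v : Fin k → E)
    (hv : Pairwise fun i j => inner ℝ (v i) (v j) = 0) : |φ v| ≤ comass φ * ∏ i, ‖v i‖ := by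
  by_cases h : ∃ i, v i = 0
  · obtain ⟨i, hi⟩ := h
    rw [φ.map_coord_zero i hi, Finset.prod_eq_zero (Finset.mem_univ i) (by simp [hi])]
    simp
  · push Not at h
    have ho : Orthonormal ℝ fun i => ‖v i‖⁻¹ • v i := by
      refine ⟨fun i => ?_, fun i j hij => ?_⟩
      · rw [norm_smul, norm_inv, norm_norm, inv_mul_cancel₀ (norm_ne_zero_iff.2 (h i))]
      · simp only [inner_smul_left, inner_smul_right, hv hij, mul_zero]
    have h1 : |φ fun i => ‖v i‖⁻¹ • v i| ≤ comass φ :=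
      le_ciSup (bddAbove_abs_apply_orthonormal φ) ⟨_, ho⟩
    have h2 : φ v = (∏ i, ‖v i‖) * φ fun i => ‖v i‖⁻¹ • v i := by
      rw [← smul_eq_mul, ← φ.map_smul_univ]
      congr 1
      ext1 i
      rw [smul_smul, mul_inv_cancel₀ (norm_ne_zero_iff.2 (h i)), one_smul]
    have h3 : 0 ≤ ∏ i, ‖v i‖ := Finset.prod_nonneg fun i _ => norm_nonneg _
    rw [h2, abs_mul, abs_of_nonneg h3, mul_comm]
    exact mul_le_mul_of_nonneg_right h1 h3

/-- The form `ι_W vol` is closed where the divergence of `W` vanishes. -/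
theorem extDeriv_fluxForm_eq_zero (b : OrthonormalBasis (Fin (k + 1)) ℝ E) {W : E → E}
    {W' : E →L[ℝ] E} {x : E} (hW : HasFDerivAt W W' x) (hdiv : ∑ i, inner ℝ (b i) (W' (b i)) = 0) :
    extDeriv (fun x => fluxForm b (W x)) x = 0 := by
  have hd : HasFDerivAt (fun x => fluxForm b (W x)) ((fluxForm b).comp W') x :=
    (fluxForm b).hasFDerivAt.comp x hW
  apply ContinuousAlternatingMap.toAlternatingMap_injective
  refine b.toBasis.ext_alternating fun s hs => ?_
  have key : extDeriv (fun x => fluxForm b (W x)) x (fun i => b i) = 0 := by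
    rw [extDeriv, hd.fderiv, ContinuousAlternatingMap.alternatizeUncurryFin_apply, ← hdiv]
    refine Finset.sum_congr rfl fun i _ => ?_
    simp only [ContinuousLinearMap.comp_apply, fluxForm_apply]
    -- In the expansion along the column of `W' (b i)`, a minor that omits a row `p ≠ i` retains the
    -- zero row `i`, because `b i` has been removed from the frame. Row `i` contributes its diagonal
    -- entry, and its sign cancels that of the exterior derivative; the sum over `i` is the
    -- divergence.
    rw [Module.Basis.det_apply, Matrix.det_succ_column_zero, Finset.sum_eq_single i]
    · have h1 : (b.toBasis.toMatrix (Fin.cons (W' (b i)) (i.removeNth fun i => b i) :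
          Fin (k + 1) → E)).submatrix i.succAbove Fin.succ = 1 := by
        ext p q
        simp [Module.Basis.toMatrix_apply, Fin.removeNth, Matrix.one_apply]
      rw [h1]
      simp [Module.Basis.toMatrix_apply, b.repr_apply_apply, ← mul_assoc, ← pow_add]
    · intro p _ hp
      obtain ⟨q, hq⟩ := Fin.exists_succAbove_eq hp.symm
      rw [Matrix.det_eq_zero_of_row_eq_zero q, mul_zero]
      intro j
      simp [Module.Basis.toMatrix_apply, Fin.removeNth, hq]
    · simp
  -- An injective choice of indices is a permutation of the basis, so the value changes only by a
  -- sign and the case `key` is enough.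
  have hb : Function.Bijective s := Finite.injective_iff_bijective.1 hs
  have h2 := (extDeriv (fun x => fluxForm b (W x)) x).toAlternatingMap.map_perm (fun i => b i)
    (Equiv.ofBijective s hb)
  simp only [ContinuousAlternatingMap.coe_toAlternatingMap, key, smul_zero] at h2
  simpa [Function.comp_def] using h2

end Flux

/-! ### The orbit form in adapted orthonormal frames -/

section OrbitForm

theorem curryLeft_detForm_cons {M : Type*} [AddCommGroup M] [Module ℝ M] {k : ℕ}
    (l : M →ₗ[ℝ] ℝ) (t : Fin k → M →ₗ[ℝ] ℝ) (w : M) (hw : ∀ i, t i w = 0) :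
    (detForm (Fin.cons l t : Fin (k + 1) → M →ₗ[ℝ] ℝ)).curryLeft w = l w • detForm t := by
  ext v
  rw [AlternatingMap.curryLeft_apply_apply, detForm_apply, Matrix.det_succ_column_zero,
    Fin.sum_univ_succ, Finset.sum_eq_zero]
  · have h0 : (Matrix.of fun i j => (Fin.cons l t : Fin (k + 1) → M →ₗ[ℝ] ℝ) i
        (Matrix.vecCons w v j)).submatrix (Fin.succAbove 0) Fin.succ =
          Matrix.of fun i j => t i (v j) := by
      ext i j; simp
    rw [h0, AlternatingMap.smul_apply, detForm_apply]
    simp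
  · intro i _
    simp [hw i]

theorem detForm_compLinearMap {M N : Type*} [AddCommGroup M] [Module ℝ M] [AddCommGroup N]
    [Module ℝ N] {ι : Type*} [Fintype ι] [DecidableEq ι] (l : ι → M →ₗ[ℝ] ℝ) (P : N →ₗ[ℝ] M) :
    (detForm l).compLinearMap P = detForm fun i => (l i).comp P := by
  ext v
  simp [detForm_apply]

theorem smul_compLinearMap {M N : Type*} [AddCommGroup M] [Module ℝ M] [AddCommGroup N]
    [Module ℝ N] {ι : Type*} (c : ℝ) (φ : M [⋀^ι]→ₗ[ℝ] ℝ) (P : N →ₗ[ℝ] M) :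
    (c • φ).compLinearMap P = c • φ.compLinearMap P := rfl

theorem wedge_smul_smul {M : Type*} [AddCommGroup M] [Module ℝ M] {a b : ℕ} (c c' : ℝ)
    (φ : M [⋀^Fin a]→ₗ[ℝ] ℝ) (ψ : M [⋀^Fin b]→ₗ[ℝ] ℝ) :
    wedge (c • φ) (c' • ψ) = (c * c') • wedge φ ψ := by
  have h : (c • φ).domCoprod (c' • ψ) = (c * c') • φ.domCoprod ψ := by
    rw [← AlternatingMap.domCoprod'_apply, ← AlternatingMap.domCoprod'_apply,
      TensorProduct.smul_tmul_smul, map_smul]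
  rw [wedge, wedge, h]
  ext v
  simp

theorem toBasis_det_eq_detForm {E : Type*} [NormedAddCommGroup E] [InnerProductSpace ℝ E]
    {ι : Type*} [Fintype ι] [DecidableEq ι] (b : OrthonormalBasis ι ℝ E) :
    b.toBasis.det = detForm fun i => (innerSL ℝ (b i) : E →ₗ[ℝ] ℝ) := by
  ext v
  rw [Module.Basis.det_apply, detForm_apply]
  congr 1
  ext i j
  simp [Module.Basis.toMatrix_apply, b.repr_apply_apply]

/-- Over an orthonormal basis starting with a unit vector `u`, contracting with `u` removes the
first dual vector. -/
theorem curryLeft_toBasis_det {E : Type*} [NormedAddCommGroup E] [InnerProductSpace ℝ E]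
    {d : ℕ} (b : OrthonormalBasis (Fin (d + 1)) ℝ E) :
    b.toBasis.det.curryLeft (b 0) = detForm fun i : Fin d => (innerSL ℝ (b i.succ) : E →ₗ[ℝ] ℝ) := by
  rw [toBasis_det_eq_detForm]
  have h := curryLeft_detForm_cons (innerSL ℝ (b 0) : E →ₗ[ℝ] ℝ)
    (fun i : Fin d => (innerSL ℝ (b i.succ) : E →ₗ[ℝ] ℝ)) (b 0) (fun i => by
      simp [b.inner_eq_ite])
  have h2 : (Fin.cons (innerSL ℝ (b 0) : E →ₗ[ℝ] ℝ)
      (fun i : Fin d => (innerSL ℝ (b i.succ) : E →ₗ[ℝ] ℝ)) : Fin (d + 1) → E →ₗ[ℝ] ℝ) =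
      fun i => (innerSL ℝ (b i) : E →ₗ[ℝ] ℝ) := by
    ext1 i
    refine Fin.cases ?_ (fun i => ?_) i <;> simp
  rw [h2] at h
  rw [h]
  simp

/-- A unit vector extends to an orthonormal basis. -/
theorem exists_orthonormalBasis_zero {d : ℕ} (u : EuclideanSpace ℝ (Fin (d + 1))) (hu : ‖u‖ = 1) :
    ∃ b : OrthonormalBasis (Fin (d + 1)) ℝ (EuclideanSpace ℝ (Fin (d + 1))), b 0 = u := by
  obtain ⟨b, hb⟩ := Orthonormal.exists_orthonormalBasis_extension_of_card_eq (𝕜 := ℝ)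
    (ι := Fin (d + 1)) (E := EuclideanSpace ℝ (Fin (d + 1))) (by simp) (v := fun _ => u) (s := {0})
    ⟨fun _ => hu, fun i j hij => absurd (Subsingleton.elim i j) hij⟩
  exact ⟨b, hb 0 rfl⟩

/-- The order in which the coordinates of `ℝ^(m+1) × ℝ^(n+1)` are listed: first the initial
coordinates of both factors, then the others. -/
def coordOrder (m n : ℕ) : Fin (m + n + 1 + 1) → Fin (m + 1) ⊕ Fin (n + 1) :=
  Fin.cons (Sum.inl 0) (Fin.cons (Sum.inr 0)
    (Fin.append (fun i : Fin m => Sum.inl i.succ) (fun j : Fin n => Sum.inr j.succ)) :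
      Fin (m + n + 1) → Fin (m + 1) ⊕ Fin (n + 1))

theorem coordOrder_bijective (m n : ℕ) : Function.Bijective (coordOrder m n) := by
  have hs : Function.Surjective (coordOrder m n) := by
    rintro (i | j)
    · refine Fin.cases ⟨0, rfl⟩ (fun i => ⟨(Fin.castAdd n i).succ.succ, ?_⟩) i
      simp [coordOrder]
    · refine Fin.cases ⟨Fin.succ 0, rfl⟩ (fun j => ⟨(Fin.natAdd m j).succ.succ, ?_⟩) j
      simp [coordOrder]
  exact (Fintype.bijective_iff_surjective_and_card _).2 ⟨hs, by simp; ring⟩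

/-- The coordinates of `ℝ^(m+1) × ℝ^(n+1)`, numbered. -/
def coordEquiv (m n : ℕ) : Fin (m + n + 1 + 1) ≃ Fin (m + 1) ⊕ Fin (n + 1) :=
  Equiv.ofBijective _ (coordOrder_bijective m n)

/-- The standard basis of `ℝ^(m+1) × ℝ^(n+1)`. -/
def ambBasis (m n : ℕ) : OrthonormalBasis (Fin (m + n + 1 + 1)) ℝ (Amb m n) :=
  (EuclideanSpace.basisFun (Fin (m + 1) ⊕ Fin (n + 1)) ℝ).reindex (coordEquiv m n).symm

/-- The inclusion `X ↦ (X, 0)`. -/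
def inclX (m n : ℕ) : EuclideanSpace ℝ (Fin (m + 1)) →ₗ[ℝ] Amb m n where
  toFun X := WithLp.toLp 2 (Sum.elim X 0)
  map_add' a b := by ext (i | i) <;> simp
  map_smul' c a := by ext (i | i) <;> simp

/-- The inclusion `Y ↦ (0, Y)`. -/
def inclY (m n : ℕ) : EuclideanSpace ℝ (Fin (n + 1)) →ₗ[ℝ] Amb m n where
  toFun Y := WithLp.toLp 2 (Sum.elim 0 Y)
  map_add' a b := by ext (i | i) <;> simp
  map_smul' c a := by ext (i | i) <;> simp

variable {m n : ℕ}

theorem projX_apply (x : Amb m n) (i : Fin (m + 1)) : projX m n x i = x (Sum.inl i) := rfl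

theorem projY_apply (x : Amb m n) (j : Fin (n + 1)) : projY m n x j = x (Sum.inr j) := rfl

@[simp] theorem inclX_inl (X : EuclideanSpace ℝ (Fin (m + 1))) (i : Fin (m + 1)) :
    inclX m n X (Sum.inl i) = X i := rfl

@[simp] theorem inclX_inr (X : EuclideanSpace ℝ (Fin (m + 1))) (j : Fin (n + 1)) :
    inclX m n X (Sum.inr j) = 0 := rfl

@[simp] theorem inclY_inl (Y : EuclideanSpace ℝ (Fin (n + 1))) (i : Fin (m + 1)) :
    inclY m n Y (Sum.inl i) = 0 := rfl

@[simp] theorem inclY_inr (Y : EuclideanSpace ℝ (Fin (n + 1))) (j : Fin (n + 1)) :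
    inclY m n Y (Sum.inr j) = Y j := rfl

@[simp] theorem projX_inclX (X : EuclideanSpace ℝ (Fin (m + 1))) : projX m n (inclX m n X) = X := by
  ext i; simp [projX_apply]

@[simp] theorem projY_inclX (X : EuclideanSpace ℝ (Fin (m + 1))) : projY m n (inclX m n X) = 0 := by
  ext i; simp [projY_apply]

@[simp] theorem projX_inclY (Y : EuclideanSpace ℝ (Fin (n + 1))) : projX m n (inclY m n Y) = 0 := by
  ext i; simp [projX_apply]

@[simp] theorem projY_inclY (Y : EuclideanSpace ℝ (Fin (n + 1))) : projY m n (inclY m n Y) = Y := by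
  ext i; simp [projY_apply]

theorem inclX_projX_add (x : Amb m n) : inclX m n (projX m n x) + inclY m n (projY m n x) = x := by
  ext (i | i) <;> simp [projX_apply, projY_apply]

theorem inner_eq_projX_add_projY (x y : Amb m n) : inner ℝ x y =
    inner ℝ (projX m n x) (projX m n y) + inner ℝ (projY m n x) (projY m n y) := by
  simp [PiLp.inner_apply, projX_apply, projY_apply]

theorem norm_sq_eq_projX_add_projY (x : Amb m n) :
    ‖x‖ ^ 2 = ‖projX m n x‖ ^ 2 + ‖projY m n x‖ ^ 2 := by
  simp only [← real_inner_self_eq_norm_sq, inner_eq_projX_add_projY]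

/-- The dual vectors of two orthonormal bases of the factors, as functionals on the product. -/
def dualX (b : OrthonormalBasis (Fin (m + 1)) ℝ (EuclideanSpace ℝ (Fin (m + 1))))
    (i : Fin (m + 1)) : Amb m n →ₗ[ℝ] ℝ :=
  (innerSL ℝ (b i) : _ →ₗ[ℝ] ℝ).comp (projX m n)

/-- The dual vectors of an orthonormal basis of the second factor, as functionals on the product. -/
def dualY (b : OrthonormalBasis (Fin (n + 1)) ℝ (EuclideanSpace ℝ (Fin (n + 1))))
    (j : Fin (n + 1)) : Amb m n →ₗ[ℝ] ℝ :=
  (innerSL ℝ (b j) : _ →ₗ[ℝ] ℝ).comp (projY m n)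

/-- Both sides are top-degree forms, so it suffices to evaluate on the standard basis, where the
matrix is block diagonal. -/
theorem detForm_sum_elim_dual
    (bX : OrthonormalBasis (Fin (m + 1)) ℝ (EuclideanSpace ℝ (Fin (m + 1))))
    (bY : OrthonormalBasis (Fin (n + 1)) ℝ (EuclideanSpace ℝ (Fin (n + 1)))) :
    detForm (Sum.elim (dualX bX) (dualY bY) : _ → Amb m n →ₗ[ℝ] ℝ) =
      (bX.toBasis.det (EuclideanSpace.basisFun _ ℝ) * bY.toBasis.det (EuclideanSpace.basisFun _ ℝ)) •
        (EuclideanSpace.basisFun (Fin (m + 1) ⊕ Fin (n + 1)) ℝ).toBasis.det := by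
  rw [AlternatingMap.eq_smul_basis_det (EuclideanSpace.basisFun (Fin (m + 1) ⊕ Fin (n + 1)) ℝ).toBasis
    (detForm (Sum.elim (dualX bX) (dualY bY) : _ → Amb m n →ₗ[ℝ] ℝ))]
  congr 1
  rw [detForm_apply, toBasis_det_eq_detForm, toBasis_det_eq_detForm, detForm_apply, detForm_apply,
    ← Matrix.det_fromBlocks_zero₂₁ _ 0]
  congr 1
  have hXl : ∀ i, projX m n (EuclideanSpace.single (Sum.inl i) 1) = EuclideanSpace.single i 1 := by
    intro i; ext j; simp [projX_apply]
  have hXr : ∀ i, projX m n (EuclideanSpace.single (Sum.inr i) 1) = 0 := by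
    intro i; ext j; simp [projX_apply]
  have hYl : ∀ i, projY m n (EuclideanSpace.single (Sum.inl i) 1) = 0 := by
    intro i; ext j; simp [projY_apply]
  have hYr : ∀ i, projY m n (EuclideanSpace.single (Sum.inr i) 1) = EuclideanSpace.single i 1 := by
    intro i; ext j; simp [projY_apply]
  ext (i | i) (j | j) <;> simp [dualX, dualY, hXl, hXr, hYl, hYr]

/-- The ordering puts the first dual vector of each factor in front. With adapted bases these are
the radial directions, and the remaining dual vectors then appear in the order in which `Ω₀`
multiplies them. -/
theorem ambBasis_det (bX : OrthonormalBasis (Fin (m + 1)) ℝ (EuclideanSpace ℝ (Fin (m + 1))))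
    (bY : OrthonormalBasis (Fin (n + 1)) ℝ (EuclideanSpace ℝ (Fin (n + 1)))) :
    detForm (Fin.cons (dualX bX 0) (Fin.cons (dualY bY 0)
      (Fin.append (fun i => dualX bX i.succ) (fun j => dualY bY j.succ)) :
        Fin (m + n + 1) → Amb m n →ₗ[ℝ] ℝ) : Fin (m + n + 1 + 1) → Amb m n →ₗ[ℝ] ℝ) =
      (bX.toBasis.det (EuclideanSpace.basisFun _ ℝ) * bY.toBasis.det (EuclideanSpace.basisFun _ ℝ)) •
        (ambBasis m n).toBasis.det := by
  have h1 : (Fin.cons (dualX bX 0) (Fin.cons (dualY bY 0)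
      (Fin.append (fun i => dualX bX i.succ) (fun j => dualY bY j.succ)) :
        Fin (m + n + 1) → Amb m n →ₗ[ℝ] ℝ) : Fin (m + n + 1 + 1) → Amb m n →ₗ[ℝ] ℝ) =
      fun i => Sum.elim (dualX bX) (dualY bY) (coordEquiv m n i) := by
    ext1 i
    refine Fin.cases rfl (fun i => Fin.cases rfl (fun i => ?_) i) i
    refine Fin.addCases (fun i => ?_) (fun i => ?_) i <;> simp [coordEquiv, coordOrder]
  rw [h1]
  ext v
  have h2 := congrArg (fun f => f (v ∘ (coordEquiv m n).symm)) (detForm_sum_elim_dual bX bY)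
  simp only [AlternatingMap.smul_apply] at h2 ⊢
  have h3 : (ambBasis m n).toBasis.det v =
      (EuclideanSpace.basisFun (Fin (m + 1) ⊕ Fin (n + 1)) ℝ).toBasis.det
        (v ∘ (coordEquiv m n).symm) := by
    rw [ambBasis, OrthonormalBasis.reindex_toBasis, Module.Basis.det_reindex]
  rw [h3, ← h2, detForm_apply, detForm_apply, ← Matrix.det_submatrix_equiv_self (coordEquiv m n)]
  congr 1
  ext i j
  simp

/-- The determinant between orthonormal bases is a sign. The adapted bases need not be positively
oriented, and their signs disappear in squares. -/
theorem toBasis_det_mul_self {d : ℕ} (b b' : OrthonormalBasis (Fin (d + 1)) ℝ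
    (EuclideanSpace ℝ (Fin (d + 1)))) : b.toBasis.det b' * b.toBasis.det b' = 1 := by
  rw [← abs_mul_abs_self, abs_det_eq_prod_norm]
  · simp
  · exact fun i j hij => b'.orthonormal.2 hij

theorem sphereForm_eq_detForm {d : ℕ} {X : EuclideanSpace ℝ (Fin (d + 1))}
    (b : OrthonormalBasis (Fin (d + 1)) ℝ (EuclideanSpace ℝ (Fin (d + 1))))
    (hb : b 0 = ‖X‖⁻¹ • X) :
    sphereForm X = b.toBasis.det (EuclideanSpace.basisFun _ ℝ) •
      detForm fun i : Fin d => (innerSL ℝ (b i.succ) : _ →ₗ[ℝ] ℝ) := by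
  rw [← curryLeft_toBasis_det, sphereForm, ← hb]
  have h := AlternatingMap.eq_smul_basis_det (EuclideanSpace.basisFun (Fin (d + 1)) ℝ).toBasis
    b.toBasis.det
  rw [h, AlternatingMap.curryLeft_smul, AlternatingMap.smul_apply,
    LinearMap.smul_apply, smul_smul]
  have h1 := (EuclideanSpace.basisFun (Fin (d + 1)) ℝ).toBasis.det_self
  simp only [OrthonormalBasis.coe_toBasis] at h1
  simp only [OrthonormalBasis.coe_toBasis, h1, smul_eq_mul, mul_one]
  rw [toBasis_det_mul_self, one_smul]

/-- For `L = l₁ d‖X‖ + l₂ d‖Y‖`, the form `L ∧ Ω₀` is the contraction of the volume form with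
`(l₂ X/‖X‖, -l₁ Y/‖Y‖)`. -/
theorem wedge_orbitForm (x : Amb m n) (hX : projX m n x ≠ 0) (hY : projY m n x ≠ 0)
    (L : Amb m n →ₗ[ℝ] ℝ) (l₁ l₂ : ℝ) (hL : ∀ y, L y =
      l₁ * inner ℝ (‖projX m n x‖⁻¹ • projX m n x) (projX m n y) +
      l₂ * inner ℝ (‖projY m n x‖⁻¹ • projY m n x) (projY m n y)) :
    (wedge (AlternatingMap.ofSubsingleton ℝ (Amb m n) ℝ (0 : Fin 1) L)
      (orbitForm m n x)).domDomCongr (finCongr (Nat.add_comm 1 (m + n))) =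
    (fluxForm (ambBasis m n) (inclX m n ((l₂ * ‖projX m n x‖⁻¹) • projX m n x) +
      inclY m n ((-l₁ * ‖projY m n x‖⁻¹) • projY m n x))).toAlternatingMap := by
  -- Frames are adapted to the point: the first vectors are the unit radial ones, and up to sign
  -- `Ω₀` is the product of all the other dual vectors.
  obtain ⟨bX, hbX⟩ := exists_orthonormalBasis_zero (‖projX m n x‖⁻¹ • projX m n x)
    (by rw [norm_smul, norm_inv, norm_norm, inv_mul_cancel₀ (norm_ne_zero_iff.2 hX)])
  obtain ⟨bY, hbY⟩ := exists_orthonormalBasis_zero (‖projY m n x‖⁻¹ • projY m n x)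
    (by rw [norm_smul, norm_inv, norm_norm, inv_mul_cancel₀ (norm_ne_zero_iff.2 hY)])
  set εX := bX.toBasis.det (EuclideanSpace.basisFun _ ℝ) with hεX
  set εY := bY.toBasis.det (EuclideanSpace.basisFun _ ℝ) with hεY
  set T : Fin (m + n) → Amb m n →ₗ[ℝ] ℝ :=
    Fin.append (fun i => dualX bX i.succ) (fun j => dualY bY j.succ) with hT
  have hO : orbitForm m n x = (εX * εY) • detForm T := by
    rw [orbitForm, sphereForm_eq_detForm bX hbX, sphereForm_eq_detForm bY hbY,
      smul_compLinearMap, smul_compLinearMap, wedge_smul_smul,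
      detForm_compLinearMap, detForm_compLinearMap, wedge_detForm]
    rfl
  have hL' : L = l₁ • dualX bX 0 + l₂ • dualY bY 0 := by
    ext y
    simp only [hL, dualX, dualY, ← hbX, ← hbY]
    rfl
  have h1 : AlternatingMap.ofSubsingleton ℝ (Amb m n) ℝ (0 : Fin 1) L =
      (1 : ℝ) • detForm fun _ : Fin 1 => L := by
    ext v
    simp [detForm_apply]
  set w := inclX m n ((l₂ * ‖projX m n x‖⁻¹) • projX m n x) +
      inclY m n ((-l₁ * ‖projY m n x‖⁻¹) • projY m n x) with hw
  have hwX : projX m n w = l₂ • bX 0 := by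
    rw [hw, map_add, projX_inclX, projX_inclY, add_zero, hbX, smul_smul]
  have hwY : projY m n w = (-l₁) • bY 0 := by
    rw [hw, map_add, projY_inclX, projY_inclY, zero_add, hbY, smul_smul]
  -- The field has only radial components, so the contraction affects just the two radial covectors.
  have hTw : ∀ i, T i w = 0 := by
    intro i
    refine Fin.addCases (fun i => ?_) (fun i => ?_) i
    · simp [hT, dualX, hwX, inner_smul_right, bX.inner_eq_ite]
    · simp [hT, dualY, hwY, inner_smul_right, bY.inner_eq_ite]
  have h2 := curryLeft_detForm (dualX bX 0) (dualY bY 0) T w hTw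
  rw [hT, ambBasis_det bX bY, ← hεX, ← hεY, ← hT] at h2
  have h3 : dualX bX 0 w = l₂ := by simp [dualX, hwX, inner_smul_right]
  have h4 : dualY bY 0 w = -l₁ := by simp [dualY, hwY, inner_smul_right]
  rw [h3, h4, neg_neg, add_comm (l₂ • _), ← hL'] at h2
  have hε : (εX * εY) * (εX * εY) = 1 := by
    rw [mul_mul_mul_comm, hεX, hεY, toBasis_det_mul_self, toBasis_det_mul_self, one_mul]
  have h5 : (fluxForm (ambBasis m n) w).toAlternatingMap =
      (εX * εY) • detForm (Fin.cons L T : Fin (m + n + 1) → Amb m n →ₗ[ℝ] ℝ) := by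
    rw [← h2, AlternatingMap.curryLeft_smul, LinearMap.smul_apply, smul_smul, hε, one_smul]
    rfl
  rw [h5, hO, h1, wedge_smul_smul, wedge_detForm, one_mul]
  ext v
  rw [AlternatingMap.domDomCongr_apply, AlternatingMap.smul_apply, AlternatingMap.smul_apply,
    detForm_apply, detForm_apply,
    ← Matrix.det_submatrix_equiv_self (finCongr (Nat.add_comm 1 (m + n)))]
  congr 2
  ext i j
  simp only [Matrix.submatrix_apply, Matrix.of_apply, Function.comp_apply]
  congr 1
  refine Fin.addCases (fun i => ?_) (fun i => ?_) i
  · rw [Fin.append_left, Subsingleton.elim i 0]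
    have : finCongr (Nat.add_comm 1 (m + n)) (Fin.castAdd (m + n) 0) = 0 := by
      ext; simp
    rw [this, Fin.cons_zero]
  · rw [Fin.append_right]
    have : finCongr (Nat.add_comm 1 (m + n)) (Fin.natAdd 1 i) = i.succ := by
      ext; simp
    rw [this, Fin.cons_succ]

end OrbitForm

/-! ### Inverse stereographic projection: conformality and behaviour at infinity -/

section Stereo

variable {d : ℕ}

/-- Inverse stereographic projection, with values in Euclidean space. -/
def stereo (y : Fin d → ℝ) : EuclideanSpace ℝ (Fin (d + 1)) := WithLp.toLp 2 (invStereo y)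

/-- The conformal factor `2 / (1 + |y|²)` of inverse stereographic projection. -/
def stereoFactor (y : Fin d → ℝ) : ℝ := 2 / (∑ i, y i ^ 2 + 1)

/-- The vector from the projection centre `(1, 0)` to the point `(0, y)`. -/
def stereoRay (y : Fin d → ℝ) : EuclideanSpace ℝ (Fin (d + 1)) :=
  WithLp.toLp 2 (Fin.cons (-1) y)

/-- The partial derivatives of inverse stereographic projection. -/
def stereoFrame (y : Fin d → ℝ) (i : Fin d) : EuclideanSpace ℝ (Fin (d + 1)) :=
  stereoFactor y • EuclideanSpace.single i.succ 1 - (stereoFactor y ^ 2 * y i) • stereoRay y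

theorem sum_sq_add_one_pos (y : Fin d → ℝ) : 0 < ∑ i, y i ^ 2 + 1 := by positivity

theorem stereoFactor_pos (y : Fin d → ℝ) : 0 < stereoFactor y :=
  div_pos two_pos (sum_sq_add_one_pos y)

/-- The point of the sphere lies on the ray from the projection centre. In this form all norms and
inner products follow from the single relation `stereoFactor_mul`. -/
theorem stereo_eq (y : Fin d → ℝ) :
    stereo y = EuclideanSpace.single 0 1 + stereoFactor y • stereoRay y := by
  have := (sum_sq_add_one_pos y).ne'
  ext i
  refine Fin.cases ?_ (fun i => ?_) i
  · simp only [stereo, invStereo, stereoFactor, stereoRay, PiLp.add_apply, PiLp.smul_apply,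
      Fin.cons_zero, smul_eq_mul, PiLp.single_apply, if_true]
    field_simp
    ring
  · simp only [stereo, invStereo, stereoFactor, stereoRay, PiLp.add_apply, PiLp.smul_apply,
      Fin.cons_succ, smul_eq_mul, PiLp.single_apply, Fin.succ_ne_zero, if_false]
    field_simp
    ring

theorem inner_stereoRay_self (y : Fin d → ℝ) :
    inner ℝ (stereoRay y) (stereoRay y) = ∑ i, y i ^ 2 + 1 := by
  rw [PiLp.inner_apply, Fin.sum_univ_succ]
  simp [stereoRay, add_comm, sq]

theorem inner_single_succ_stereoRay (y : Fin d → ℝ) (i : Fin d) :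
    inner ℝ (EuclideanSpace.single i.succ (1 : ℝ)) (stereoRay y) = y i := by
  simp [stereoRay, EuclideanSpace.inner_single_left]

theorem inner_single_zero_stereoRay (y : Fin d → ℝ) :
    inner ℝ (EuclideanSpace.single (0 : Fin (d + 1)) (1 : ℝ)) (stereoRay y) = -1 := by
  simp [stereoRay, EuclideanSpace.inner_single_left]

theorem inner_single_single (i j : Fin (d + 1)) :
    inner ℝ (EuclideanSpace.single i (1 : ℝ)) (EuclideanSpace.single j (1 : ℝ)) =
      if i = j then 1 else 0 := by
  simp [EuclideanSpace.inner_single_left]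

theorem stereoFactor_mul (y : Fin d → ℝ) : stereoFactor y * (∑ i, y i ^ 2 + 1) = 2 :=
  div_mul_cancel₀ _ (sum_sq_add_one_pos y).ne'

/-- Conformality of stereographic projection. Orthogonality of the frame turns Jacobians into
products of lengths. -/
theorem inner_stereoFrame (y : Fin d → ℝ) (i j : Fin d) :
    inner ℝ (stereoFrame y i) (stereoFrame y j) = if i = j then stereoFactor y ^ 2 else 0 := by
  have h := stereoFactor_mul y
  simp only [stereoFrame, inner_sub_left, inner_sub_right, inner_smul_left, inner_smul_right,
    inner_stereoRay_self, inner_single_succ_stereoRay, inner_single_single,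
    real_inner_comm (EuclideanSpace.single _ _) (stereoRay y), conj_trivial, Fin.succ_inj]
  split_ifs <;> linear_combination (stereoFactor y ^ 3 * y i * y j) * h

theorem norm_stereoFrame (y : Fin d → ℝ) (i : Fin d) : ‖stereoFrame y i‖ = stereoFactor y := by
  rw [← sq_eq_sq₀ (norm_nonneg _) (stereoFactor_pos y).le, ← real_inner_self_eq_norm_sq,
    inner_stereoFrame, if_pos rfl]

theorem norm_stereo (y : Fin d → ℝ) : ‖stereo y‖ = 1 := by
  have h := stereoFactor_mul y
  rw [← sq_eq_sq₀ (norm_nonneg _) zero_le_one, ← real_inner_self_eq_norm_sq, stereo_eq]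
  simp only [inner_add_left, inner_add_right, inner_smul_left, inner_smul_right,
    inner_stereoRay_self, inner_single_zero_stereoRay, inner_single_single,
    real_inner_comm (EuclideanSpace.single _ _) (stereoRay y), conj_trivial, if_true]
  linear_combination stereoFactor y * h

theorem inner_stereo_stereoFrame (y : Fin d → ℝ) (i : Fin d) :
    inner ℝ (stereo y) (stereoFrame y i) = 0 := by
  have h := stereoFactor_mul y
  rw [stereo_eq]
  simp only [stereoFrame, inner_add_left, inner_sub_right, inner_smul_left, inner_smul_right,
    inner_stereoRay_self, inner_single_zero_stereoRay, inner_single_single,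
    inner_single_succ_stereoRay,
    real_inner_comm (EuclideanSpace.single _ _) (stereoRay y), conj_trivial,
    (Fin.succ_ne_zero i).symm, if_false]
  linear_combination (-stereoFactor y ^ 2 * y i) * h

theorem norm_stereo_sub_single (y : Fin d → ℝ) :
    ‖stereo y - EuclideanSpace.single 0 1‖ ^ 2 = 2 * stereoFactor y := by
  have h := stereoFactor_mul y
  rw [stereo_eq, add_sub_cancel_left, ← real_inner_self_eq_norm_sq]
  simp only [inner_smul_left, inner_smul_right, inner_stereoRay_self, conj_trivial]
  linear_combination stereoFactor y * h

theorem contDiff_stereoFactor : ContDiff ℝ ∞ (stereoFactor : (Fin d → ℝ) → ℝ) := by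
  refine ContDiff.div contDiff_const ?_ fun y => (sum_sq_add_one_pos y).ne'
  fun_prop

theorem contDiff_stereoRay : ContDiff ℝ ∞ (stereoRay : (Fin d → ℝ) → _) := by
  rw [contDiff_euclidean]
  intro i
  refine Fin.cases ?_ (fun i => ?_) i
  · simp only [stereoRay, Fin.cons_zero]; fun_prop
  · simp only [stereoRay, Fin.cons_succ]; fun_prop

theorem contDiff_stereo : ContDiff ℝ ∞ (stereo : (Fin d → ℝ) → _) := by
  rw [show (stereo : (Fin d → ℝ) → _) = _ from funext stereo_eq]
  exact contDiff_const.add (contDiff_stereoFactor.smul contDiff_stereoRay)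

/-- On the `i`-th coordinate line `|y|²` grows by `2 yᵢ t + t²` and the ray moves linearly, so a
one-variable derivative suffices. -/
theorem fderiv_stereo_single (y : Fin d → ℝ) (i : Fin d) :
    fderiv ℝ stereo y (Pi.single i 1) = stereoFrame y i := by
  have hf : HasFDerivAt stereo (fderiv ℝ stereo y) y :=
    (contDiff_stereo.differentiable (by simp) y).hasFDerivAt
  have hl : HasDerivAt (fun t : ℝ => y + t • Pi.single i (1 : ℝ)) (Pi.single i 1) 0 := by
    simpa using ((hasDerivAt_id (0 : ℝ)).smul_const (Pi.single i (1 : ℝ))).const_add y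
  have h1 : HasDerivAt (fun t : ℝ => stereo (y + t • Pi.single i (1 : ℝ)))
      (fderiv ℝ stereo y (Pi.single i 1)) 0 := by
    have hf' : HasFDerivAt (stereo : (Fin d → ℝ) → _) (fderiv ℝ stereo y)
        (y + (0 : ℝ) • Pi.single i (1 : ℝ)) := by rwa [zero_smul, add_zero]
    exact hf'.comp_hasDerivAt (0 : ℝ) hl
  refine h1.unique ?_
  have hs : ∀ t : ℝ, ∑ j, (y + t • Pi.single i (1 : ℝ) : Fin d → ℝ) j ^ 2 = ∑ j, y j ^ 2 + (2 * y i * t + t ^ 2) := by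
    intro t
    rw [← sub_eq_iff_eq_add', ← Finset.sum_sub_distrib, Finset.sum_eq_single i]
    · simp; ring
    · intro j _ hj
      simp [hj]
    · simp
  have hr : ∀ t : ℝ, stereoRay (y + t • Pi.single i (1 : ℝ)) =
      stereoRay y + t • EuclideanSpace.single i.succ (1 : ℝ) := by
    intro t
    ext j
    refine Fin.cases ?_ (fun j => ?_) j
    · simp [stereoRay]
    · simp [stereoRay, Pi.single_apply]
  have hN : HasDerivAt (fun t : ℝ => 2 / ((∑ j, y j ^ 2 + (2 * y i * t + t ^ 2)) + 1))
      (-(stereoFactor y ^ 2 * y i)) 0 := by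
    have h0 := (sum_sq_add_one_pos y).ne'
    have h2 : HasDerivAt (fun t : ℝ => (∑ j, y j ^ 2 + (2 * y i * t + t ^ 2)) + 1) (2 * y i) 0 := by
      have := ((((hasDerivAt_id (0 : ℝ)).const_mul (2 * y i)).add
        ((hasDerivAt_id (0 : ℝ)).pow 2)).const_add (∑ j, y j ^ 2)).add_const 1
      simpa using this
    have h3 := (hasDerivAt_const (0 : ℝ) (2 : ℝ)).div h2 (by simpa using h0)
    refine h3.congr_deriv ?_
    simp only [stereoFactor]
    norm_num
    field_simp
  have hR : HasDerivAt (fun t : ℝ => stereoRay y + t • EuclideanSpace.single i.succ (1 : ℝ))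
      (EuclideanSpace.single i.succ (1 : ℝ)) 0 := by
    simpa using ((hasDerivAt_id (0 : ℝ)).smul_const
      (EuclideanSpace.single i.succ (1 : ℝ))).const_add (stereoRay y)
  have h4 := (hN.smul hR).const_add (EuclideanSpace.single 0 (1 : ℝ))
  have h5 : (fun t : ℝ => stereo (y + t • Pi.single i (1 : ℝ))) = fun t =>
      EuclideanSpace.single 0 1 + (2 / ((∑ j, y j ^ 2 + (2 * y i * t + t ^ 2)) + 1)) •
        (stereoRay y + t • EuclideanSpace.single i.succ (1 : ℝ)) := by
    ext1 t
    rw [stereo_eq, hr, stereoFactor, hs]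
  rw [h5]
  refine h4.congr_deriv ?_
  simp [stereoFrame, stereoFactor, sub_eq_add_neg]

theorem stereoFactor_le (y : Fin d → ℝ) (i : Fin d) : stereoFactor y ≤ 2 * (1 + y i ^ 2)⁻¹ := by
  rw [stereoFactor, div_eq_mul_inv]
  have h : y i ^ 2 ≤ ∑ j, y j ^ 2 :=
    Finset.single_le_sum (f := fun j => y j ^ 2) (fun j _ => sq_nonneg _) (Finset.mem_univ i)
  have : 0 < 1 + y i ^ 2 := by positivity
  exact mul_le_mul_of_nonneg_left (inv_anti₀ this (by linarith)) two_pos.le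

theorem tendsto_inv_one_add_sq_cocompact :
    Tendsto (fun s : ℝ => (1 + s ^ 2)⁻¹) (cocompact ℝ) (𝓝 0) := by
  refine tendsto_inv_atTop_zero.comp (tendsto_atTop_add_const_left _ 1 ?_)
  have h := (tendsto_pow_atTop two_ne_zero).comp (tendsto_norm_cocompact_atTop (E := ℝ))
  refine h.congr fun s => ?_
  simp

/-- As one coordinate tends to infinity the chart closes up at the projection centre and its
derivatives vanish. This lets the artificial side faces cancel in Stokes' theorem. -/
theorem tendsto_stereoFactor_update (y : Fin d → ℝ) (i : Fin d) :
    Tendsto (fun s : ℝ => stereoFactor (Function.update y i s)) (cocompact ℝ) (𝓝 0) := by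
  refine squeeze_zero (fun s => (stereoFactor_pos _).le) (fun s => stereoFactor_le _ i) ?_
  simpa using tendsto_inv_one_add_sq_cocompact.const_mul 2

theorem tendsto_stereo_update (y : Fin d → ℝ) (i : Fin d) :
    Tendsto (fun s : ℝ => stereo (Function.update y i s)) (cocompact ℝ)
      (𝓝 (EuclideanSpace.single 0 1)) := by
  rw [tendsto_iff_norm_sub_tendsto_zero]
  have h : (fun s : ℝ => ‖stereo (Function.update y i s) - EuclideanSpace.single 0 1‖) =
      fun s => √(2 * stereoFactor (Function.update y i s)) := by
    ext1 s
    rw [← norm_stereo_sub_single, Real.sqrt_sq (norm_nonneg _)]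
  rw [h]
  simpa using ((tendsto_stereoFactor_update y i).const_mul 2).sqrt

theorem tendsto_stereoFrame_update (y : Fin d → ℝ) (i j : Fin d) :
    Tendsto (fun s : ℝ => stereoFrame (Function.update y i s) j) (cocompact ℝ) (𝓝 0) := by
  rw [tendsto_zero_iff_norm_tendsto_zero]
  simpa only [norm_stereoFrame] using tendsto_stereoFactor_update y i

end Stereo

/-! ### Parametrizing hypersurfaces swept out by orbits -/

section OrbitChart

variable {m n : ℕ}

/-- The coordinates on the first sphere. -/
def firstCoords (m n : ℕ) : (Fin (m + n) → ℝ) →L[ℝ] (Fin m → ℝ) :=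
  ContinuousLinearMap.pi fun i => ContinuousLinearMap.proj (Fin.castAdd n i)

/-- The coordinates on the second sphere. -/
def secondCoords (m n : ℕ) : (Fin (m + n) → ℝ) →L[ℝ] (Fin n → ℝ) :=
  ContinuousLinearMap.pi fun j => ContinuousLinearMap.proj (Fin.natAdd m j)

@[simp] theorem firstCoords_apply (q : Fin (m + n) → ℝ) (i : Fin m) :
    firstCoords m n q i = q (Fin.castAdd n i) := rfl

@[simp] theorem secondCoords_apply (q : Fin (m + n) → ℝ) (j : Fin n) :
    secondCoords m n q j = q (Fin.natAdd m j) := rfl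

/-- The parametrization of the unit sphere of the first factor. -/
def orbX (m n : ℕ) (q : Fin (m + n) → ℝ) : Amb m n := inclX m n (stereo (firstCoords m n q))

/-- The parametrization of the unit sphere of the second factor. -/
def orbY (m n : ℕ) (q : Fin (m + n) → ℝ) : Amb m n := inclY m n (stereo (secondCoords m n q))

/-- The parametrization of the orbit `Sᵐ(a) × Sⁿ(b)`. -/
def orbPoint (m n : ℕ) (a b : ℝ) (q : Fin (m + n) → ℝ) : Amb m n := a • orbX m n q + b • orbY m n q

/-- The partial derivatives of the parametrization of an orbit. -/
def orbFrame (m n : ℕ) (a b : ℝ) (q : Fin (m + n) → ℝ) : Fin (m + n) → Amb m n :=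
  Fin.append (fun i => a • inclX m n (stereoFrame (firstCoords m n q) i))
    (fun j => b • inclY m n (stereoFrame (secondCoords m n q) j))

/-- The parametrization of the hypersurface swept out by the orbits over a curve. -/
def orbitChart (m n : ℕ) (x y : ℝ → ℝ) (p : Fin (m + n + 1) → ℝ) : Amb m n :=
  orbPoint m n (x (p (Fin.last _))) (y (p (Fin.last _))) (Fin.init p)

/-- The cone is the hypersurface over a ray, so its boundary and its area are handled by the same
lemmas as those of the competitors. -/
theorem coneChart_eq_orbitChart :
    coneChart m n = orbitChart m n (fun t => t * radX m n) (fun t => t * radY m n) := by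
  ext p (i | i)
  · simp only [coneChart, orbitChart, orbPoint, orbX, orbY, stereo, PiLp.add_apply, PiLp.smul_apply,
      Sum.elim_inl, inclX_inl, inclY_inl, smul_eq_mul, mul_zero, add_zero, mul_assoc]
    rfl
  · simp only [coneChart, orbitChart, orbPoint, orbX, orbY, stereo, PiLp.add_apply, PiLp.smul_apply,
      Sum.elim_inr, inclX_inr, inclY_inr, smul_eq_mul, mul_zero, zero_add, mul_assoc]
    rfl

@[simp] theorem projX_orbX (q : Fin (m + n) → ℝ) :
    projX m n (orbX m n q) = stereo (firstCoords m n q) := projX_inclX _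

@[simp] theorem projY_orbX (q : Fin (m + n) → ℝ) : projY m n (orbX m n q) = 0 := projY_inclX _

@[simp] theorem projX_orbY (q : Fin (m + n) → ℝ) : projX m n (orbY m n q) = 0 := projX_inclY _

@[simp] theorem projY_orbY (q : Fin (m + n) → ℝ) :
    projY m n (orbY m n q) = stereo (secondCoords m n q) := projY_inclY _

theorem contDiff_inclX : ContDiff ℝ ∞ (inclX m n) :=
  (LinearMap.toContinuousLinearMap (inclX m n)).contDiff

theorem contDiff_inclY : ContDiff ℝ ∞ (inclY m n) :=
  (LinearMap.toContinuousLinearMap (inclY m n)).contDiff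

theorem contDiff_projX : ContDiff ℝ ∞ (projX m n) :=
  (LinearMap.toContinuousLinearMap (projX m n)).contDiff

theorem contDiff_projY : ContDiff ℝ ∞ (projY m n) :=
  (LinearMap.toContinuousLinearMap (projY m n)).contDiff

theorem contDiff_orbX : ContDiff ℝ ∞ (orbX m n) :=
  contDiff_inclX.comp (contDiff_stereo.comp (firstCoords m n).contDiff)

theorem contDiff_orbY : ContDiff ℝ ∞ (orbY m n) :=
  contDiff_inclY.comp (contDiff_stereo.comp (secondCoords m n).contDiff)

theorem firstCoords_single_castAdd (i : Fin m) :
    firstCoords m n (Pi.single (Fin.castAdd n i) 1) = Pi.single i 1 := by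
  ext k
  simp [Pi.single_apply]

theorem firstCoords_single_natAdd (j : Fin n) :
    firstCoords m n (Pi.single (Fin.natAdd m j) 1) = 0 := by
  ext k
  have : Fin.castAdd n k ≠ Fin.natAdd m j := by
    intro h
    have := congrArg Fin.val h
    simp at this
    omega
  simp [this]

theorem secondCoords_single_castAdd (i : Fin m) :
    secondCoords m n (Pi.single (Fin.castAdd n i) 1) = 0 := by
  ext k
  have : Fin.natAdd m k ≠ Fin.castAdd n i := by
    intro h
    have := congrArg Fin.val h
    simp at this
    omega
  simp [this]

theorem secondCoords_single_natAdd (j : Fin n) :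
    secondCoords m n (Pi.single (Fin.natAdd m j) 1) = Pi.single j 1 := by
  ext k
  simp [Pi.single_apply]

theorem hasFDerivAt_orbX (q : Fin (m + n) → ℝ) : HasFDerivAt (orbX m n)
    ((LinearMap.toContinuousLinearMap (inclX m n)).comp
      ((fderiv ℝ stereo (firstCoords m n q)).comp (firstCoords m n))) q :=
  (LinearMap.toContinuousLinearMap (inclX m n)).hasFDerivAt.comp q
    (HasFDerivAt.comp q ((contDiff_stereo.differentiable (by simp) _).hasFDerivAt)
      (firstCoords m n).hasFDerivAt)

theorem hasFDerivAt_orbY (q : Fin (m + n) → ℝ) : HasFDerivAt (orbY m n)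
    ((LinearMap.toContinuousLinearMap (inclY m n)).comp
      ((fderiv ℝ stereo (secondCoords m n q)).comp (secondCoords m n))) q :=
  (LinearMap.toContinuousLinearMap (inclY m n)).hasFDerivAt.comp q
    (HasFDerivAt.comp q ((contDiff_stereo.differentiable (by simp) _).hasFDerivAt)
      (secondCoords m n).hasFDerivAt)

theorem smul_fderiv_orbX_add (a b : ℝ) (q : Fin (m + n) → ℝ) (j : Fin (m + n)) :
    a • fderiv ℝ (orbX m n) q (Pi.single j 1) + b • fderiv ℝ (orbY m n) q (Pi.single j 1) =
      orbFrame m n a b q j := by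
  rw [(hasFDerivAt_orbX q).fderiv, (hasFDerivAt_orbY q).fderiv]
  refine Fin.addCases (fun i => ?_) (fun i => ?_) j
  · simp [orbFrame, firstCoords_single_castAdd, secondCoords_single_castAdd, fderiv_stereo_single]
  · simp [orbFrame, firstCoords_single_natAdd, secondCoords_single_natAdd, fderiv_stereo_single]

/-- Dropping the last coordinate. -/
def initL (k : ℕ) : (Fin (k + 1) → ℝ) →L[ℝ] (Fin k → ℝ) :=
  ContinuousLinearMap.pi fun i => ContinuousLinearMap.proj i.castSucc

theorem initL_apply {k : ℕ} (p : Fin (k + 1) → ℝ) : initL k p = Fin.init p := rfl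

theorem initL_single_castSucc {k : ℕ} (j : Fin k) :
    initL k (Pi.single j.castSucc 1) = Pi.single j 1 := by
  ext i
  simp [initL_apply, Fin.init, Pi.single_apply]

theorem initL_single_last {k : ℕ} : initL k (Pi.single (Fin.last k) 1) = 0 := by
  ext i
  simp [initL_apply, Fin.init, (Fin.castSucc_lt_last i).ne]

theorem contDiffAt_orbitChart {x y : ℝ → ℝ} {p : Fin (m + n + 1) → ℝ}
    (hx : ContDiffAt ℝ ∞ x (p (Fin.last _))) (hy : ContDiffAt ℝ ∞ y (p (Fin.last _))) :
    ContDiffAt ℝ ∞ (orbitChart m n x y) p := by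
  have hl : ContDiffAt ℝ ∞ (fun p : Fin (m + n + 1) → ℝ => p (Fin.last _)) p := by fun_prop
  have hX : ContDiffAt ℝ ∞ (fun p : Fin (m + n + 1) → ℝ => orbX m n (initL _ p)) p :=
    (contDiff_orbX.comp (initL _).contDiff).contDiffAt
  have hY : ContDiffAt ℝ ∞ (fun p : Fin (m + n + 1) → ℝ => orbY m n (initL _ p)) p :=
    (contDiff_orbY.comp (initL _).contDiff).contDiffAt
  exact ((hx.comp p hl).smul hX).add ((hy.comp p hl).smul hY)

theorem coordFrame_orbitChart {x y : ℝ → ℝ} {x' y' : ℝ} {p : Fin (m + n + 1) → ℝ}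
    (hx : HasDerivAt x x' (p (Fin.last _))) (hy : HasDerivAt y y' (p (Fin.last _))) :
    coordFrame (orbitChart m n x y) p =
      Fin.snoc (orbFrame m n (x (p (Fin.last _))) (y (p (Fin.last _))) (Fin.init p))
        (orbPoint m n x' y' (Fin.init p)) := by
  have hl : HasFDerivAt (fun p : Fin (m + n + 1) → ℝ => p (Fin.last _))
      (ContinuousLinearMap.proj (R := ℝ) (φ := fun _ => ℝ) (Fin.last (m + n))) p :=
    (ContinuousLinearMap.proj (R := ℝ) (φ := fun _ => ℝ) (Fin.last (m + n))).hasFDerivAt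
  have hX : HasFDerivAt (fun p : Fin (m + n + 1) → ℝ => orbX m n (initL _ p))
      ((fderiv ℝ (orbX m n) (Fin.init p)).comp (initL _)) p :=
    HasFDerivAt.comp p (hasFDerivAt_orbX _).differentiableAt.hasFDerivAt (initL _).hasFDerivAt
  have hY : HasFDerivAt (fun p : Fin (m + n + 1) → ℝ => orbY m n (initL _ p))
      ((fderiv ℝ (orbY m n) (Fin.init p)).comp (initL _)) p :=
    HasFDerivAt.comp p (hasFDerivAt_orbY _).differentiableAt.hasFDerivAt (initL _).hasFDerivAt
  have h := ((HasDerivAt.comp_hasFDerivAt p hx hl).smul hX).add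
    ((HasDerivAt.comp_hasFDerivAt p hy hl).smul hY)
  have h' : HasFDerivAt (orbitChart m n x y) _ p := h
  ext1 j
  rw [coordFrame, h'.fderiv]
  refine Fin.lastCases ?_ (fun j => ?_) j
  · have h0 : Fin.init (Pi.single (Fin.last (m + n)) (1 : ℝ) : Fin (m + n + 1) → ℝ) = 0 :=
      initL_single_last
    simp [orbPoint, initL_apply, h0]
  · rw [Fin.snoc_castSucc, ← smul_fderiv_orbX_add]
    simp [initL_single_castSucc, (Fin.castSucc_lt_last j).ne']

theorem norm_inclX (X : EuclideanSpace ℝ (Fin (m + 1))) : ‖inclX m n X‖ = ‖X‖ := by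
  rw [← sq_eq_sq₀ (norm_nonneg _) (norm_nonneg _), norm_sq_eq_projX_add_projY]
  simp

theorem norm_inclY (Y : EuclideanSpace ℝ (Fin (n + 1))) : ‖inclY m n Y‖ = ‖Y‖ := by
  rw [← sq_eq_sq₀ (norm_nonneg _) (norm_nonneg _), norm_sq_eq_projX_add_projY]
  simp

theorem projX_orbPoint (a b : ℝ) (q : Fin (m + n) → ℝ) :
    projX m n (orbPoint m n a b q) = a • stereo (firstCoords m n q) := by
  simp [orbPoint]

theorem projY_orbPoint (a b : ℝ) (q : Fin (m + n) → ℝ) :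
    projY m n (orbPoint m n a b q) = b • stereo (secondCoords m n q) := by
  simp [orbPoint]

theorem norm_orbPoint (a b : ℝ) (q : Fin (m + n) → ℝ) :
    ‖orbPoint m n a b q‖ = √(a ^ 2 + b ^ 2) := by
  rw [eq_comm, Real.sqrt_eq_iff_mul_self_eq (by positivity) (norm_nonneg _), ← sq,
    norm_sq_eq_projX_add_projY, projX_orbPoint, projY_orbPoint, norm_smul, norm_smul, norm_stereo,
    norm_stereo]
  simp

theorem inner_orbPoint (a b a' b' : ℝ) (q : Fin (m + n) → ℝ) :
    inner ℝ (orbPoint m n a b q) (orbPoint m n a' b' q) = a * a' + b * b' := by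
  rw [inner_eq_projX_add_projY, projX_orbPoint, projY_orbPoint, projX_orbPoint, projY_orbPoint]
  simp only [inner_smul_left, inner_smul_right, real_inner_self_eq_norm_sq, norm_stereo,
    conj_trivial]
  ring

theorem inner_orbPoint_orbFrame (a b a' b' : ℝ) (q : Fin (m + n) → ℝ) (j : Fin (m + n)) :
    inner ℝ (orbPoint m n a b q) (orbFrame m n a' b' q j) = 0 := by
  rw [inner_eq_projX_add_projY, projX_orbPoint, projY_orbPoint]
  refine Fin.addCases (fun i => ?_) (fun i => ?_) j
  · simp [orbFrame, inner_smul_left, inner_smul_right, inner_stereo_stereoFrame]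
  · simp [orbFrame, inner_smul_left, inner_smul_right, inner_stereo_stereoFrame]

theorem pairwise_inner_orbFrame (a b : ℝ) (q : Fin (m + n) → ℝ) :
    Pairwise fun i j => inner ℝ (orbFrame m n a b q i) (orbFrame m n a b q j) = 0 := by
  intro i j
  refine Fin.addCases (fun i => ?_) (fun i => ?_) i <;>
    refine Fin.addCases (fun j => ?_) (fun j => ?_) j <;> intro h <;>
    simp only [orbFrame, inner_eq_projX_add_projY, Fin.append_left, Fin.append_right,
      projX_inclX, projX_inclY, projY_inclX, projY_inclY, inner_smul_left, inner_smul_right,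
      inner_stereoFrame, inner_zero_left, inner_zero_right, mul_zero, add_zero, zero_add]
  · rw [if_neg (fun e => h (by rw [e]))]; simp
  · rw [if_neg (fun e => h (by rw [e]))]; simp

/-- The motion along the curve is radial in both factors, while the orbit directions are tangent to
the spheres. Hence the area element is the product of the lengths of the frame. -/
theorem pairwise_inner_snoc_orbFrame (a b a' b' : ℝ) (q : Fin (m + n) → ℝ) :
    Pairwise fun i j => inner ℝ
      ((Fin.snoc (orbFrame m n a b q) (orbPoint m n a' b' q) : Fin (m + n + 1) → Amb m n) i)
      ((Fin.snoc (orbFrame m n a b q) (orbPoint m n a' b' q) : Fin (m + n + 1) → Amb m n) j) = 0 := by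
  intro i j
  refine Fin.lastCases ?_ (fun i => ?_) i <;> refine Fin.lastCases ?_ (fun j => ?_) j <;> intro h
  · exact absurd rfl h
  · simpa using inner_orbPoint_orbFrame a' b' a b q j
  · simpa [real_inner_comm] using inner_orbPoint_orbFrame a' b' a b q i
  · simpa using pairwise_inner_orbFrame a b q (fun e => h (by rw [e]))

/-- The Jacobian of the product of two inverse stereographic projections. -/
def orbJacobian (m n : ℕ) (q : Fin (m + n) → ℝ) : ℝ :=
  stereoFactor (firstCoords m n q) ^ m * stereoFactor (secondCoords m n q) ^ n

theorem prod_norm_orbFrame (a b : ℝ) (q : Fin (m + n) → ℝ) :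
    ∏ j, ‖orbFrame m n a b q j‖ = |a| ^ m * |b| ^ n * orbJacobian m n q := by
  rw [Fin.prod_univ_add]
  simp only [orbFrame, Fin.append_left, Fin.append_right, norm_smul, norm_inclX, norm_inclY,
    norm_stereoFrame, Finset.prod_const, Finset.card_univ, Fintype.card_fin, Real.norm_eq_abs,
    mul_pow, orbJacobian]
  ring

/-- The conformal factor is at most `2 / (1 + yᵢ²)` for each single coordinate. Choosing a different
coordinate for each frame vector bounds the product by an integrable product of one-variable
weights. -/
theorem norm_orbFrame_le (a b : ℝ) (q : Fin (m + n) → ℝ) (j : Fin (m + n)) :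
    ‖orbFrame m n a b q j‖ ≤ 2 * (|a| + |b|) * (1 + q j ^ 2)⁻¹ := by
  refine Fin.addCases (fun i => ?_) (fun i => ?_) j
  · simp only [orbFrame, Fin.append_left, norm_smul, norm_inclX, norm_stereoFrame,
      Real.norm_eq_abs]
    calc |a| * stereoFactor (firstCoords m n q) ≤ (|a| + |b|) * (2 * (1 + q (Fin.castAdd n i) ^ 2)⁻¹) :=
          mul_le_mul (le_add_of_nonneg_right (abs_nonneg _)) (stereoFactor_le _ i)
            (stereoFactor_pos _).le (by positivity)
      _ = _ := by ring
  · simp only [orbFrame, Fin.append_right, norm_smul, norm_inclY, norm_stereoFrame,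
      Real.norm_eq_abs]
    calc |b| * stereoFactor (secondCoords m n q) ≤ (|a| + |b|) * (2 * (1 + q (Fin.natAdd m i) ^ 2)⁻¹) :=
          mul_le_mul (le_add_of_nonneg_left (abs_nonneg _)) (stereoFactor_le _ i)
            (stereoFactor_pos _).le (by positivity)
      _ = _ := by ring

theorem continuous_orbJacobian : Continuous (orbJacobian m n) :=
  ((contDiff_stereoFactor.continuous.comp (firstCoords m n).continuous).pow m).mul
    ((contDiff_stereoFactor.continuous.comp (secondCoords m n).continuous).pow n)

theorem orbJacobian_pos (q : Fin (m + n) → ℝ) : 0 < orbJacobian m n q :=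
  mul_pos (pow_pos (stereoFactor_pos _) _) (pow_pos (stereoFactor_pos _) _)

theorem firstCoords_update_castAdd (q : Fin (m + n) → ℝ) (i : Fin m) (s : ℝ) :
    firstCoords m n (Function.update q (Fin.castAdd n i) s) =
      Function.update (firstCoords m n q) i s := by
  ext k
  simp [Function.update_apply]

theorem firstCoords_update_natAdd (q : Fin (m + n) → ℝ) (j : Fin n) (s : ℝ) :
    firstCoords m n (Function.update q (Fin.natAdd m j) s) = firstCoords m n q := by
  ext k
  have : Fin.castAdd n k ≠ Fin.natAdd m j := by
    intro h
    have := congrArg Fin.val h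
    simp at this
    omega
  simp [this]

theorem secondCoords_update_castAdd (q : Fin (m + n) → ℝ) (i : Fin m) (s : ℝ) :
    secondCoords m n (Function.update q (Fin.castAdd n i) s) = secondCoords m n q := by
  ext k
  have : Fin.natAdd m k ≠ Fin.castAdd n i := by
    intro h
    have := congrArg Fin.val h
    simp at this
    omega
  simp [this]

theorem secondCoords_update_natAdd (q : Fin (m + n) → ℝ) (j : Fin n) (s : ℝ) :
    secondCoords m n (Function.update q (Fin.natAdd m j) s) =
      Function.update (secondCoords m n q) j s := by
  ext k
  simp [Function.update_apply]

/-- The parametrization of an orbit closes up at infinity. -/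
theorem exists_tendsto_orbPoint_update (q : Fin (m + n) → ℝ) (j : Fin (m + n)) :
    ∃ U V : Amb m n, ∀ a b : ℝ, Tendsto (fun s : ℝ => orbPoint m n a b (Function.update q j s))
      (cocompact ℝ) (𝓝 (a • U + b • V)) := by
  have hiX := contDiff_inclX (m := m) (n := n) |>.continuous
  have hiY := contDiff_inclY (m := m) (n := n) |>.continuous
  refine Fin.addCases (fun i => ?_) (fun i => ?_) j
  · refine ⟨inclX m n (EuclideanSpace.single 0 1), orbY m n q, fun a b => ?_⟩
    simp only [orbPoint, orbX, orbY, firstCoords_update_castAdd, secondCoords_update_castAdd]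
    exact ((((hiX.tendsto _).comp (tendsto_stereo_update _ i)).const_smul a).add tendsto_const_nhds)
  · refine ⟨orbX m n q, inclY m n (EuclideanSpace.single 0 1), fun a b => ?_⟩
    simp only [orbPoint, orbX, orbY, firstCoords_update_natAdd, secondCoords_update_natAdd]
    exact (tendsto_const_nhds.add (((hiY.tendsto _).comp (tendsto_stereo_update _ i)).const_smul b))

/-- The frame vectors on the sphere containing the `j`-th coordinate shrink to zero, and those on
the other sphere do not depend on that coordinate. -/
theorem exists_tendsto_orbFrame_update (q : Fin (m + n) → ℝ) (j l : Fin (m + n)) :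
    ∃ U : ℝ → ℝ → Amb m n, ∀ a b : ℝ,
      Tendsto (fun s : ℝ => orbFrame m n a b (Function.update q j s) l) (cocompact ℝ)
        (𝓝 (U a b)) := by
  have hiX := contDiff_inclX (m := m) (n := n) |>.continuous
  have hiY := contDiff_inclY (m := m) (n := n) |>.continuous
  refine Fin.addCases (fun i => ?_) (fun i => ?_) j <;>
    refine Fin.addCases (fun l => ?_) (fun l => ?_) l
  · refine ⟨fun a _ => a • inclX m n 0, fun a b => ?_⟩
    simp only [orbFrame, Fin.append_left, firstCoords_update_castAdd]
    exact (((hiX.tendsto _).comp (tendsto_stereoFrame_update _ i l)).const_smul a)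
  · refine ⟨fun _ b => b • inclY m n (stereoFrame (secondCoords m n q) l), fun a b => ?_⟩
    simp only [orbFrame, Fin.append_right, secondCoords_update_castAdd]
    exact tendsto_const_nhds
  · refine ⟨fun a _ => a • inclX m n (stereoFrame (firstCoords m n q) l), fun a b => ?_⟩
    simp only [orbFrame, Fin.append_left, firstCoords_update_natAdd]
    exact tendsto_const_nhds
  · refine ⟨fun _ b => b • inclY m n 0, fun a b => ?_⟩
    simp only [orbFrame, Fin.append_right, secondCoords_update_natAdd]
    exact (((hiY.tendsto _).comp (tendsto_stereoFrame_update _ i l)).const_smul b)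

end OrbitChart

/-! ### Stokes' theorem on slabs -/

section Stokes

/-- The integrable weights `1 / (1 + s²)` (and the indicator of `[a, b]` for the last variable). -/
def slabWeight {N : ℕ} (a b : ℝ) (i : Fin (N + 1)) (s : ℝ) : ℝ :=
  if i = Fin.last N then (Icc a b).indicator 1 s else (1 + s ^ 2)⁻¹

theorem integrable_slabWeight {N : ℕ} (a b : ℝ) (i : Fin (N + 1)) :
    Integrable (slabWeight a b i) := by
  by_cases h : i = Fin.last N
  · have : slabWeight a b i = (Icc a b).indicator 1 := by ext s; simp [slabWeight, h]
    rw [this, integrable_indicator_iff measurableSet_Icc]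
    exact continuousOn_const.integrableOn_compact isCompact_Icc
  · have : slabWeight a b i = fun s => (1 + s ^ 2)⁻¹ := by ext s; simp [slabWeight, h]
    rw [this]
    exact integrable_inv_one_add_sq

theorem slabWeight_nonneg {N : ℕ} (a b : ℝ) (i : Fin (N + 1)) (s : ℝ) : 0 ≤ slabWeight a b i s := by
  unfold slabWeight
  split_ifs
  · exact indicator_nonneg (fun _ _ => zero_le_one) _
  · positivity

/-- The slab `ℝᴺ × [a, b]`. -/
def slab (N : ℕ) (a b : ℝ) : Set (Fin (N + 1) → ℝ) :=
  {p | a ≤ p (Fin.last N) ∧ p (Fin.last N) ≤ b}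

theorem isClosed_slab (N : ℕ) (a b : ℝ) : IsClosed (slab N a b) :=
  isClosed_Icc.preimage (continuous_apply (Fin.last N))

theorem measurableSet_slab (N : ℕ) (a b : ℝ) : MeasurableSet (slab N a b) :=
  (isClosed_slab N a b).measurableSet

/-- The boxes exhausting a slab. -/
def slabBox (N : ℕ) (a b : ℝ) (k : ℕ) : Set (Fin (N + 1) → ℝ) :=
  Icc (Fin.snoc (fun _ : Fin N => -(k : ℝ)) a) (Fin.snoc (fun _ : Fin N => (k : ℝ)) b)

theorem mem_slabBox {N : ℕ} {a b : ℝ} {k : ℕ} {p : Fin (N + 1) → ℝ} :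
    p ∈ slabBox N a b k ↔ p ∈ slab N a b ∧ ∀ j : Fin N, |p j.castSucc| ≤ k := by
  simp only [slabBox, mem_Icc, Pi.le_def, slab, mem_ofPred_eq, abs_le]
  constructor
  · intro h
    have h1 := h.1 (Fin.last N)
    have h2 := h.2 (Fin.last N)
    simp only [Fin.snoc_last] at h1 h2
    refine ⟨⟨h1, h2⟩, fun j => ?_⟩
    have h3 := h.1 j.castSucc
    have h4 := h.2 j.castSucc
    simp only [Fin.snoc_castSucc] at h3 h4
    exact ⟨h3, h4⟩
  · intro h
    refine ⟨fun i => ?_, fun i => ?_⟩ <;> refine Fin.lastCases ?_ (fun j => ?_) i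
    · simpa using h.1.1
    · simpa using (h.2 j).1
    · simpa using h.1.2
    · simpa using (h.2 j).2

theorem exists_nat_forall_abs_le {N : ℕ} (q : Fin N → ℝ) : ∃ k : ℕ, ∀ j, |q j| ≤ k := by
  obtain ⟨k, hk⟩ := exists_nat_ge ‖q‖
  exact ⟨k, fun j => (norm_le_pi_norm q j).trans hk⟩

theorem iUnion_slabBox (N : ℕ) (a b : ℝ) : ⋃ k, slabBox N a b k = slab N a b := by
  ext p
  simp only [mem_iUnion, mem_slabBox]
  refine ⟨fun ⟨_, h⟩ => h.1, fun h => ?_⟩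
  obtain ⟨k, hk⟩ := exists_nat_forall_abs_le (Fin.init p)
  exact ⟨k, h, hk⟩

theorem monotone_slabBox (N : ℕ) (a b : ℝ) : Monotone (slabBox N a b) := by
  intro k l hkl p hp
  rw [mem_slabBox] at hp ⊢
  exact ⟨hp.1, fun j => (hp.2 j).trans (by exact_mod_cast hkl)⟩

variable {E : Type*} [NormedAddCommGroup E] [InnerProductSpace ℝ E] {N : ℕ}
  {F : (Fin (N + 1) → ℝ) → E} {a b K : ℝ}

theorem continuousOn_coordFrame (hF : ∀ p ∈ slab N a b, ContDiffAt ℝ ∞ F p) :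
    ContinuousOn (coordFrame F) (slab N a b) := by
  refine continuousOn_pi.2 fun i p hp => ContinuousAt.continuousWithinAt ?_
  have h1 : ContinuousAt (fderiv ℝ F) p :=
    ((hF p hp).fderiv_right (m := 0) (by norm_cast)).continuousAt
  exact h1.clm_apply continuousAt_const

/-- The component of the pulled back form that omits the `i`-th variable. -/
def pullbackCoeff (F : (Fin (N + 1) → ℝ) → E) (φ : DiffForm E N) (i : Fin (N + 1))
    (p : Fin (N + 1) → ℝ) : ℝ :=
  φ (F p) fun j => coordFrame F p (i.succAbove j)

theorem continuousOn_pullbackCoeff (hF : ∀ p ∈ slab N a b, ContDiffAt ℝ ∞ F p) {φ : DiffForm E N}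
    (hφ : Continuous φ) (i : Fin (N + 1)) : ContinuousOn (pullbackCoeff F φ i) (slab N a b) := by
  have h1 : ContinuousOn (fun p => φ (F p)) (slab N a b) :=
    hφ.comp_continuousOn fun p hp => (hF p hp).continuousAt.continuousWithinAt
  have h2 : ContinuousOn (fun p => fun j => coordFrame F p (i.succAbove j)) (slab N a b) :=
    continuousOn_pi.2 fun j => continuousOn_pi.1 (continuousOn_coordFrame hF) (i.succAbove j)
  exact h1.eval h2

theorem continuousOn_apply_coordFrame (hF : ∀ p ∈ slab N a b, ContDiffAt ℝ ∞ F p)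
    {φ : DiffForm E (N + 1)} (hφ : Continuous φ) :
    ContinuousOn (fun p => φ (F p) (coordFrame F p)) (slab N a b) := by
  have h1 : ContinuousOn (fun p => φ (F p)) (slab N a b) :=
    hφ.comp_continuousOn fun p hp => (hF p hp).continuousAt.continuousWithinAt
  exact h1.eval (continuousOn_coordFrame hF)

/-- The weight of the omitted variable `i` is absent from the bound, so the bound is uniform on all
faces on which that variable is constant. -/
theorem abs_pullbackCoeff_le {φ : DiffForm E N} {C : ℝ} (hC : ∀ x, ‖φ x‖ ≤ C)
    (hK : ∀ p ∈ slab N a b, ∀ i, ‖coordFrame F p i‖ ≤ K * slabWeight a b i (p i))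
    (i : Fin (N + 1)) {p : Fin (N + 1) → ℝ} (hp : p ∈ slab N a b) :
    |pullbackCoeff F φ i p| ≤
      C * K ^ N * ∏ j, slabWeight a b (i.succAbove j) (p (i.succAbove j)) := by
  refine ((φ (F p)).le_opNorm _).trans ?_
  have h0 : 0 ≤ C := (norm_nonneg _).trans (hC 0)
  rw [mul_assoc]
  refine mul_le_mul (hC _) ?_ (Finset.prod_nonneg fun _ _ => norm_nonneg _) h0
  calc ∏ j, ‖coordFrame F p (i.succAbove j)‖
      ≤ ∏ j, K * slabWeight a b (i.succAbove j) (p (i.succAbove j)) :=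
        Finset.prod_le_prod (fun _ _ => norm_nonneg _) fun j _ => hK p hp _
    _ = _ := by simp [Finset.prod_mul_distrib]

theorem abs_apply_coordFrame_le {φ : DiffForm E (N + 1)} {C : ℝ} (hC : ∀ x, ‖φ x‖ ≤ C)
    (hK : ∀ p ∈ slab N a b, ∀ i, ‖coordFrame F p i‖ ≤ K * slabWeight a b i (p i))
    {p : Fin (N + 1) → ℝ} (hp : p ∈ slab N a b) :
    |φ (F p) (coordFrame F p)| ≤ C * K ^ (N + 1) * ∏ j, slabWeight a b j (p j) := by
  refine ((φ (F p)).le_opNorm _).trans ?_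
  have h0 : 0 ≤ C := (norm_nonneg _).trans (hC 0)
  rw [mul_assoc]
  refine mul_le_mul (hC _) ?_ (Finset.prod_nonneg fun _ _ => norm_nonneg _) h0
  calc ∏ j, ‖coordFrame F p j‖ ≤ ∏ j, K * slabWeight a b j (p j) :=
        Finset.prod_le_prod (fun _ _ => norm_nonneg _) fun j _ => hK p hp _
    _ = _ := by simp [Finset.prod_mul_distrib]

theorem integrableOn_apply_coordFrame (hF : ∀ p ∈ slab N a b, ContDiffAt ℝ ∞ F p)
    {φ : DiffForm E (N + 1)} (hφ : Continuous φ) {C : ℝ} (hC : ∀ x, ‖φ x‖ ≤ C)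
    (hK : ∀ p ∈ slab N a b, ∀ i, ‖coordFrame F p i‖ ≤ K * slabWeight a b i (p i)) :
    IntegrableOn (fun p => φ (F p) (coordFrame F p)) (slab N a b) := by
  have hi : Integrable fun p : Fin (N + 1) → ℝ => C * K ^ (N + 1) * ∏ j, slabWeight a b j (p j) :=
    (Integrable.fintype_prod fun j => integrable_slabWeight a b j).const_mul _
  refine Integrable.mono' hi.integrableOn
    ((continuousOn_apply_coordFrame hF hφ).aestronglyMeasurable (measurableSet_slab N a b)) ?_
  exact (ae_restrict_iff' (measurableSet_slab N a b)).2
    (Eventually.of_forall fun p hp => abs_apply_coordFrame_le hC hK hp)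

theorem differentiableAt_pullback {p : Fin (N + 1) → ℝ} (hF : ContDiffAt ℝ ∞ F p)
    {φ : DiffForm E N} (hφ : Differentiable ℝ φ) :
    DifferentiableAt ℝ (fun p => (φ (F p)).compContinuousLinearMap (fderiv ℝ F p)) p := by
  have h1 : DifferentiableAt ℝ (fun p => φ (F p)) p :=
    (hφ _).comp p (hF.differentiableAt (by simp))
  have h2 : DifferentiableAt ℝ (fderiv ℝ F) p :=
    (hF.fderiv_right (m := 1) (by norm_cast)).differentiableAt one_ne_zero
  exact h1.continuousAlternatingMapCompContinuousLinearMap h2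

theorem differentiableAt_pullbackCoeff {p : Fin (N + 1) → ℝ} (hF : ContDiffAt ℝ ∞ F p)
    {φ : DiffForm E N} (hφ : Differentiable ℝ φ) (i : Fin (N + 1)) :
    DifferentiableAt ℝ (pullbackCoeff F φ i) p :=
  (differentiableAt_pullback hF hφ).continuousAlternatingMap_apply_const
    fun j => Pi.single (i.succAbove j) 1

theorem two_le_smooth : minSmoothness ℝ 2 ≤ (∞ : WithTop ℕ∞) := by
  rw [minSmoothness_of_isRCLikeNormedField]
  exact WithTop.coe_le_coe.2 le_top

/-- Exterior differentiation commutes with pullback. On the standard basis the derivative of the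
pulled-back form is a divergence, to which the divergence theorem on boxes applies. -/
theorem extDeriv_apply_coordFrame {p : Fin (N + 1) → ℝ} (hF : ContDiffAt ℝ ∞ F p)
    {φ : DiffForm E N} (hφ : Differentiable ℝ φ) :
    extDeriv φ (F p) (coordFrame F p) =
      ∑ i : Fin (N + 1), ((-1) ^ i.val • fderiv ℝ (pullbackCoeff F φ i) p) (Pi.single i 1) := by
  have h1 := extDeriv_pullback (𝕜 := ℝ) (hφ (F p)) hF two_le_smooth
  have h2 := congrArg (fun ξ => ξ fun i : Fin (N + 1) => (Pi.single i 1 : Fin (N + 1) → ℝ)) h1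
  have h3 := extDeriv_apply (differentiableAt_pullback hF hφ)
    fun i : Fin (N + 1) => (Pi.single i 1 : Fin (N + 1) → ℝ)
  simp only [h3] at h2
  refine Eq.trans ?_ (h2.symm.trans ?_)
  · rfl
  · rfl

theorem slab_insertNth {i : Fin (N + 1)} (l : Fin N)
    (hl : i.succAbove l = Fin.last N) (s : ℝ) (q : Fin N → ℝ) :
    (Fin.insertNth i s q : Fin (N + 1) → ℝ) ∈ slab N a b ↔ q l ∈ Icc a b := by
  have : (Fin.insertNth i s q : Fin (N + 1) → ℝ) (Fin.last N) = q l := by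
    rw [← hl, Fin.insertNth_apply_succAbove]
  rw [slab, mem_ofPred_eq, this, mem_Icc]

/-- Opposite side faces tend to the same limit, because the chart and its frame have one limit as
the coordinate leaves every compact set. The limit passes under the integral because the dominating
function does not involve that coordinate. -/
theorem tendsto_side_face (hK0 : 0 ≤ K) (hF : ∀ p ∈ slab N a b, ContDiffAt ℝ ∞ F p)
    (hK : ∀ p ∈ slab N a b, ∀ i, ‖coordFrame F p i‖ ≤ K * slabWeight a b i (p i))
    {φ : DiffForm E N} (hφ : Continuous φ) {C : ℝ} (hC : ∀ x, ‖φ x‖ ≤ C)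
    {i : Fin (N + 1)} (hi : i ≠ Fin.last N)
    (hlim : ∀ p ∈ slab N a b, (∃ L, Tendsto (fun s => F (Function.update p i s)) (cocompact ℝ) (𝓝 L)) ∧
      ∀ l ≠ i, ∃ L, Tendsto (fun s => coordFrame F (Function.update p i s) l) (cocompact ℝ) (𝓝 L))
    (B : ℕ → Set (Fin N → ℝ)) (hB : ∀ k, IsCompact (B k))
    (hBs : ∀ k, ∀ q ∈ B k, ∀ s : ℝ, (Fin.insertNth i s q : Fin (N + 1) → ℝ) ∈ slab N a b) :
    Tendsto (fun k : ℕ => (∫ q in B k, pullbackCoeff F φ i (Fin.insertNth i (k : ℝ) q)) -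
      ∫ q in B k, pullbackCoeff F φ i (Fin.insertNth i (-(k : ℝ)) q)) atTop (𝓝 0) := by
  obtain ⟨l, hl⟩ := Fin.exists_succAbove_eq hi.symm
  have hcont : ∀ (s : ℝ) (k : ℕ),
      ContinuousOn (fun q => pullbackCoeff F φ i (Fin.insertNth i s q)) (B k) := by
    intro s k
    refine (continuousOn_pullbackCoeff hF hφ i).comp ?_ fun q hq => hBs k q hq s
    exact (Continuous.finInsertNth (A := fun _ => ℝ) i continuous_const continuous_id).continuousOn
  have hint : ∀ (s : ℝ) (k : ℕ),
      IntegrableOn (fun q => pullbackCoeff F φ i (Fin.insertNth i s q)) (B k) :=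
    fun s k => (hcont s k).integrableOn_compact (hB k)
  have h1 : ∀ k : ℕ, (∫ q in B k, pullbackCoeff F φ i (Fin.insertNth i (k : ℝ) q)) -
      ∫ q in B k, pullbackCoeff F φ i (Fin.insertNth i (-(k : ℝ)) q) =
      ∫ q, (B k).indicator (fun q => pullbackCoeff F φ i (Fin.insertNth i (k : ℝ) q) -
        pullbackCoeff F φ i (Fin.insertNth i (-(k : ℝ)) q)) q := by
    intro k
    rw [integral_indicator (hB k).measurableSet, integral_sub (hint _ k) (hint _ k)]
  simp only [h1]
  rw [← integral_zero (Fin N → ℝ) ℝ]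
  refine tendsto_integral_of_dominated_convergence
    (fun q => 2 * (C * K ^ N * ∏ j, slabWeight a b (i.succAbove j) (q j))) (fun k => ?_) ?_
    (fun k => Eventually.of_forall fun q => ?_) (Eventually.of_forall fun q => ?_)
  · rw [aestronglyMeasurable_indicator_iff (hB k).measurableSet]
    exact ((hcont _ k).sub (hcont _ k)).aestronglyMeasurable (hB k).measurableSet
  · exact ((Integrable.fintype_prod fun j =>
      integrable_slabWeight a b (i.succAbove j)).const_mul _).const_mul _
  · have h0 : 0 ≤ C := (norm_nonneg _).trans (hC 0)
    by_cases hq : q ∈ B k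
    · rw [indicator_of_mem hq, Real.norm_eq_abs, two_mul]
      refine (abs_sub _ _).trans (add_le_add ?_ ?_)
      · simpa using abs_pullbackCoeff_le hC hK i (hBs k q hq k)
      · simpa using abs_pullbackCoeff_le hC hK i (hBs k q hq (-k))
    · rw [indicator_of_notMem hq, norm_zero, mul_comm C, mul_assoc]
      have := Finset.prod_nonneg fun j (_ : j ∈ Finset.univ) =>
        slabWeight_nonneg a b (i.succAbove j) (q j)
      positivity
  · by_cases hq : q l ∈ Icc a b
    · have hmem : ∀ s : ℝ, (Fin.insertNth i s q : Fin (N + 1) → ℝ) ∈ slab N a b :=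
        fun s => (slab_insertNth l hl s q).2 hq
      have hup : ∀ s : ℝ, Function.update (Fin.insertNth i 0 q : Fin (N + 1) → ℝ) i s =
          Fin.insertNth i s q := fun s => Fin.update_insertNth _ _ _ _
      obtain ⟨⟨L, hL⟩, hfr⟩ := hlim _ (hmem 0)
      choose! M hM using hfr
      simp only [hup] at hL hM
      -- The form on the face omits the direction `i`, so only limits of the other frame vectors are
      -- needed.
      have hψ : Tendsto (fun s : ℝ => pullbackCoeff F φ i (Fin.insertNth i s q)) (cocompact ℝ)
          (𝓝 (φ L fun j => M (i.succAbove j))) :=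
        ((hφ.tendsto L).comp hL).eval
          (tendsto_pi_nhds.2 fun j => hM _ (Fin.succAbove_ne i j))
      have hk : Tendsto (fun k : ℕ => (k : ℝ)) atTop (cocompact ℝ) :=
        tendsto_natCast_atTop_atTop.mono_right atTop_le_cocompact
      have hk' : Tendsto (fun k : ℕ => -(k : ℝ)) atTop (cocompact ℝ) :=
        (tendsto_neg_atTop_atBot.comp tendsto_natCast_atTop_atTop).mono_right atBot_le_cocompact
      have hd := (hψ.comp hk).sub (hψ.comp hk')
      rw [sub_self] at hd
      rw [tendsto_zero_iff_norm_tendsto_zero] at hd ⊢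
      refine squeeze_zero (fun _ => norm_nonneg _) (fun k => ?_) hd
      exact norm_indicator_le_norm_self _ _
    · refine tendsto_const_nhds.congr fun k => ?_
      rw [indicator_of_notMem]
      intro hqk
      exact hq ((slab_insertNth l hl 0 q).1 (hBs k q hqk 0))

theorem snoc_mem_slab (q : Fin N → ℝ) (t : ℝ) :
    (Fin.snoc q t : Fin (N + 1) → ℝ) ∈ slab N a b ↔ t ∈ Icc a b := by
  rw [slab, mem_ofPred_eq, Fin.snoc_last, mem_Icc]

theorem iUnion_Icc_const_nat : ⋃ k : ℕ, Icc (fun _ : Fin N => -(k : ℝ)) (fun _ => (k : ℝ)) = univ := by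
  refine eq_univ_of_forall fun q => mem_iUnion.2 ?_
  obtain ⟨k, hk⟩ := exists_nat_forall_abs_le q
  exact ⟨k, fun j => (abs_le.1 (hk j)).1, fun j => (abs_le.1 (hk j)).2⟩

theorem monotone_Icc_const_nat :
    Monotone fun k : ℕ => Icc (fun _ : Fin N => -(k : ℝ)) (fun _ => (k : ℝ)) := by
  intro k l hkl
  have : (k : ℝ) ≤ l := by exact_mod_cast hkl
  exact Icc_subset_Icc (fun _ => neg_le_neg this) fun _ => this

theorem integrable_pullbackCoeff_last (hF : ∀ p ∈ slab N a b, ContDiffAt ℝ ∞ F p)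
    (hK : ∀ p ∈ slab N a b, ∀ i, ‖coordFrame F p i‖ ≤ K * slabWeight a b i (p i))
    {φ : DiffForm E N} (hφ : Continuous φ) {C : ℝ} (hC : ∀ x, ‖φ x‖ ≤ C) {t : ℝ}
    (ht : t ∈ Icc a b) :
    Integrable fun q => pullbackCoeff F φ (Fin.last N) (Fin.snoc q t) := by
  have hi : Integrable fun q : Fin N → ℝ =>
      C * K ^ N * ∏ j, slabWeight a b ((Fin.last N).succAbove j) (q j) :=
    (Integrable.fintype_prod fun j => integrable_slabWeight a b ((Fin.last N).succAbove j)).const_mul _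
  refine Integrable.mono' hi (Continuous.aestronglyMeasurable ?_) (Eventually.of_forall fun q => ?_)
  · refine (continuousOn_pullbackCoeff hF hφ _).comp_continuous (f := fun q : Fin N → ℝ =>
      (Fin.snoc q t : Fin (N + 1) → ℝ)) ?_ fun q => (snoc_mem_slab q t).2 ht
    exact Continuous.finSnoc continuous_id continuous_const
  · have h := abs_pullbackCoeff_le hC hK (Fin.last N) ((snoc_mem_slab q t).2 ht)
    simpa using h

/-- **Stokes' theorem** for a parametrization of a hypersurface by a slab that closes up at
infinity. -/
theorem integral_extDeriv_slab (hab : a ≤ b) (hK0 : 0 ≤ K)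
    (hF : ∀ p ∈ slab N a b, ContDiffAt ℝ ∞ F p)
    (hK : ∀ p ∈ slab N a b, ∀ i, ‖coordFrame F p i‖ ≤ K * slabWeight a b i (p i))
    (hlim : ∀ p ∈ slab N a b, ∀ j : Fin N,
      (∃ L, Tendsto (fun s => F (Function.update p j.castSucc s)) (cocompact ℝ) (𝓝 L)) ∧
      ∀ l ≠ j.castSucc, ∃ L,
        Tendsto (fun s => coordFrame F (Function.update p j.castSucc s) l) (cocompact ℝ) (𝓝 L))
    {φ : DiffForm E N} (hφ : IsTestForm φ) :
    ∫ p in slab N a b, extDeriv φ (F p) (coordFrame F p) =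
      (-1) ^ N * ((∫ q, pullbackCoeff F φ (Fin.last N) (Fin.snoc q b)) -
        ∫ q, pullbackCoeff F φ (Fin.last N) (Fin.snoc q a)) := by
  have hφc : Continuous φ := hφ.1.continuous
  have hφd : Differentiable ℝ φ := hφ.1.differentiable (by simp)
  obtain ⟨C, hC⟩ := hφ.2.exists_bound_of_continuous hφc
  have hdc : Continuous (extDeriv φ) := by
    have h1 : Continuous (fderiv ℝ φ) := hφ.1.continuous_fderiv (by simp)
    exact (ContinuousAlternatingMap.alternatizeUncurryFinCLM ℝ E ℝ).continuous.comp h1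
  have hds : HasCompactSupport (extDeriv φ) := by
    refine (hφ.2.fderiv (𝕜 := ℝ)).comp_left (g := fun f => ContinuousAlternatingMap.alternatizeUncurryFin f) ?_
    exact map_zero (ContinuousAlternatingMap.alternatizeUncurryFinCLM ℝ E ℝ)
  obtain ⟨C', hC'⟩ := hds.exists_bound_of_continuous hdc
  have hD := integrableOn_apply_coordFrame hF hdc hC' hK
  have hDc := continuousOn_apply_coordFrame hF hdc
  have hsub : ∀ k, slabBox N a b k ⊆ slab N a b := fun k p hp => (mem_slabBox.1 hp).1
  -- The slab is exhausted by boxes. On each box the classical divergence theorem holds; side faces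
  -- and end faces are then treated separately in the limit.
  have hlhs : Tendsto (fun k => ∫ p in slabBox N a b k, extDeriv φ (F p) (coordFrame F p)) atTop
      (𝓝 (∫ p in slab N a b, extDeriv φ (F p) (coordFrame F p))) := by
    rw [← iUnion_slabBox]
    refine tendsto_setIntegral_of_monotone (fun k => measurableSet_Icc) (monotone_slabBox N a b) ?_
    rwa [iUnion_slabBox]
  set f : Fin (N + 1) → (Fin (N + 1) → ℝ) → ℝ := fun i p => (-1) ^ i.val • pullbackCoeff F φ i p
    with hf
  set lo : ℕ → Fin (N + 1) → ℝ := fun k => Fin.snoc (fun _ : Fin N => -(k : ℝ)) a with hlo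
  set hi : ℕ → Fin (N + 1) → ℝ := fun k => Fin.snoc (fun _ : Fin N => (k : ℝ)) b with hhi
  have hle : ∀ k, lo k ≤ hi k := by
    intro k i
    refine Fin.lastCases ?_ (fun j => ?_) i
    · simpa [hlo, hhi] using hab
    · simp only [hlo, hhi, Fin.snoc_castSucc]
      linarith [(Nat.cast_nonneg k : (0 : ℝ) ≤ k)]
  have hbox : ∀ k, ∫ p in slabBox N a b k, extDeriv φ (F p) (coordFrame F p) =
      ∑ i : Fin (N + 1), ((∫ q in Icc (lo k ∘ i.succAbove) (hi k ∘ i.succAbove),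
          f i (Fin.insertNth i (hi k i) q)) -
        ∫ q in Icc (lo k ∘ i.succAbove) (hi k ∘ i.succAbove), f i (Fin.insertNth i (lo k i) q)) := by
    intro k
    have hcongr : EqOn (fun p => extDeriv φ (F p) (coordFrame F p)) (fun p =>
        ∑ i : Fin (N + 1), ((-1) ^ i.val • fderiv ℝ (pullbackCoeff F φ i) p) (Pi.single i 1))
        (slabBox N a b k) := fun p hp => extDeriv_apply_coordFrame (hF p (hsub k hp)) hφd
    have hint : IntegrableOn (fun p => extDeriv φ (F p) (coordFrame F p)) (slabBox N a b k) :=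
      hD.mono_set (hsub k)
    refine (setIntegral_congr_fun (s := slabBox N a b k) measurableSet_Icc hcongr).trans ?_
    refine integral_divergence_of_hasFDerivAt_off_countable' (lo k) (hi k) (hle k) f
      (fun i p => (-1) ^ i.val • fderiv ℝ (pullbackCoeff F φ i) p) ∅ countable_empty
      (fun i => ((continuousOn_pullbackCoeff hF hφc i).mono (hsub k)).const_smul ((-1 : ℤ) ^ i.val)) ?_
      (hint.congr_fun hcongr measurableSet_Icc)
    intro p hp i
    have hp' : p ∈ slabBox N a b k :=
      ⟨fun j => (hp.1 j (mem_univ _)).1.le, fun j => (hp.1 j (mem_univ _)).2.le⟩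
    exact (differentiableAt_pullbackCoeff (hF p (hsub k hp')) hφd i).hasFDerivAt.const_smul ((-1 : ℤ) ^ i.val)
  -- The end faces exhaust the whole of `ℝᴺ` and converge to the integrals over it. The sign is that
  -- of the last variable.
  have hlast : ∀ {t : ℝ}, t ∈ Icc a b → Tendsto (fun k : ℕ =>
      ∫ q in Icc (lo k ∘ (Fin.last N).succAbove) (hi k ∘ (Fin.last N).succAbove),
        f (Fin.last N) (Fin.insertNth (Fin.last N) t q)) atTop
      (𝓝 ((-1) ^ N * ∫ q, pullbackCoeff F φ (Fin.last N) (Fin.snoc q t))) := by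
    intro t ht
    have h1 := (integrable_pullbackCoeff_last hF hK hφc hC ht).const_mul ((-1) ^ N)
    have h2 := tendsto_setIntegral_of_monotone (μ := volume)
      (s := fun k : ℕ => Icc (fun _ : Fin N => -(k : ℝ)) (fun _ => (k : ℝ)))
      (fun k => measurableSet_Icc) monotone_Icc_const_nat h1.integrableOn
    rw [iUnion_Icc_const_nat, setIntegral_univ, integral_const_mul] at h2
    refine h2.congr fun k => ?_
    have e1 : lo k ∘ (Fin.last N).succAbove = fun _ => -(k : ℝ) := by
      ext j; simp [hlo]
    have e2 : hi k ∘ (Fin.last N).succAbove = fun _ => (k : ℝ) := by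
      ext j; simp [hhi]
    rw [e1, e2]
    simp [hf, Fin.insertNth_last']
  refine tendsto_nhds_unique hlhs ?_
  simp only [hbox, Fin.sum_univ_castSucc]
  rw [mul_sub, ← zero_add ((-1 : ℝ) ^ N * _ - _)]
  refine Tendsto.add ?_ ?_
  · rw [← Finset.sum_const_zero (s := (Finset.univ : Finset (Fin N)))]
    refine tendsto_finsetSum _ fun j _ => ?_
    have hne : j.castSucc ≠ Fin.last N := (Fin.castSucc_lt_last j).ne
    obtain ⟨l, hl⟩ := Fin.exists_succAbove_eq hne.symm
    have h1 := tendsto_side_face hK0 hF hK hφc hC hne (fun p hp => hlim p hp j)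
      (fun k : ℕ => Icc (lo k ∘ j.castSucc.succAbove) (hi k ∘ j.castSucc.succAbove))
      (fun k => isCompact_Icc) (fun k q hq s => by
        rw [slab_insertNth l hl]
        have h1 := hq.1 l
        have h2 := hq.2 l
        simp only [Function.comp_apply, hl, hlo, hhi, Fin.snoc_last] at h1 h2
        exact ⟨h1, h2⟩)
    have h2 := h1.const_mul ((-1) ^ (j.castSucc).val)
    rw [mul_zero] at h2
    refine h2.congr fun k => ?_
    have e1 : lo k j.castSucc = -(k : ℝ) := by simp [hlo]
    have e2 : hi k j.castSucc = k := by simp [hhi]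
    simp only [e1, e2, hf, zsmul_eq_mul]
    push_cast
    simp only [integral_const_mul]
    ring
  · have hb := hlast (right_mem_Icc.2 hab)
    have ha := hlast (left_mem_Icc.2 hab)
    refine (hb.sub ha).congr fun k => ?_
    have e1 : lo k (Fin.last N) = a := by simp [hlo]
    have e2 : hi k (Fin.last N) = b := by simp [hhi]
    simp only [e1, e2]

end Stokes

/-! ### Boundary and mass of swept hypersurfaces -/

section SweptCurrents

theorem removeNth_last_eq_init {N : ℕ} (p : Fin (N + 1) → ℝ) :
    (Fin.last N).removeNth p = Fin.init p := by
  ext i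
  simp [Fin.removeNth, Fin.init]

theorem piFinSuccAbove_last_apply {N : ℕ} (p : Fin (N + 1) → ℝ) :
    MeasurableEquiv.piFinSuccAbove (fun _ => ℝ) (Fin.last N) p = (p (Fin.last N), Fin.init p) := by
  rw [← removeNth_last_eq_init]
  rfl

theorem indicator_slab {N : ℕ} (a b : ℝ) (g : ℝ → ℝ) (h : (Fin N → ℝ) → ℝ) :
    (slab N a b).indicator (fun p => g (p (Fin.last N)) * h (Fin.init p)) =
      (fun z : ℝ × (Fin N → ℝ) => (Icc a b).indicator g z.1 * h z.2) ∘
        MeasurableEquiv.piFinSuccAbove (fun _ => ℝ) (Fin.last N) := by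
  ext p
  rw [Function.comp_apply, piFinSuccAbove_last_apply]
  by_cases hp : p ∈ slab N a b
  · rw [indicator_of_mem hp, indicator_of_mem (show p (Fin.last N) ∈ Icc a b from hp)]
  · rw [indicator_of_notMem hp, indicator_of_notMem (show p (Fin.last N) ∉ Icc a b from hp), zero_mul]

/-- Fubini: the area of a swept hypersurface is a weighted length times the area of the unit orbit.
-/
theorem setIntegral_slab_mul {N : ℕ} (a b : ℝ) (g : ℝ → ℝ) (h : (Fin N → ℝ) → ℝ) :
    ∫ p in slab N a b, g (p (Fin.last N)) * h (Fin.init p) =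
      (∫ t in Icc a b, g t) * ∫ q, h q := by
  have h1 := integral_prod_mul (L := ℝ) (μ := (volume : Measure ℝ)) (ν := volume)
    ((Icc a b).indicator g) h
  rw [integral_indicator measurableSet_Icc] at h1
  rw [← integral_indicator (measurableSet_slab N a b), indicator_slab, ← h1]
  exact (volume_preserving_piFinSuccAbove (fun _ => ℝ) (Fin.last N)).integral_comp
    (MeasurableEquiv.measurableEmbedding _)
    (fun z : ℝ × (Fin N → ℝ) => (Icc a b).indicator g z.1 * h z.2)

theorem integrableOn_slab_mul {N : ℕ} {a b : ℝ} {g : ℝ → ℝ} {h : (Fin N → ℝ) → ℝ}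
    (hg : IntegrableOn g (Icc a b)) (hh : Integrable h) :
    IntegrableOn (fun p => g (p (Fin.last N)) * h (Fin.init p)) (slab N a b) := by
  rw [← integrable_indicator_iff (measurableSet_slab N a b), indicator_slab]
  refine ((volume_preserving_piFinSuccAbove (fun _ => ℝ) (Fin.last N)).integrable_comp_emb
    (MeasurableEquiv.measurableEmbedding _)).2 ?_
  exact ((integrable_indicator_iff measurableSet_Icc).2 hg).mul_prod hh

variable {m n : ℕ} {x y : ℝ → ℝ} {a b : ℝ}

theorem integrable_orbJacobian : Integrable (orbJacobian m n) := by
  have hi : Integrable fun q : Fin (m + n) → ℝ => ∏ j, 4 * (1 + q j ^ 2)⁻¹ :=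
    Integrable.fintype_prod fun _ => integrable_inv_one_add_sq.const_mul 4
  refine hi.mono' continuous_orbJacobian.aestronglyMeasurable (Eventually.of_forall fun q => ?_)
  have h := prod_norm_orbFrame (m := m) (n := n) 1 1 q
  simp only [abs_one, one_pow, one_mul] at h
  rw [Real.norm_eq_abs, abs_of_pos (orbJacobian_pos q), ← h]
  refine Finset.prod_le_prod (fun _ _ => norm_nonneg _) fun j _ => ?_
  refine (norm_orbFrame_le 1 1 q j).trans_eq ?_
  rw [abs_one]
  ring

/-- The area of the unit orbit. -/
def orbArea (m n : ℕ) : ℝ := ∫ q, orbJacobian m n q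

theorem orbArea_pos : 0 < orbArea m n := by
  refine (integral_pos_iff_support_of_nonneg (fun q => (orbJacobian_pos q).le)
    integrable_orbJacobian).2 ?_
  have : Function.support (orbJacobian m n) = univ :=
    eq_univ_of_forall fun q => (orbJacobian_pos q).ne'
  rw [this]
  exact isOpen_univ.measure_pos _ univ_nonempty

/-- A smooth curve on a compact interval. -/
structure SmoothCurve (x y : ℝ → ℝ) (a b : ℝ) : Prop where
  le : a ≤ b
  fst : ∀ t ∈ Icc a b, ContDiffAt ℝ ∞ x t
  snd : ∀ t ∈ Icc a b, ContDiffAt ℝ ∞ y t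

/-- The area element `|x|ᵐ|y|ⁿ √(x'² + y'²)` of the hypersurface swept out over a curve. -/
def speed (m n : ℕ) (x y : ℝ → ℝ) (t : ℝ) : ℝ :=
  |x t| ^ m * |y t| ^ n * √(deriv x t ^ 2 + deriv y t ^ 2)

theorem ContDiffAt.continuousAt_deriv {f : ℝ → ℝ} {t : ℝ} (hf : ContDiffAt ℝ ∞ f t) :
    ContinuousAt (deriv f) t := by
  have h : ContinuousAt (fderiv ℝ f) t := (hf.fderiv_right (m := 0) (by norm_cast)).continuousAt
  exact h.clm_apply continuousAt_const

namespace SmoothCurve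

variable (hc : SmoothCurve x y a b)
include hc

theorem contDiffAt {p : Fin (m + n + 1) → ℝ} (hp : p ∈ slab (m + n) a b) :
    ContDiffAt ℝ ∞ (orbitChart m n x y) p :=
  contDiffAt_orbitChart (hc.fst _ hp) (hc.snd _ hp)

theorem coordFrame_eq {p : Fin (m + n + 1) → ℝ} (hp : p ∈ slab (m + n) a b) :
    coordFrame (orbitChart m n x y) p =
      Fin.snoc (orbFrame m n (x (p (Fin.last _))) (y (p (Fin.last _))) (Fin.init p))
        (orbPoint m n (deriv x (p (Fin.last _))) (deriv y (p (Fin.last _))) (Fin.init p)) :=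
  coordFrame_orbitChart ((hc.fst _ hp).differentiableAt (by simp)).hasDerivAt
    ((hc.snd _ hp).differentiableAt (by simp)).hasDerivAt

theorem continuousOn_fst : ContinuousOn x (Icc a b) :=
  fun t ht => (hc.fst t ht).continuousAt.continuousWithinAt

theorem continuousOn_snd : ContinuousOn y (Icc a b) :=
  fun t ht => (hc.snd t ht).continuousAt.continuousWithinAt

theorem continuousOn_deriv_fst : ContinuousOn (deriv x) (Icc a b) :=
  fun t ht => (ContDiffAt.continuousAt_deriv (hc.fst t ht)).continuousWithinAt

theorem continuousOn_deriv_snd : ContinuousOn (deriv y) (Icc a b) :=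
  fun t ht => (ContDiffAt.continuousAt_deriv (hc.snd t ht)).continuousWithinAt

theorem integrableOn_speed : IntegrableOn (speed m n x y) (Icc a b) := by
  refine ContinuousOn.integrableOn_compact isCompact_Icc ?_
  exact ((hc.continuousOn_fst.abs.pow m).mul (hc.continuousOn_snd.abs.pow n)).mul
    ((hc.continuousOn_deriv_fst.pow 2).add (hc.continuousOn_deriv_snd.pow 2)).sqrt

theorem exists_norm_coordFrame_le : ∃ K, 0 ≤ K ∧ ∀ p ∈ slab (m + n) a b, ∀ i,
    ‖coordFrame (orbitChart m n x y) p i‖ ≤ K * slabWeight a b i (p i) := by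
  obtain ⟨C₁, h₁⟩ := isCompact_Icc.exists_bound_of_continuousOn
    ((continuousOn_const (c := (2 : ℝ))).mul (hc.continuousOn_fst.abs.add hc.continuousOn_snd.abs))
  obtain ⟨C₂, h₂⟩ := isCompact_Icc.exists_bound_of_continuousOn
    ((hc.continuousOn_deriv_fst.pow 2).add (hc.continuousOn_deriv_snd.pow 2)).sqrt
  have hC₁ : 0 ≤ C₁ := (norm_nonneg _).trans (h₁ a (left_mem_Icc.2 hc.le))
  have hC₂ : 0 ≤ C₂ := (norm_nonneg _).trans (h₂ a (left_mem_Icc.2 hc.le))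
  refine ⟨C₁ + C₂, by positivity, fun p hp i => ?_⟩
  rw [hc.coordFrame_eq hp]
  refine Fin.lastCases ?_ (fun j => ?_) i
  · have hw : slabWeight a b (Fin.last (m + n)) (p (Fin.last (m + n))) = 1 := by
      simp [slabWeight, indicator_of_mem (show p (Fin.last (m + n)) ∈ Icc a b from hp)]
    rw [hw, mul_one, Fin.snoc_last, norm_orbPoint]
    exact ((le_abs_self _).trans (h₂ _ hp)).trans (le_add_of_nonneg_left hC₁)
  · have hw : slabWeight a b j.castSucc (p j.castSucc) = (1 + p j.castSucc ^ 2)⁻¹ := by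
      simp [slabWeight, (Fin.castSucc_lt_last j).ne]
    rw [hw, Fin.snoc_castSucc]
    refine (norm_orbFrame_le _ _ _ j).trans ?_
    refine mul_le_mul_of_nonneg_right ?_ (by positivity)
    exact ((le_abs_self _).trans (h₁ _ hp)).trans (le_add_of_nonneg_right hC₂)

end SmoothCurve

/-- The integral of a form over the orbit `Sᵐ(a) × Sⁿ(b)`. -/
def orbIntegral (m n : ℕ) (φ : DiffForm (Amb m n) (m + n)) (a b : ℝ) : ℝ :=
  ∫ q, φ (orbPoint m n a b q) (orbFrame m n a b q)

/-- On the axis `X = 0` the first sphere is a point, so a frame vector vanishes. This is why a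
competitor may start anywhere on an axis without creating boundary. -/
theorem orbIntegral_of_fst_eq_zero (hm : 1 ≤ m) (φ : DiffForm (Amb m n) (m + n)) (b : ℝ) :
    orbIntegral m n φ 0 b = 0 := by
  refine integral_eq_zero_of_ae (Eventually.of_forall fun q => ?_)
  refine (φ _).map_coord_zero (Fin.castAdd n ⟨0, hm⟩) ?_
  rw [orbFrame, Fin.append_left, zero_smul]

theorem orbIntegral_of_snd_eq_zero (hn : 1 ≤ n) (φ : DiffForm (Amb m n) (m + n)) (a : ℝ) :
    orbIntegral m n φ a 0 = 0 := by
  refine integral_eq_zero_of_ae (Eventually.of_forall fun q => ?_)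
  refine (φ _).map_coord_zero (Fin.natAdd m ⟨0, hn⟩) ?_
  rw [orbFrame, Fin.append_right, zero_smul]

theorem init_update_castSucc {N : ℕ} (p : Fin (N + 1) → ℝ) (j : Fin N) (s : ℝ) :
    (Fin.init (Function.update p j.castSucc s) : Fin N → ℝ) = Function.update (Fin.init p) j s := by
  ext i
  simp [Fin.init, Function.update_apply]

/-- The boundary consists of the two end orbits only, since each orbit is closed and its chart
closes up at infinity. -/
theorem SmoothCurve.pushCurrent_extDeriv (hc : SmoothCurve x y a b)
    {φ : DiffForm (Amb m n) (m + n)} (hφ : IsTestForm φ) :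
    pushCurrent (orbitChart m n x y) (slab (m + n) a b) (extDeriv φ) =
      (-1) ^ (m + n) * (orbIntegral m n φ (x b) (y b) - orbIntegral m n φ (x a) (y a)) := by
  obtain ⟨K, hK0, hK⟩ := hc.exists_norm_coordFrame_le (m := m) (n := n)
  have hB : ∀ t ∈ Icc a b, ∫ q, pullbackCoeff (orbitChart m n x y) φ (Fin.last (m + n))
      (Fin.snoc q t) = orbIntegral m n φ (x t) (y t) := by
    intro t ht
    refine integral_congr_ae (Eventually.of_forall fun q => ?_)
    simp only [pullbackCoeff]
    rw [hc.coordFrame_eq ((snoc_mem_slab q t).2 ht)]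
    simp [orbitChart, Fin.init_snoc]
  rw [pushCurrent, integral_extDeriv_slab hc.le hK0 (fun p hp => hc.contDiffAt hp) hK ?_ hφ,
    hB b (right_mem_Icc.2 hc.le), hB a (left_mem_Icc.2 hc.le)]
  intro p hp j
  have hl : ∀ s, Function.update p j.castSucc s (Fin.last (m + n)) = p (Fin.last (m + n)) :=
    fun s => Function.update_of_ne (Fin.castSucc_lt_last j).ne' _ _
  have hmem : ∀ s, Function.update p j.castSucc s ∈ slab (m + n) a b := fun s => by
    rw [slab, mem_ofPred_eq, hl]
    exact hp
  obtain ⟨U, V, hUV⟩ := exists_tendsto_orbPoint_update (m := m) (n := n) (Fin.init p) j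
  refine ⟨⟨_, by simpa only [orbitChart, hl, init_update_castSucc] using hUV _ _⟩, fun l => ?_⟩
  refine Fin.lastCases (fun _ => ?_) (fun l _ => ?_) l
  · refine ⟨_, (hUV (deriv x (p (Fin.last _))) (deriv y (p (Fin.last _)))).congr fun s => ?_⟩
    rw [hc.coordFrame_eq (hmem s), Fin.snoc_last, hl, init_update_castSucc]
  · obtain ⟨U', hU'⟩ := exists_tendsto_orbFrame_update (m := m) (n := n) (Fin.init p) j l
    refine ⟨_, (hU' (x (p (Fin.last _))) (y (p (Fin.last _)))).congr fun s => ?_⟩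
    rw [hc.coordFrame_eq (hmem s), Fin.snoc_castSucc, hl, init_update_castSucc]

theorem SmoothCurve.pairwise_inner (hc : SmoothCurve x y a b) {p : Fin (m + n + 1) → ℝ}
    (hp : p ∈ slab (m + n) a b) :
    Pairwise fun i j => inner ℝ (coordFrame (orbitChart m n x y) p i)
      (coordFrame (orbitChart m n x y) p j) = 0 := by
  rw [hc.coordFrame_eq hp]
  exact pairwise_inner_snoc_orbFrame _ _ _ _ _

theorem SmoothCurve.prod_norm (hc : SmoothCurve x y a b) {p : Fin (m + n + 1) → ℝ}
    (hp : p ∈ slab (m + n) a b) :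
    ∏ i, ‖coordFrame (orbitChart m n x y) p i‖ =
      speed m n x y (p (Fin.last _)) * orbJacobian m n (Fin.init p) := by
  rw [hc.coordFrame_eq hp, Fin.prod_univ_castSucc]
  simp only [Fin.snoc_castSucc, Fin.snoc_last, prod_norm_orbFrame, norm_orbPoint, speed]
  ring

/-- Since the frame is orthogonal, comass one bounds the integrand by the area element. Only this
upper bound is needed for a competitor. -/
theorem SmoothCurve.pushCurrent_le (hc : SmoothCurve x y a b)
    {φ : DiffForm (Amb m n) (m + n + 1)} (hφ : IsTestForm φ) (h1 : ∀ z, comass (φ z) ≤ 1) :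
    pushCurrent (orbitChart m n x y) (slab (m + n) a b) φ ≤
      (∫ t in Icc a b, speed m n x y t) * orbArea m n := by
  obtain ⟨K, hK0, hK⟩ := hc.exists_norm_coordFrame_le (m := m) (n := n)
  obtain ⟨C, hC⟩ := hφ.2.exists_bound_of_continuous hφ.1.continuous
  rw [orbArea, ← setIntegral_slab_mul]
  refine setIntegral_mono_on (integrableOn_apply_coordFrame (fun p hp => hc.contDiffAt hp)
    hφ.1.continuous hC hK) (integrableOn_slab_mul hc.integrableOn_speed integrable_orbJacobian)
    (measurableSet_slab _ _ _) fun p hp => ?_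
  rw [← hc.prod_norm hp]
  refine (le_abs_self _).trans ((abs_apply_le_comass_mul _ _ (hc.pairwise_inner hp)).trans ?_)
  exact mul_le_of_le_one_left (Finset.prod_nonneg fun _ _ => norm_nonneg _) (h1 _)

end SweptCurrents

/-! ### Swept hypersurfaces as rectifiable currents -/

section Competitors

theorem jacobian_eq_prod_norm {E : Type*} [NormedAddCommGroup E] [InnerProductSpace ℝ E] {k : ℕ}
    {f : (Fin k → ℝ) → E} {p : Fin k → ℝ}
    (h : Pairwise fun i j => inner ℝ (coordFrame f p i) (coordFrame f p j) = 0) :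
    jacobian f p = ∏ i, ‖coordFrame f p i‖ := by
  have : (Matrix.of fun i j => inner ℝ (coordFrame f p i) (coordFrame f p j)) =
      Matrix.diagonal fun i => ‖coordFrame f p i‖ ^ 2 := by
    ext i j
    by_cases hij : i = j
    · subst hij
      simp
    · simpa [hij] using h hij
  rw [jacobian, this, Matrix.det_diagonal, Finset.prod_pow,
    Real.sqrt_sq (Finset.prod_nonneg fun _ _ => norm_nonneg _)]

/-- The interior of a slab. -/
def openSlab (N : ℕ) (a b : ℝ) : Set (Fin (N + 1) → ℝ) :=
  {p | a < p (Fin.last N) ∧ p (Fin.last N) < b}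

theorem isOpen_openSlab (N : ℕ) (a b : ℝ) : IsOpen (openSlab N a b) :=
  isOpen_Ioo.preimage (continuous_apply (Fin.last N))

theorem openSlab_subset (N : ℕ) (a b : ℝ) : openSlab N a b ⊆ slab N a b :=
  fun _ hp => ⟨hp.1.le, hp.2.le⟩

/-- A globally Lipschitz extension of the chart agrees with it on the closed slab, but the
derivatives can be compared only in the interior. The bounding hyperplanes are null sets. -/
theorem openSlab_ae_eq (N : ℕ) (a b : ℝ) : openSlab N a b =ᵐ[volume] slab N a b := by
  have h : ∀ c : ℝ, ∀ᵐ p : Fin (N + 1) → ℝ, p (Fin.last N) ≠ c := fun c => by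
    rw [ae_iff]
    simpa [volume_pi] using Measure.pi_hyperplane (fun _ : Fin (N + 1) => (volume : Measure ℝ)) (Fin.last N) c
  filter_upwards [h a, h b] with p ha hb
  refine propext ⟨fun hp => openSlab_subset N a b hp, fun hp => ?_⟩
  exact ⟨lt_of_le_of_ne hp.1 ha.symm, lt_of_le_of_ne hp.2 hb⟩

theorem convex_slab (N : ℕ) (a b : ℝ) : Convex ℝ (slab N a b) :=
  (convex_Icc a b).linear_preimage (LinearMap.proj (R := ℝ) (φ := fun _ => ℝ) (Fin.last N))

theorem convex_openSlab (N : ℕ) (a b : ℝ) : Convex ℝ (openSlab N a b) :=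
  (convex_Ioo a b).linear_preimage (LinearMap.proj (R := ℝ) (φ := fun _ => ℝ) (Fin.last N))

theorem nnnorm_fderiv_le_of_coordFrame {E : Type*} [NormedAddCommGroup E] [InnerProductSpace ℝ E]
    {k : ℕ} {f : (Fin k → ℝ) → E} {p : Fin k → ℝ} {K : NNReal}
    (h : ∀ i, ‖coordFrame f p i‖ ≤ K) : ‖fderiv ℝ f p‖₊ ≤ k * K := by
  rw [← NNReal.coe_le_coe]
  push_cast
  refine ContinuousLinearMap.opNorm_le_bound _ (by positivity) fun v => ?_
  have hv : v = ∑ i, v i • (Pi.single i 1 : Fin k → ℝ) := by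
    ext j
    simp [Finset.sum_apply, Pi.single_apply]
  calc ‖fderiv ℝ f p v‖ = ‖∑ i, v i • coordFrame f p i‖ := by
        conv_lhs => rw [hv, map_sum]
        simp [coordFrame]
    _ ≤ ∑ i : Fin k, ‖v‖ * K := by
        refine norm_sum_le_of_le _ fun i _ => ?_
        rw [norm_smul]
        exact mul_le_mul (norm_le_pi_norm v i) (h i) (norm_nonneg _) (norm_nonneg _)
    _ = k * K * ‖v‖ := by simp; ring

theorem slabWeight_le_one {N : ℕ} (a b : ℝ) (i : Fin (N + 1)) (s : ℝ) : slabWeight a b i s ≤ 1 := by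
  unfold slabWeight
  split_ifs
  · exact indicator_le_self' (fun _ _ => zero_le_one) s |>.trans le_rfl
  · exact inv_le_one_of_one_le₀ (by nlinarith [sq_nonneg s])

variable {m n : ℕ} {x y : ℝ → ℝ} {a b : ℝ}

/-- The swept hypersurface is parametrized by a Lipschitz map on the interior of the slab. -/
theorem SmoothCurve.exists_lipschitz (hc : SmoothCurve x y a b) :
    ∃ f : (Fin (m + n + 1) → ℝ) → Amb m n, (∃ K, LipschitzWith K f) ∧
      Bornology.IsBounded (f '' openSlab (m + n) a b) ∧
      ∫⁻ p in openSlab (m + n) a b, ENNReal.ofReal (jacobian f p) < ⊤ ∧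
      ∀ φ, pushCurrent f (openSlab (m + n) a b) φ =
        pushCurrent (orbitChart m n x y) (slab (m + n) a b) φ := by
  obtain ⟨K, hK0, hK⟩ := hc.exists_norm_coordFrame_le (m := m) (n := n)
  lift K to NNReal using hK0
  have hlip : LipschitzOnWith ((m + n + 1 : ℕ) * K) (orbitChart m n x y) (slab (m + n) a b) := by
    refine (convex_slab _ a b).lipschitzOnWith_of_nnnorm_fderiv_le
      (fun p hp => (hc.contDiffAt hp).differentiableAt (by simp)) fun p hp => ?_
    refine nnnorm_fderiv_le_of_coordFrame fun i => (hK p hp i).trans ?_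
    exact mul_le_of_le_one_right K.2 (slabWeight_le_one _ _ _ _)
  -- Rectifiability asks for maps that are Lipschitz on all of `ℝᵏ`, while the curve is controlled
  -- only on its compact interval.
  obtain ⟨f, hf, hEq⟩ := hlip.extend_finite_dimension
  have hfr : ∀ p ∈ openSlab (m + n) a b, coordFrame f p = coordFrame (orbitChart m n x y) p := by
    intro p hp
    have : f =ᶠ[𝓝 p] orbitChart m n x y := by
      filter_upwards [(isOpen_openSlab _ a b).mem_nhds hp] with z hz
      exact (hEq (openSlab_subset _ _ _ hz)).symm
    ext1 i
    rw [coordFrame, coordFrame, this.fderiv_eq]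
  refine ⟨f, ⟨_, hf⟩, ?_, ?_, fun φ => ?_⟩
  · obtain ⟨C, hC⟩ := isCompact_Icc.exists_bound_of_continuousOn
      ((hc.continuousOn_fst.pow 2).add (hc.continuousOn_snd.pow 2)).sqrt
    refine isBounded_iff_forall_norm_le.2 ⟨C, ?_⟩
    rintro _ ⟨p, hp, rfl⟩
    rw [← hEq (openSlab_subset _ _ _ hp), orbitChart, norm_orbPoint]
    exact (le_abs_self _).trans (hC _ (openSlab_subset _ _ _ hp))
  · have hint := (integrableOn_slab_mul (hc.integrableOn_speed (m := m) (n := n))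
      integrable_orbJacobian).mono_set (openSlab_subset (m + n) a b)
    refine lt_of_le_of_lt (setLIntegral_mono' (isOpen_openSlab _ _ _).measurableSet fun p hp => ?_)
      hint.2
    have hp' := openSlab_subset _ _ _ hp
    rw [jacobian_eq_prod_norm (by rw [hfr p hp]; exact hc.pairwise_inner hp'), hfr p hp,
      hc.prod_norm hp']
    exact Real.ofReal_le_enorm _
  · rw [pushCurrent, pushCurrent, setIntegral_congr_set (openSlab_ae_eq _ a b).symm]
    refine setIntegral_congr_fun (isOpen_openSlab _ _ _).measurableSet fun p hp => ?_
    simp only [hfr p hp, hEq (openSlab_subset _ _ _ hp)]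

theorem isRectifiableCurrent_add {x₁ y₁ x₂ y₂ : ℝ → ℝ} {a₁ b₁ a₂ b₂ : ℝ}
    (h₁ : SmoothCurve x₁ y₁ a₁ b₁) (h₂ : SmoothCurve x₂ y₂ a₂ b₂) :
    IsRectifiableCurrent fun φ : DiffForm (Amb m n) (m + n + 1) =>
      pushCurrent (orbitChart m n x₁ y₁) (slab (m + n) a₁ b₁) φ +
        pushCurrent (orbitChart m n x₂ y₂) (slab (m + n) a₂ b₂) φ := by
  obtain ⟨f₁, hL₁, hB₁, hJ₁, hT₁⟩ := h₁.exists_lipschitz (m := m) (n := n)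
  obtain ⟨f₂, hL₂, hB₂, hJ₂, hT₂⟩ := h₂.exists_lipschitz (m := m) (n := n)
  refine ⟨fun j => if j = 0 then f₁ else f₂, fun j => if j = 0 then openSlab (m + n) a₁ b₁ else
    if j = 1 then openSlab (m + n) a₂ b₂ else ∅, fun j => ?_, fun j => ?_, ?_, ?_, fun φ _ => ?_⟩
  · simp only
    split_ifs
    exacts [hL₁, hL₂]
  · simp only
    split_ifs
    exacts [(isOpen_openSlab _ _ _).measurableSet, (isOpen_openSlab _ _ _).measurableSet,
      MeasurableSet.empty]
  · refine (hB₁.union hB₂).subset (iUnion_subset fun j => ?_)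
    simp only
    split_ifs
    exacts [subset_union_left, subset_union_right, by simp]
  · rw [tsum_eq_sum (s := {0, 1})]
    · simpa using ⟨hJ₁, hJ₂⟩
    · intro j hj
      simp only [Finset.mem_insert, Finset.mem_singleton, not_or] at hj
      simp [hj.1, hj.2]
  · have := hasSum_sum_of_ne_finset_zero (s := {0, 1}) (L := .unconditional ℕ) (f := fun j : ℕ =>
      pushCurrent (if j = 0 then f₁ else f₂) (if j = 0 then openSlab (m + n) a₁ b₁ else
        if j = 1 then openSlab (m + n) a₂ b₂ else ∅) φ) ?_
    · simpa [hT₁, hT₂] using this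
    · intro j hj
      simp only [Finset.mem_insert, Finset.mem_singleton, not_or] at hj
      simp [hj.1, hj.2, pushCurrent]

end Competitors

/-! ### A lower bound for the mass of the cone, and comparison -/

section ConeMass

variable {m n : ℕ}

/-- The vector field `(-nX, mY)` normal to the cone. -/
def coneNormal (m n : ℕ) (z : Amb m n) : Amb m n :=
  inclX m n (-(n : ℝ) • projX m n z) + inclY m n ((m : ℝ) • projY m n z)

theorem contDiff_coneNormal : ContDiff ℝ ∞ (coneNormal m n) :=
  (contDiff_inclX.comp (contDiff_projX.const_smul _)).add
    (contDiff_inclY.comp (contDiff_projY.const_smul _))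

theorem coneNormal_eq_zero_iff (hm : 1 ≤ m) (hn : 1 ≤ n) {z : Amb m n} :
    coneNormal m n z = 0 ↔ z = 0 := by
  have hm0 : (m : ℝ) ≠ 0 := by positivity
  have hn0 : (n : ℝ) ≠ 0 := by positivity
  refine ⟨fun h => ?_, fun h => by simp [coneNormal, h]⟩
  have h1 := congrArg (projX m n) h
  have h2 := congrArg (projY m n) h
  simp [coneNormal, hn0] at h1
  simp [coneNormal, hm0] at h2
  rw [← inclX_projX_add z, h1, h2]
  simp

theorem coneNormal_orbPoint (a b : ℝ) (q : Fin (m + n) → ℝ) :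
    coneNormal m n (orbPoint m n a b q) = orbPoint m n (-(n : ℝ) * a) (m * b) q := by
  rw [coneNormal, projX_orbPoint, projY_orbPoint]
  simp [orbPoint, orbX, orbY, mul_smul]

/-- The cutoff function used to localize a form to an annulus of radii `√(c/2)`, `√3`. -/
def annulusCutoff (c s : ℝ) : ℝ := smoothTransition (2 * s / c - 1) * smoothTransition (3 - s)

theorem contDiff_annulusCutoff (c : ℝ) : ContDiff ℝ ∞ (annulusCutoff c) := by
  unfold annulusCutoff
  refine (smoothTransition.contDiff.comp ?_).mul (smoothTransition.contDiff.comp ?_)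
  · exact ((contDiff_const.mul contDiff_id).div_const c).sub contDiff_const
  · exact contDiff_const.sub contDiff_id

theorem annulusCutoff_nonneg (c s : ℝ) : 0 ≤ annulusCutoff c s :=
  mul_nonneg (smoothTransition.nonneg _) (smoothTransition.nonneg _)

theorem annulusCutoff_le_one (c s : ℝ) : annulusCutoff c s ≤ 1 :=
  mul_le_one₀ (smoothTransition.le_one _) (smoothTransition.nonneg _) (smoothTransition.le_one _)

theorem annulusCutoff_eq_one {c s : ℝ} (hc : 0 < c) (h : c ≤ s) (h' : s ≤ 1) :
    annulusCutoff c s = 1 := by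
  rw [annulusCutoff, smoothTransition.one_of_one_le, smoothTransition.one_of_one_le, one_mul]
  · linarith
  · rw [le_sub_iff_add_le, le_div_iff₀ hc]
    linarith

theorem annulusCutoff_eq_zero_of_le {c s : ℝ} (hc : 0 < c) (h : s ≤ c / 2) :
    annulusCutoff c s = 0 := by
  rw [annulusCutoff, smoothTransition.zero_of_nonpos, zero_mul]
  rw [sub_nonpos, div_le_one hc]
  linarith

theorem annulusCutoff_eq_zero_of_ge {c s : ℝ} (h : 3 ≤ s) : annulusCutoff c s = 0 := by
  rw [annulusCutoff, smoothTransition.zero_of_nonpos (x := 3 - s) (by linarith), mul_zero]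

/-- The test form `σ χ(|z|²) ι_ν vol` with `ν` the unit normal of the cone. -/
def coneTestForm (m n : ℕ) (σ c : ℝ) (z : Amb m n) : Amb m n [⋀^Fin (m + n + 1)]→L[ℝ] ℝ :=
  fluxForm (ambBasis m n) ((σ * annulusCutoff c (‖z‖ ^ 2) * ‖coneNormal m n z‖⁻¹) •
    coneNormal m n z)

/-- The unit normal is singular only at the origin, near which the cutoff vanishes; the other factor
of the cutoff makes the support compact. -/
theorem isTestForm_coneTestForm (hm : 1 ≤ m) (hn : 1 ≤ n) (σ : ℝ) {c : ℝ} (hc : 0 < c) :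
    IsTestForm (coneTestForm m n σ c) := by
  refine ⟨(fluxForm (ambBasis m n)).contDiff.comp ?_, ?_⟩
  · rw [contDiff_iff_contDiffAt]
    intro z
    by_cases hz : z = 0
    · have h0 : (fun z : Amb m n => (σ * annulusCutoff c (‖z‖ ^ 2) * ‖coneNormal m n z‖⁻¹) •
          coneNormal m n z) =ᶠ[𝓝 z] fun _ => 0 := by
        have h1 : ∀ᶠ w : Amb m n in 𝓝 z, ‖w‖ ^ 2 < c / 2 := by
          refine ContinuousAt.eventually_lt (by fun_prop) continuousAt_const ?_
          simpa [hz] using hc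
        filter_upwards [h1] with w hw
        rw [annulusCutoff_eq_zero_of_le hc hw.le, mul_zero, zero_mul, zero_smul]
      exact contDiffAt_const.congr_of_eventuallyEq h0
    · have hne : coneNormal m n z ≠ 0 := fun h => hz ((coneNormal_eq_zero_iff hm hn).1 h)
      have h1 : ContDiffAt ℝ ∞ (fun z : Amb m n => annulusCutoff c (‖z‖ ^ 2)) z :=
        ((contDiff_annulusCutoff c).comp (contDiff_norm_sq ℝ)).contDiffAt
      have h2 : ContDiffAt ℝ ∞ (fun z : Amb m n => ‖coneNormal m n z‖⁻¹) z :=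
        (contDiff_coneNormal.contDiffAt.norm ℝ hne).inv (norm_ne_zero_iff.2 hne)
      exact ((contDiffAt_const.mul h1).mul h2).smul contDiff_coneNormal.contDiffAt
  · refine HasCompactSupport.intro (isCompact_closedBall (0 : Amb m n) 2) fun z hz => ?_
    have : 2 < ‖z‖ := by simpa using hz
    rw [coneTestForm, annulusCutoff_eq_zero_of_ge (by nlinarith), mul_zero, zero_mul, zero_smul, map_zero]

theorem comass_coneTestForm_le {σ : ℝ} (hσ : |σ| = 1) (c : ℝ) (z : Amb m n) :
    comass (coneTestForm m n σ c z) ≤ 1 := by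
  refine (comass_fluxForm_le _ _).trans ?_
  rw [norm_smul, Real.norm_eq_abs, abs_mul, abs_mul, hσ, one_mul, abs_inv, abs_norm, mul_assoc,
    abs_of_nonneg (annulusCutoff_nonneg _ _)]
  exact mul_le_one₀ (annulusCutoff_le_one _ _) (by positivity) inv_mul_le_one

theorem smoothCurve_cone (m n : ℕ) :
    SmoothCurve (fun t => t * radX m n) (fun t => t * radY m n) 0 1 where
  le := zero_le_one
  fst _ _ := (contDiff_id.mul contDiff_const).contDiffAt
  snd _ _ := (contDiff_id.mul contDiff_const).contDiffAt

theorem truncatedCone_eq (m n : ℕ) : truncatedCone m n =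
    pushCurrent (orbitChart m n (fun t => t * radX m n) (fun t => t * radY m n))
      (slab (m + n) 0 1) := by
  rw [truncatedCone, coneChart_eq_orbitChart]
  rfl

theorem radX_sq_add_radY_sq (hm : 1 ≤ m) : radX m n ^ 2 + radY m n ^ 2 = 1 := by
  have h : (0 : ℝ) < m + n := by positivity
  rw [radX, radY, sq_sqrt (by positivity), sq_sqrt (by positivity)]
  field_simp

theorem radX_pos (hm : 1 ≤ m) : 0 < radX m n := by
  have : (0 : ℝ) < m := by positivity
  exact sqrt_pos.2 (by positivity)

theorem radY_pos (hn : 1 ≤ n) : 0 < radY m n := by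
  have : (0 : ℝ) < n := by positivity
  exact sqrt_pos.2 (by positivity)

theorem mul_radY_sq_eq (m n : ℕ) : m * radY m n ^ 2 = n * radX m n ^ 2 := by
  rw [radX, radY, sq_sqrt (by positivity), sq_sqrt (by positivity)]
  ring

theorem hasDerivAt_mul_const' (c t : ℝ) : HasDerivAt (fun t : ℝ => t * c) c t := by
  simpa using (hasDerivAt_id t).mul_const c

theorem speed_cone (hm : 1 ≤ m) (t : ℝ) :
    speed m n (fun t => t * radX m n) (fun t => t * radY m n) t =
      |t| ^ (m + n) * (radX m n ^ m * radY m n ^ n) := by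
  have hX : 0 ≤ radX m n := sqrt_nonneg _
  have hY : 0 ≤ radY m n := sqrt_nonneg _
  rw [speed, (hasDerivAt_mul_const' _ t).deriv, (hasDerivAt_mul_const' _ t).deriv,
    radX_sq_add_radY_sq hm, abs_mul, abs_mul, abs_of_nonneg hX, abs_of_nonneg hY]
  simp only [sqrt_one, mul_pow, pow_add]
  ring

/-- The field `(-nX, mY)` is orthogonal to the orbits, being radial in each factor, and to the ray
because `m radY² = n radX²`. Equality in Hadamard's inequality then yields the area element. -/
theorem abs_fluxForm_coneNormal (hm : 1 ≤ m) (hn : 1 ≤ n) {p : Fin (m + n + 1) → ℝ}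
    (hp : p ∈ openSlab (m + n) 0 1) :
    |fluxForm (ambBasis m n) (‖coneNormal m n (coneChart m n p)‖⁻¹ • coneNormal m n (coneChart m n p))
      (coordFrame (coneChart m n) p)| = p (Fin.last _) ^ (m + n) * (radX m n ^ m * radY m n ^ n) *
        orbJacobian m n (Fin.init p) := by
  have hp' := openSlab_subset _ _ _ hp
  have hc := smoothCurve_cone m n
  rw [coneChart_eq_orbitChart, abs_fluxForm_eq _ _ _ (hc.pairwise_inner hp'), hc.prod_norm hp',
    speed_cone hm, abs_of_pos hp.1]
  · rw [norm_smul, norm_inv, norm_norm, inv_mul_cancel₀, one_mul]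
    rw [norm_ne_zero_iff, Ne, coneNormal_eq_zero_iff hm hn, ← norm_eq_zero, orbitChart,
      norm_orbPoint, mul_pow, mul_pow, ← mul_add, radX_sq_add_radY_sq hm, mul_one,
      sqrt_sq hp.1.le]
    exact hp.1.ne'
  · intro i
    rw [hc.coordFrame_eq hp', inner_smul_left, orbitChart, coneNormal_orbPoint]
    refine mul_eq_zero_of_right _ ?_
    refine Fin.lastCases ?_ (fun j => ?_) i
    · rw [Fin.snoc_last, inner_orbPoint, (hasDerivAt_mul_const' _ _).deriv,
        (hasDerivAt_mul_const' _ _).deriv]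
      linear_combination p (Fin.last _) * mul_radY_sq_eq m n
    · rw [Fin.snoc_castSucc, inner_orbPoint_orbFrame]

/-- Two continuous functions with equal squares, one of them without zeros, agree up to one global
sign on a connected set. The orientation of the chart need not be determined. -/
theorem exists_sign_fluxForm_coneNormal (hm : 1 ≤ m) (hn : 1 ≤ n) :
    ∃ σ : ℝ, |σ| = 1 ∧ ∀ p ∈ openSlab (m + n) 0 1,
      σ * fluxForm (ambBasis m n)
        (‖coneNormal m n (coneChart m n p)‖⁻¹ • coneNormal m n (coneChart m n p))
        (coordFrame (coneChart m n) p) = p (Fin.last _) ^ (m + n) *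
          (radX m n ^ m * radY m n ^ n) * orbJacobian m n (Fin.init p) := by
  have hc := smoothCurve_cone m n
  have hsub := openSlab_subset (m + n) 0 1
  have hF : ContinuousOn (coneChart m n) (openSlab (m + n) 0 1) := by
    rw [coneChart_eq_orbitChart]
    exact fun p hp => (hc.contDiffAt (hsub hp)).continuousAt.continuousWithinAt
  have hfr : ContinuousOn (coordFrame (coneChart m n)) (openSlab (m + n) 0 1) := by
    rw [coneChart_eq_orbitChart]
    exact (continuousOn_coordFrame fun p hp => hc.contDiffAt hp).mono hsub
  have hpos : ∀ p ∈ openSlab (m + n) 0 1, 0 < p (Fin.last _) ^ (m + n) *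
      (radX m n ^ m * radY m n ^ n) * orbJacobian m n (Fin.init p) := fun p hp =>
    mul_pos (mul_pos (pow_pos hp.1 _) (mul_pos (pow_pos (radX_pos hm) _) (pow_pos (radY_pos hn) _)))
      (orbJacobian_pos _)
  have hN : ContinuousOn (fun p => coneNormal m n (coneChart m n p)) (openSlab (m + n) 0 1) :=
    contDiff_coneNormal.continuous.comp_continuousOn hF
  have hne : ∀ p ∈ openSlab (m + n) 0 1, ‖coneNormal m n (coneChart m n p)‖ ≠ 0 := by
    intro p hp h
    have := abs_fluxForm_coneNormal hm hn hp
    rw [h, inv_zero, zero_smul, map_zero] at this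
    exact (hpos p hp).ne (by simpa using this)
  have h1 := (convex_openSlab (m + n) 0 1).isPreconnected.eq_or_eq_neg_of_sq_eq
    (f := fun p => fluxForm (ambBasis m n)
        (‖coneNormal m n (coneChart m n p)‖⁻¹ • coneNormal m n (coneChart m n p))
        (coordFrame (coneChart m n) p))
    (g := fun p => p (Fin.last _) ^ (m + n) * (radX m n ^ m * radY m n ^ n) *
      orbJacobian m n (Fin.init p)) ?_ ?_ ?_ fun {p} hp => (hpos p hp).ne'
  · rcases h1 with h | h
    · exact ⟨1, abs_one, fun p hp => by simpa using h hp⟩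
    · refine ⟨-1, by simp, fun p hp => ?_⟩
      have := h hp
      simp only [Pi.neg_apply] at this
      rw [this]
      ring
  · exact ((fluxForm (ambBasis m n)).continuous.comp_continuousOn
      ((hN.norm.inv₀ hne).smul hN)).eval hfr
  · refine Continuous.continuousOn ?_
    exact (((continuous_apply _).pow _).mul continuous_const).mul
      (continuous_orbJacobian.comp (initL _).continuous)
  · intro p hp
    simp only [Pi.pow_apply]
    rw [← abs_fluxForm_coneNormal hm hn hp, sq_abs]

theorem norm_coneChart (hm : 1 ≤ m) {p : Fin (m + n + 1) → ℝ} (hp : 0 ≤ p (Fin.last _)) :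
    ‖coneChart m n p‖ = p (Fin.last _) := by
  rw [coneChart_eq_orbitChart, orbitChart, norm_orbPoint, mul_pow, mul_pow, ← mul_add,
    radX_sq_add_radY_sq hm, mul_one, sqrt_sq hp]

theorem exists_truncatedCone_coneTestForm (hm : 1 ≤ m) (hn : 1 ≤ n) :
    ∃ σ : ℝ, |σ| = 1 ∧ ∀ c, truncatedCone m n (coneTestForm m n σ c) =
      (∫ t in Icc (0 : ℝ) 1, annulusCutoff c (t ^ 2) * t ^ (m + n) *
        (radX m n ^ m * radY m n ^ n)) * orbArea m n := by
  obtain ⟨σ, hσ, h⟩ := exists_sign_fluxForm_coneNormal hm hn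
  refine ⟨σ, hσ, fun c => ?_⟩
  have h1 : truncatedCone m n (coneTestForm m n σ c) = ∫ p in openSlab (m + n) 0 1,
      coneTestForm m n σ c (coneChart m n p) (coordFrame (coneChart m n) p) :=
    setIntegral_congr_set (openSlab_ae_eq _ _ _).symm
  rw [h1, orbArea, ← setIntegral_slab_mul, ← setIntegral_congr_set (openSlab_ae_eq _ _ _)]
  refine setIntegral_congr_fun (isOpen_openSlab _ _ _).measurableSet fun p hp => ?_
  have h2 := h p hp
  simp only [map_smul, ContinuousAlternatingMap.smul_apply, smul_eq_mul] at h2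
  simp only [coneTestForm, map_smul, ContinuousAlternatingMap.smul_apply, smul_eq_mul,
    norm_coneChart hm hp.1.le]
  linear_combination annulusCutoff c (p (Fin.last _) ^ 2) * h2

/-- The mass of the truncated cone is at least its area. -/
theorem lt_currentMass_truncatedCone (hm : 1 ≤ m) (hn : 1 ≤ n) {L : ℝ}
    (hL : L < radX m n ^ m * radY m n ^ n / (m + n + 1)) :
    ENNReal.ofReal (L * orbArea m n) < currentMass (truncatedCone m n) := by
  set P := radX m n ^ m * radY m n ^ n with hP
  have hP0 : 0 < P := mul_pos (pow_pos (radX_pos hm) _) (pow_pos (radY_pos hn) _)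
  have h0 : max L 0 < P / (m + n + 1) := max_lt hL (by positivity)
  -- The part of the cone between the radii `c` and 1 has area `(1 - c^α) P / α` times the orbit
  -- area, which exceeds the given value for small `c`. The maximum with 0 supplies the positivity
  -- needed for strict comparison in `ENNReal`.
  have h1 : ∀ᶠ c in 𝓝[>] (0 : ℝ), max L 0 < (1 - c ^ (m + n + 1)) / (m + n + 1) * P ∧ c < 1 := by
    refine nhdsWithin_le_nhds ((ContinuousAt.eventually_lt continuousAt_const (by fun_prop) ?_).and
      (gt_mem_nhds one_pos))
    simp only [ne_eq, Nat.add_eq_zero_iff, one_ne_zero, and_false, not_false_eq_true, zero_pow]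
    rwa [sub_zero, div_mul_eq_mul_div, one_mul]
  obtain ⟨c, ⟨hc, hc1⟩, hc0⟩ := (h1.and self_mem_nhdsWithin).exists
  obtain ⟨σ, hσ, hT⟩ := exists_truncatedCone_coneTestForm hm hn
  have hval : (1 - c ^ (m + n + 1)) / (m + n + 1) * P ≤
      ∫ t in Icc (0 : ℝ) 1, annulusCutoff (c ^ 2) (t ^ 2) * t ^ (m + n) * P := by
    have hcont : Continuous fun t : ℝ => annulusCutoff (c ^ 2) (t ^ 2) * t ^ (m + n) * P :=
      (((contDiff_annulusCutoff _).continuous.comp (continuous_pow 2)).mul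
        (continuous_pow _)).mul continuous_const
    have e1 : ∫ t in Icc c 1, annulusCutoff (c ^ 2) (t ^ 2) * t ^ (m + n) * P =
        (1 - c ^ (m + n + 1)) / (m + n + 1) * P := by
      have : ∫ t in Icc c 1, annulusCutoff (c ^ 2) (t ^ 2) * t ^ (m + n) * P =
          ∫ t in Icc c 1, t ^ (m + n) * P := by
        refine setIntegral_congr_fun measurableSet_Icc fun t ht => ?_
        have ht0 : 0 ≤ t := hc0.le.trans ht.1
        rw [annulusCutoff_eq_one (by positivity) (pow_le_pow_left₀ hc0.le ht.1 2)
          (pow_le_one₀ ht0 ht.2), one_mul]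
      rw [this, integral_Icc_eq_integral_Ioc, ← intervalIntegral.integral_of_le hc1.le,
        intervalIntegral.integral_mul_const, integral_pow]
      simp
    rw [← e1]
    refine setIntegral_mono_set hcont.integrableOn_Icc ?_
      (Icc_subset_Icc_left hc0.le).eventuallyLE
    refine (ae_restrict_iff' measurableSet_Icc).2 (Eventually.of_forall fun t ht => ?_)
    have := ht.1
    have := annulusCutoff_nonneg (c ^ 2) (t ^ 2)
    simp only [Pi.zero_apply]
    positivity
  have hA := orbArea_pos (m := m) (n := n)
  refine lt_of_lt_of_le ?_ (le_iSup₂_of_le (coneTestForm m n σ (c ^ 2))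
    ⟨isTestForm_coneTestForm hm hn σ (by positivity), comass_coneTestForm_le hσ _⟩ le_rfl)
  rw [hT]
  have h2 : max L 0 < ∫ t in Icc (0 : ℝ) 1, annulusCutoff (c ^ 2) (t ^ 2) * t ^ (m + n) * P :=
    hc.trans_le hval
  refine (ENNReal.ofReal_lt_ofReal_iff (mul_pos ((le_max_right _ _).trans_lt h2) hA)).2 ?_
  exact mul_lt_mul_of_pos_right ((le_max_left _ _).trans_lt h2) hA

/-- A union of two swept hypersurfaces of smaller area contradicts minimality of the cone. -/
theorem not_isMassMinimizing_of_curves (hm : 1 ≤ m) (hn : 1 ≤ n) {x₁ y₁ x₂ y₂ : ℝ → ℝ}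
    {a₁ b₁ a₂ b₂ : ℝ} (h₁ : SmoothCurve x₁ y₁ a₁ b₁) (h₂ : SmoothCurve x₂ y₂ a₂ b₂)
    (hstart : x₁ a₁ = 0 ∨ y₁ a₁ = 0) (hx : x₁ b₁ = x₂ a₂) (hy : y₁ b₁ = y₂ a₂)
    (hxe : x₂ b₂ = radX m n) (hye : y₂ b₂ = radY m n)
    (hlen : (∫ t in Icc a₁ b₁, speed m n x₁ y₁ t) + ∫ t in Icc a₂ b₂, speed m n x₂ y₂ t <
      radX m n ^ m * radY m n ^ n / (m + n + 1)) :
    ¬ IsMassMinimizing (truncatedCone m n) := by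
  intro hmin
  -- The mass of the competitor is at most the sum of the two areas, and the mass of the cone is
  -- strictly larger.
  have hmass := hmin _ (isRectifiableCurrent_add h₁ h₂) fun φ hφ => ?_
  · refine (lt_of_lt_of_le (lt_currentMass_truncatedCone hm hn hlen) hmass).not_ge ?_
    refine iSup₂_le fun φ hφ => ENNReal.ofReal_le_ofReal ?_
    rw [add_mul]
    exact add_le_add (h₁.pushCurrent_le hφ.1 hφ.2) (h₂.pushCurrent_le hφ.1 hφ.2)
  -- The boundaries telescope: the initial orbit is degenerate, the two orbits at the junction
  -- cancel, and the final orbit is the link.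
  · have h0 : orbIntegral m n φ (x₁ a₁) (y₁ a₁) = 0 := by
      rcases hstart with h | h <;> rw [h]
      · exact orbIntegral_of_fst_eq_zero hm _ _
      · exact orbIntegral_of_snd_eq_zero hn _ _
    rw [truncatedCone_eq, h₁.pushCurrent_extDeriv hφ, h₂.pushCurrent_extDeriv hφ,
      (smoothCurve_cone m n).pushCurrent_extDeriv hφ, h0, hx, hy, hxe, hye]
    simp only [one_mul, zero_mul, orbIntegral_of_fst_eq_zero hm]
    ring

end ConeMass

/-! ### Instability of the cones with m + n ≤ 5 -/

section LowDimension

variable {m n : ℕ}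

theorem cos_coneAngle (hm : 1 ≤ m) (n : ℕ) : cos (coneAngle m n) = radX m n := by
  have hm0 : (0 : ℝ) < m := by positivity
  rw [coneAngle, cos_arctan, sq_sqrt (by positivity), radX, ← sqrt_one, ← sqrt_div zero_le_one]
  simp only [sqrt_one]
  congr 1
  field_simp

theorem sin_coneAngle (hm : 1 ≤ m) (n : ℕ) : sin (coneAngle m n) = radY m n := by
  have hm0 : (0 : ℝ) < m := by positivity
  rw [coneAngle, sin_arctan, sq_sqrt (by positivity), radY, ← sqrt_div (by positivity)]
  congr 1
  field_simp

/-- Areas are estimated through explicit primitives `E` with derivative at least the speed, so no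
competitor's area has to be computed exactly. -/
theorem SmoothCurve.integral_speed_le {x y E E' : ℝ → ℝ} {a b : ℝ} (hc : SmoothCurve x y a b)
    (hE : ∀ t ∈ Icc a b, HasDerivAt E (E' t) t) (hle : ∀ t ∈ Icc a b, speed m n x y t ≤ E' t) :
    ∫ t in Icc a b, speed m n x y t ≤ E b - E a := by
  rw [integral_Icc_eq_integral_Ioc, ← intervalIntegral.integral_of_le hc.le]
  exact intervalIntegral.integral_le_sub_of_hasDeriv_right_of_le hc.le
    (fun t ht => (hE t ht).continuousAt.continuousWithinAt)
    (fun t ht => (hE t (Ioo_subset_Icc_self ht)).hasDerivWithinAt) hc.integrableOn_speed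
    fun t ht => hle t (Ioo_subset_Icc_self ht)

theorem hasDerivAt_cos_pow_mul_sin_pow (m n : ℕ) {θ : ℝ} (hc : cos θ ≠ 0) (hs : sin θ ≠ 0) :
    HasDerivAt (fun θ => cos θ ^ m * sin θ ^ n)
      (cos θ ^ m * sin θ ^ n * (n * (cos θ / sin θ) - m * (sin θ / cos θ))) θ := by
  refine (((hasDerivAt_cos θ).pow m).mul ((hasDerivAt_sin θ).pow n)).congr_deriv ?_
  simp only [Pi.pow_apply]
  have h1 : (m : ℝ) * cos θ ^ (m - 1) = m * cos θ ^ m / cos θ := by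
    rcases m with _ | m
    · simp
    · rw [Nat.add_sub_cancel, pow_succ]
      field_simp
  have h2 : (n : ℝ) * sin θ ^ (n - 1) = n * sin θ ^ n / sin θ := by
    rcases n with _ | n
    · simp
    · rw [Nat.add_sub_cancel, pow_succ]
      field_simp
  rw [h1, h2]
  field_simp
  ring

/-- The logarithmic derivative of the orbit volume vanishes at the cone angle and has slope `-2(m +
n)` there. Hence the orbit volume is `P (1 - (m + n) x² + …)`, and for `c < m + n` adding `P c x²`
still leaves a strict second-derivative maximum. -/
theorem exists_cos_pow_mul_sin_pow_le (hm : 1 ≤ m) (hn : 1 ≤ n) {c : ℝ} (hc : c < m + n) :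
    ∃ δ > 0, ∀ θ, |θ - coneAngle m n| < δ → 0 ≤ cos θ ∧ 0 ≤ sin θ ∧
      cos θ ^ m * sin θ ^ n ≤
        radX m n ^ m * radY m n ^ n * (1 - c * (θ - coneAngle m n) ^ 2) := by
  have hX := radX_pos (n := n) hm
  have hY := radY_pos (m := m) hn
  have hX2 : radX m n ^ 2 = m / (m + n) := sq_sqrt (by positivity)
  have hY2 : radY m n ^ 2 = n / (m + n) := sq_sqrt (by positivity)
  have hm0 : (0 : ℝ) < m := by positivity
  have hn0 : (0 : ℝ) < n := by positivity
  set θ₀ := coneAngle m n with hθ₀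
  have hcos : cos θ₀ = radX m n := cos_coneAngle hm n
  have hsin : sin θ₀ = radY m n := sin_coneAngle hm n
  set P := radX m n ^ m * radY m n ^ n with hP
  have hP0 : 0 < P := mul_pos (pow_pos hX _) (pow_pos hY _)
  have hev : ∀ᶠ θ in 𝓝 θ₀, 0 < cos θ ∧ 0 < sin θ :=
    (continuousAt_const.eventually_lt continuous_cos.continuousAt (by rw [hcos]; exact hX)).and
      (continuousAt_const.eventually_lt continuous_sin.continuousAt (by rw [hsin]; exact hY))
  set g : ℝ → ℝ := fun θ => cos θ ^ m * sin θ ^ n + P * c * (θ - θ₀) ^ 2 with hg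
  have hq : ∀ θ, HasDerivAt (fun θ => P * c * (θ - θ₀) ^ 2) (P * c * (2 * (θ - θ₀))) θ := fun θ => by
    simpa using (((hasDerivAt_id θ).sub_const θ₀).pow 2).const_mul (P * c)
  set h : ℝ → ℝ := fun θ => n * (cos θ / sin θ) - m * (sin θ / cos θ) with hh
  have hh0 : h θ₀ = 0 := by
    simp only [hh, hcos, hsin]
    field_simp
    rw [hX2, hY2]
    ring
  have hg1 : ∀ θ, 0 < cos θ ∧ 0 < sin θ →
      HasDerivAt g (cos θ ^ m * sin θ ^ n * h θ + P * c * (2 * (θ - θ₀))) θ := fun θ hθ =>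
    (hasDerivAt_cos_pow_mul_sin_pow m n hθ.1.ne' hθ.2.ne').add (hq θ)
  have hd1 : deriv g =ᶠ[𝓝 θ₀] fun θ => cos θ ^ m * sin θ ^ n * h θ + P * c * (2 * (θ - θ₀)) :=
    hev.mono fun θ hθ => (hg1 θ hθ).deriv
  have hd2 : HasDerivAt (fun θ => cos θ ^ m * sin θ ^ n * h θ + P * c * (2 * (θ - θ₀)))
      (P * (2 * (c - (m + n)))) θ₀ := by
    have k1 := hasDerivAt_cos_pow_mul_sin_pow m n hev.self_of_nhds.1.ne' hev.self_of_nhds.2.ne'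
    have k2 : HasDerivAt h (-(2 * (m + n) : ℝ)) θ₀ := by
      refine ((((hasDerivAt_cos θ₀).div (hasDerivAt_sin θ₀) hev.self_of_nhds.2.ne').const_mul
        (n : ℝ)).sub (((hasDerivAt_sin θ₀).div (hasDerivAt_cos θ₀)
          hev.self_of_nhds.1.ne').const_mul (m : ℝ))).congr_deriv ?_
      have h1 := radX_sq_add_radY_sq (n := n) hm
      rw [hcos, hsin]
      have e1 : (-radY m n * radY m n - radX m n * radX m n) / radY m n ^ 2 = -((m + n) / n) := by
        rw [show -radY m n * radY m n - radX m n * radX m n = -1 by linarith, hY2]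
        field_simp
      have e2 : (radX m n * radX m n - radY m n * -radY m n) / radX m n ^ 2 = (m + n) / m := by
        rw [show radX m n * radX m n - radY m n * -radY m n = 1 by linarith, hX2]
        field_simp
      rw [e1, e2]
      field_simp
      ring
    have k3 : HasDerivAt (fun θ => P * c * (2 * (θ - θ₀))) (P * c * 2) θ₀ := by
      simpa using (((hasDerivAt_id θ₀).sub_const θ₀).const_mul 2).const_mul (P * c)
    refine ((k1.mul k2).add k3).congr_deriv ?_
    rw [show (n * (cos θ₀ / sin θ₀) - m * (sin θ₀ / cos θ₀) : ℝ) = 0 from hh0, hcos, hsin]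
    ring
  have hmax : IsLocalMax g θ₀ := by
    refine isLocalMax_of_deriv_deriv_neg ?_ ?_ (hg1 θ₀ hev.self_of_nhds).continuousAt
    · rw [hd1.deriv_eq, hd2.deriv]
      exact mul_neg_of_pos_of_neg hP0 (by linarith)
    · rw [hd1.eq_of_nhds, hh0]
      simp
  obtain ⟨δ, hδ, hball⟩ := Metric.eventually_nhds_iff.1 (hmax.and hev)
  refine ⟨δ, hδ, fun θ hθ => ?_⟩
  obtain ⟨h1, h2, h3⟩ := hball (y := θ) (by rwa [Real.dist_eq])
  refine ⟨h2.le, h3.le, ?_⟩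
  have hg0 : g θ₀ = P := by simp [hg, hcos, hsin, hP]
  rw [hg0] at h1
  simp only [hg] at h1
  linarith

theorem speed_polar {θ : ℝ → ℝ} {θ' s : ℝ} (h : HasDerivAt θ θ' s) (hc : 0 ≤ cos (θ s))
    (hs : 0 ≤ sin (θ s)) :
    speed m n (fun s => exp s * cos (θ s)) (fun s => exp s * sin (θ s)) s =
      exp ((m + n + 1) * s) * (cos (θ s) ^ m * sin (θ s) ^ n) * √(1 + θ' ^ 2) := by
  have h1 : HasDerivAt (fun s => exp s * cos (θ s)) _ s := (hasDerivAt_exp s).mul h.cos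
  have h2 : HasDerivAt (fun s => exp s * sin (θ s)) _ s := (hasDerivAt_exp s).mul h.sin
  have h3 : (exp s * cos (θ s) + exp s * (-sin (θ s) * θ')) ^ 2 +
      (exp s * sin (θ s) + exp s * (cos (θ s) * θ')) ^ 2 = exp s ^ 2 * (1 + θ' ^ 2) := by
    linear_combination exp s ^ 2 * (1 + θ' ^ 2) * sin_sq_add_cos_sq (θ s)
  have h4 : exp ((m + n + 1) * s) = exp s ^ m * exp s ^ n * exp s := by
    rw [← exp_nat_mul, ← exp_nat_mul, ← exp_add, ← exp_add]
    ring_nf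
  rw [speed, h1.deriv, h2.deriv, h3, sqrt_mul (sq_nonneg _), sqrt_sq (exp_pos s).le, h4,
    abs_of_nonneg (mul_nonneg (exp_pos s).le hc), abs_of_nonneg (mul_nonneg (exp_pos s).le hs),
    mul_pow, mul_pow]
  ring

/-- The cones of dimension at most six are not minimizing: an explicit perturbation of the ray
through the link decreases area. -/
theorem not_isMassMinimizing_of_add_le_five (hm : 1 ≤ m) (hn : 1 ≤ n) (hN : m + n ≤ 5) :
    ¬ IsMassMinimizing (truncatedCone m n) := by
  -- The loss of 1/10 in the quadratic coefficient is affordable: it leaves the margin 4/10 in `h6`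
  -- below.
  obtain ⟨δ, hδ, hk⟩ := exists_cos_pow_mul_sin_pow_le hm hn (c := m + n - 1 / 10) (by linarith)
  have hX := radX_pos (n := n) hm
  have hY := radY_pos (m := m) hn
  set P := radX m n ^ m * radY m n ^ n with hP
  have hP0 : 0 < P := mul_pos (pow_pos hX _) (pow_pos hY _)
  set α : ℝ := m + n + 1 with hα
  have hα0 : 0 < α := by positivity
  -- For `s` in `[-4, 0]` the perturbation is at most `4 r exp (2α) = δ / 2`.
  set r : ℝ := δ * exp (-(2 * α)) / 8 with hr
  have hr0 : 0 < r := by positivity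
  -- In `s = log R` the second variation is `∫ exp (αs) (x'²/2 - (α-1) x²)`. With `x = exp (-αs/2)
  -- p` the weight disappears, and for `p` vanishing at both ends it equals `∫ p'²/2 - (α - 1 -
  -- α²/8) p²`. The parabola vanishing at -4 and 0 makes this negative for `α ≤ 6`.
  set p : ℝ → ℝ := fun s => s ^ 2 + 4 * s with hp
  set θ : ℝ → ℝ := fun s => coneAngle m n + r * (exp (-(α / 2) * s) * p s) with hθ
  set θ' : ℝ → ℝ := fun s => r * (exp (-(α / 2) * s) * (2 * s + 4 - α / 2 * p s)) with hθ'
  have hpd : ∀ s, HasDerivAt p (2 * s + 4) s := fun s => by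
    refine ((hasDerivAt_pow 2 s).add ((hasDerivAt_id s).const_mul 4)).congr_deriv ?_
    simp
  have hθd : ∀ s, HasDerivAt θ (θ' s) s := fun s => by
    refine (((((hasDerivAt_id s).const_mul (-(α / 2))).exp.mul (hpd s)).const_mul r).const_add
      (coneAngle m n)).congr_deriv ?_
    simp only [hθ', id]
    ring
  have hθs : ContDiff ℝ ∞ θ := by
    have : ContDiff ℝ ∞ p := by fun_prop
    fun_prop
  have hc₁ : SmoothCurve (fun t => t * radX m n) (fun t => t * radY m n) 0 (exp (-4)) :=
    ⟨(exp_pos _).le, fun _ _ => (contDiff_id.mul contDiff_const).contDiffAt,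
      fun _ _ => (contDiff_id.mul contDiff_const).contDiffAt⟩
  have hc₂ : SmoothCurve (fun s => exp s * cos (θ s)) (fun s => exp s * sin (θ s)) (-4) 0 :=
    ⟨by norm_num, fun _ _ => (contDiff_exp.mul (contDiff_cos.comp hθs)).contDiffAt,
      fun _ _ => (contDiff_exp.mul (contDiff_sin.comp hθs)).contDiffAt⟩
  have hp4 : p (-4) = 0 := by norm_num [hp]
  have hp0 : p 0 = 0 := by norm_num [hp]
  have l₁ : ∫ t in Icc 0 (exp (-4)), speed m n (fun t => t * radX m n) (fun t => t * radY m n) t ≤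
      P * exp (-4 * α) / α - 0 := by
    have key := hc₁.integral_speed_le (m := m) (n := n) (E := fun t => P * t ^ (m + n + 1) / α)
      (E' := fun t => P * t ^ (m + n)) (fun t _ => ?_) fun t ht => ?_
    · refine key.trans_eq ?_
      have e1 : exp (-4) ^ (m + n + 1) = exp (-4 * α) := by
        rw [← exp_nat_mul, hα]
        push_cast
        ring_nf
      rw [e1]
      simp
    · refine (((hasDerivAt_pow (m + n + 1) t).const_mul P).div_const α).congr_deriv ?_
      simp only [Nat.add_sub_cancel, hα]
      push_cast
      field_simp
    · rw [speed_cone hm, abs_of_nonneg ht.1, mul_comm]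
  -- A primitive of the second-variation density. The mixed term `p p'` integrates to `p² / 2`,
  -- which vanishes at both ends.
  set G : ℝ → ℝ := fun s => -(α - 1 - 1 / 10 - α ^ 2 / 8) * (s ^ 5 / 5 + 2 * s ^ 4 + 16 / 3 * s ^ 3) +
    (4 / 3 * s ^ 3 + 8 * s ^ 2 + 16 * s) / 2 - α / 4 * p s ^ 2 with hG
  have l₂ : ∫ s in Icc (-4) 0, speed m n (fun s => exp s * cos (θ s)) (fun s => exp s * sin (θ s)) s ≤
      P * (exp (α * 0) / α + r ^ 2 * G 0) - P * (exp (α * -4) / α + r ^ 2 * G (-4)) := by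
    refine hc₂.integral_speed_le (E := fun s => P * (exp (α * s) / α + r ^ 2 * G s))
      (E' := fun s => P * (exp (α * s) + r ^ 2 * (-(α - 1 - 1 / 10) * p s ^ 2 +
        (2 * s + 4 - α / 2 * p s) ^ 2 / 2))) (fun s _ => ?_) fun s hs => ?_
    · have g1 : HasDerivAt G (-(α - 1 - 1 / 10) * p s ^ 2 +
          (2 * s + 4 - α / 2 * p s) ^ 2 / 2) s := by
        refine ((((((hasDerivAt_pow 5 s).div_const 5).add ((hasDerivAt_pow 4 s).const_mul 2)).add
          ((hasDerivAt_pow 3 s).const_mul (16 / 3))).const_mul _).add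
          (((((hasDerivAt_pow 3 s).const_mul (4 / 3)).add ((hasDerivAt_pow 2 s).const_mul 8)).add
            ((hasDerivAt_id s).const_mul 16)).div_const 2)).sub
          (((hpd s).pow 2).const_mul (α / 4)) |>.congr_deriv ?_
        simp only [hp]
        norm_num
        ring
      have g2 := (((hasDerivAt_id s).const_mul α).exp.div_const α).add (g1.const_mul (r ^ 2))
      refine (g2.const_mul P).congr_deriv ?_
      simp only [id]
      field_simp
    · have hsx : |θ s - coneAngle m n| < δ := by
        have e1 : |p s| ≤ 4 := by
          rw [abs_le]
          constructor <;> simp only [hp] <;> nlinarith [hs.1, hs.2, sq_nonneg (s + 2)]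
        have e2 : exp (-(α / 2) * s) ≤ exp (2 * α) := exp_le_exp.2 (by nlinarith [hs.1])
        simp only [hθ, add_sub_cancel_left]
        rw [abs_mul, abs_mul, abs_of_pos hr0, abs_of_pos (exp_pos _)]
        calc r * (exp (-(α / 2) * s) * |p s|) ≤ r * (exp (2 * α) * 4) := by gcongr
          _ = δ / 2 * (exp (-(2 * α)) * exp (2 * α)) := by rw [hr]; ring
          _ < δ := by rw [← exp_add]; simp; linarith
      obtain ⟨k1, k2, k3⟩ := hk _ hsx
      rw [speed_polar (hθd s) k1 k2, ← hα]
      have e3 : √(1 + θ' s ^ 2) ≤ 1 + θ' s ^ 2 / 2 := by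
        rw [sqrt_le_left (by positivity)]
        nlinarith [sq_nonneg (θ' s ^ 2)]
      have hee : exp (α * s) * exp (-(α / 2) * s) ^ 2 = 1 := by
        rw [← exp_nat_mul, ← exp_add]
        convert exp_zero using 2
        push_cast
        ring
      have hx2 : (θ s - coneAngle m n) ^ 2 * exp (α * s) = r ^ 2 * p s ^ 2 := by
        simp only [hθ]
        linear_combination r ^ 2 * p s ^ 2 * hee
      have hx' : θ' s ^ 2 * exp (α * s) = r ^ 2 * (2 * s + 4 - α / 2 * p s) ^ 2 := by
        simp only [hθ']
        linear_combination r ^ 2 * (2 * s + 4 - α / 2 * p s) ^ 2 * hee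
      have hα1 : 0 ≤ α - 1 - 1 / 10 := by
        have : (1 : ℝ) ≤ m := by exact_mod_cast hm
        have : (1 : ℝ) ≤ n := by exact_mod_cast hn
        linarith
      calc exp (α * s) * (cos (θ s) ^ m * sin (θ s) ^ n) * √(1 + θ' s ^ 2)
          ≤ exp (α * s) * (cos (θ s) ^ m * sin (θ s) ^ n) * (1 + θ' s ^ 2 / 2) := by gcongr
        _ ≤ exp (α * s) * (P * (1 - (m + n - 1 / 10) * (θ s - coneAngle m n) ^ 2)) *
            (1 + θ' s ^ 2 / 2) := by gcongr
        -- The term of fourth order in the perturbation has a favourable sign and is dropped in the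
        -- next step.
        _ = P * (exp (α * s) - (α - 1 - 1 / 10) * ((θ s - coneAngle m n) ^ 2 * exp (α * s)) +
              θ' s ^ 2 * exp (α * s) / 2) -
            P * (α - 1 - 1 / 10) * ((θ s - coneAngle m n) ^ 2 * exp (α * s)) * θ' s ^ 2 / 2 := by
          rw [hα]; ring
        _ ≤ P * (exp (α * s) - (α - 1 - 1 / 10) * ((θ s - coneAngle m n) ^ 2 * exp (α * s)) +
              θ' s ^ 2 * exp (α * s) / 2) := by
          refine sub_le_self _ ?_
          positivity
        _ = _ := by rw [hx2, hx']; ring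
  refine not_isMassMinimizing_of_curves hm hn hc₁ hc₂ (Or.inl (by simp)) ?_ ?_ ?_ ?_ ?_
  · simp [hθ, hp4, cos_coneAngle hm]
  · simp [hθ, hp4, sin_coneAngle hm]
  · simp [hθ, hp0, cos_coneAngle hm]
  · simp [hθ, hp0, sin_coneAngle hm]
  · refine (add_le_add l₁ l₂).trans_lt ?_
    -- Here `∫ p² = 512/15` and `∫ p'²/2 = 32/3` over `[-4, 0]`, so a coefficient of at least 4/10
    -- on `∫ p²` is sufficient.
    have hG4 : 0 < G (-4) := by
      have h5 : (m : ℝ) + n ≤ 5 := by exact_mod_cast hN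
      have h2 : (2 : ℝ) ≤ m + n := by exact_mod_cast (add_le_add hm hn)
      have h6 : 4 / 10 ≤ α - 1 - 1 / 10 - α ^ 2 / 8 := by
        simp only [hα]
        nlinarith
      simp only [hG, hp4]
      nlinarith
    have hG0 : G 0 = 0 := by simp [hG, hp0]
    rw [hG0, mul_zero, exp_zero, mul_comm α (-4)]
    have : 0 < P * (r ^ 2 * G (-4)) := by positivity
    have e : P * exp (-4 * α) / α - 0 + (P * (1 / α + r ^ 2 * 0) -
      P * (exp (-4 * α) / α + r ^ 2 * G (-4))) = P / α - P * (r ^ 2 * G (-4)) := by ring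
    rw [e]
    linarith

end LowDimension

/-! ### A competitor for the cone over S¹ × S⁵ -/

section LopsidedCone

/-- The cosine of the angle at slope `√5 / w`. -/
def slopeX (w : ℝ) : ℝ := w / √(5 + w ^ 2)

/-- The sine of the angle at slope `√5 / w`. -/
def slopeY (w : ℝ) : ℝ := √5 / √(5 + w ^ 2)

theorem hasDerivAt_sqrt_five_add_sq (w : ℝ) :
    HasDerivAt (fun w => √(5 + w ^ 2)) (w / √(5 + w ^ 2)) w := by
  refine (((hasDerivAt_pow 2 w).const_add 5).sqrt (by positivity)).congr_deriv ?_
  field_simp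
  push_cast
  ring

theorem hasDerivAt_slopeX (w : ℝ) :
    HasDerivAt slopeX (5 / ((5 + w ^ 2) * √(5 + w ^ 2))) w := by
  have h0 : 0 < √(5 + w ^ 2) := sqrt_pos.2 (by positivity)
  have h1 : √(5 + w ^ 2) ^ 2 = 5 + w ^ 2 := sq_sqrt (by positivity)
  refine ((hasDerivAt_id w).div (hasDerivAt_sqrt_five_add_sq w) h0.ne').congr_deriv ?_
  simp only [id]
  generalize √(5 + w ^ 2) = r at h0 h1 ⊢
  rw [← h1]
  field_simp
  linear_combination h1

theorem hasDerivAt_slopeY (w : ℝ) :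
    HasDerivAt slopeY (-(√5 * w / ((5 + w ^ 2) * √(5 + w ^ 2)))) w := by
  have h0 : 0 < √(5 + w ^ 2) := sqrt_pos.2 (by positivity)
  have h1 : √(5 + w ^ 2) ^ 2 = 5 + w ^ 2 := sq_sqrt (by positivity)
  refine ((hasDerivAt_const w (√5)).div (hasDerivAt_sqrt_five_add_sq w) h0.ne').congr_deriv ?_
  generalize √(5 + w ^ 2) = r at h0 h1 ⊢
  rw [← h1]
  field_simp
  ring

theorem contDiff_sqrt_five_add_sq : ContDiff ℝ ∞ fun w : ℝ => √(5 + w ^ 2) := by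
  refine ContDiff.sqrt (by fun_prop) fun w => ?_
  positivity

theorem contDiff_slopeX : ContDiff ℝ ∞ slopeX :=
  contDiff_id.div contDiff_sqrt_five_add_sq fun w => (sqrt_pos.2 (by positivity)).ne'

theorem contDiff_slopeY : ContDiff ℝ ∞ slopeY :=
  contDiff_const.div contDiff_sqrt_five_add_sq fun w => (sqrt_pos.2 (by positivity)).ne'

/-- In the coordinates `ρ = log R` and `w`, the value `w = 1` is the cone and `w = 0` the axis `X =
0`. The last square root is the length of the curve in `log R` and the angle. -/
theorem speed_slope {ρ w : ℝ → ℝ} {σ w' t : ℝ} (hρ : HasDerivAt ρ σ t) (hw : HasDerivAt w w' t)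
    (h0 : 0 ≤ w t) :
    speed 1 5 (fun t => exp (ρ t) * slopeX (w t)) (fun t => exp (ρ t) * slopeY (w t)) t =
      25 * √5 * (exp (7 * ρ t) * (w t / (5 + w t ^ 2) ^ 3)) *
        √(σ ^ 2 + 5 * w' ^ 2 / (5 + w t ^ 2) ^ 2) := by
  have hX : HasDerivAt (fun t => exp (ρ t) * slopeX (w t)) _ t :=
    hρ.exp.mul ((hasDerivAt_slopeX (w t)).comp t hw)
  have hY : HasDerivAt (fun t => exp (ρ t) * slopeY (w t)) _ t :=
    hρ.exp.mul ((hasDerivAt_slopeY (w t)).comp t hw)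
  have hr0 : 0 < √(5 + w t ^ 2) := sqrt_pos.2 (by positivity)
  have hr1 : √(5 + w t ^ 2) ^ 2 = 5 + w t ^ 2 := sq_sqrt (by positivity)
  have h5 : √5 ^ 2 = (5 : ℝ) := sq_sqrt (by norm_num)
  have h55 : √5 ^ 5 = (25 * √5 : ℝ) := by linear_combination (√5 ^ 3 + 5 * √5) * h5
  have he : exp (7 * ρ t) = exp (ρ t) ^ 7 := by rw [← exp_nat_mul]; norm_num
  rw [speed, hX.deriv, hY.deriv, he]
  simp only [slopeX, slopeY]
  generalize √(5 + w t ^ 2) = r at hr0 hr1 ⊢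
  rw [← hr1]
  have h6 : (exp (ρ t) * σ * (w t / r) + exp (ρ t) * (5 / (r ^ 2 * r) * w')) ^ 2 +
      (exp (ρ t) * σ * (√5 / r) + exp (ρ t) * (-(√5 * w t / (r ^ 2 * r)) * w')) ^ 2 =
      exp (ρ t) ^ 2 * (σ ^ 2 + 5 * w' ^ 2 / (r ^ 2) ^ 2) := by
    field_simp
    linear_combination (σ ^ 2 * r ^ 4 + w' ^ 2 * w t ^ 2 - 2 * σ * r ^ 2 * w' * w t) * h5 -
      (σ ^ 2 * r ^ 4 + 5 * w' ^ 2) * hr1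
  rw [h6, sqrt_mul (sq_nonneg _), sqrt_sq (exp_pos _).le, abs_of_nonneg (by positivity),
    abs_of_nonneg (by positivity), pow_one, mul_pow, div_pow, h55]
  field_simp

/-- A criterion for a function with derivative at least the speed. -/
theorem exists_hasDerivAt_speed_le {ρ w σ Z : ℝ → ℝ} {w' σ' Z' t : ℝ} (hρ : HasDerivAt ρ (σ t) t)
    (hw : HasDerivAt w w' t) (hσ : HasDerivAt σ σ' t) (hZ : HasDerivAt Z Z' t)
    (hZe : Z t = σ t ^ 2 + 5 * w' ^ 2 / (5 + w t ^ 2) ^ 2) (hZ0 : 0 < Z t) (h0 : 0 ≤ w t)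
    (hineq : 14 * w t * Z t ^ 2 ≤ 2 * Z t * (w' * σ t + w t * σ' + w t * σ t * (7 * σ t -
      6 * (w t * w') / (5 + w t ^ 2))) - w t * σ t * Z') :
    ∃ E', HasDerivAt (fun t => 25 * √5 / 7 *
        (exp (7 * ρ t) * (w t / (5 + w t ^ 2) ^ 3) * (σ t / √(Z t)))) E' t ∧
      speed 1 5 (fun t => exp (ρ t) * slopeX (w t)) (fun t => exp (ρ t) * slopeY (w t)) t ≤ E' := by
  have hA : HasDerivAt (fun t => (5 + w t ^ 2) ^ 3) (6 * (5 + w t ^ 2) ^ 2 * w t * w') t :=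
    (((hw.pow 2).const_add 5).pow 3).congr_deriv (by simp; ring)
  have hr0 : 0 < √(Z t) := sqrt_pos.2 hZ0
  have hA0 : 0 < 5 + w t ^ 2 := by positivity
  -- The candidate primitive is `R⁷ V cos ψ / 7`, with `ψ` the angle between the curve and the ray.
  -- For a stationary hypersurface its derivative is the area density, by the first variation under
  -- homotheties. For an approximate solution `hineq` gives an inequality.
  refine ⟨_, ((((hρ.const_mul 7).exp.mul (hw.div hA (by positivity))).mul
    (hσ.div (hZ.sqrt hZ0.ne') hr0.ne')).const_mul _), ?_⟩
  rw [speed_slope hρ hw h0, ← hZe]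
  have hr1 : Z t = √(Z t) ^ 2 := (sq_sqrt hZ0.le).symm
  rw [← sub_nonneg] at hineq ⊢
  -- The excess of the derivative over the speed is exactly this factor times the slack in `hineq`.
  have hpos : 0 ≤ 25 * √5 / 7 * exp (7 * ρ t) / ((5 + w t ^ 2) ^ 3 * (2 * Z t * √(Z t))) := by
    positivity
  refine (mul_nonneg hpos hineq).trans_eq ?_
  simp only [Pi.mul_apply, Pi.div_apply]
  generalize √(Z t) = r at hr0 hr1 ⊢
  rw [hr1]
  field_simp
  ring

/-- The quadratic part has negative discriminant and its minimum near `27/32`; the cubic term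
absorbs the negative terms of degrees five and six. -/
theorem axis_polynomial_nonneg {v : ℝ} (h0 : 0 ≤ v) (h1 : v ≤ 9 / 10) :
    0 ≤ v * (37 / 8 - 1671 / 160 * v + 19803 / 3200 * v ^ 2 + 9127 / 64000 * v ^ 3 +
      3537 / 64000 * v ^ 4 - 4131 / 64000 * v ^ 5 - 729 / 64000 * v ^ 6) := by
  have h3 : 0 ≤ v ^ 3 := by positivity
  have h4 : 0 ≤ v ^ 4 := by positivity
  have h5 : v ^ 5 ≤ v ^ 3 := pow_le_pow_of_le_one h0 (by linarith) (by norm_num)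
  have h6 : v ^ 6 ≤ v ^ 3 := pow_le_pow_of_le_one h0 (by linarith) (by norm_num)
  refine mul_nonneg h0 ?_
  nlinarith [sq_nonneg (v - 27 / 32)]

/-- The hypersurface leaving the axis `X = 0`, in the coordinate `w`. -/
theorem exists_potential_near_axis (C t : ℝ) (h0 : 0 ≤ t) (h1 : t ^ 2 ≤ 9 / 10) :
    ∃ E', HasDerivAt (fun t => 25 * √5 / 7 *
        (exp (7 * (C - 19 / 80 * log (1 - t ^ 2) + 9 / 80 * t ^ 2)) * (t / (5 + t ^ 2) ^ 3) *
          (t * (7 / 10 - 9 / 40 * t ^ 2) / (1 - t ^ 2) /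
            √((t * (7 / 10 - 9 / 40 * t ^ 2) / (1 - t ^ 2)) ^ 2 + 5 / (5 + t ^ 2) ^ 2)))) E' t ∧
      speed 1 5 (fun t => exp (C - 19 / 80 * log (1 - t ^ 2) + 9 / 80 * t ^ 2) * slopeX t)
        (fun t => exp (C - 19 / 80 * log (1 - t ^ 2) + 9 / 80 * t ^ 2) * slopeY t) t ≤ E' := by
  have hv : 0 < 1 - t ^ 2 := by linarith
  have hsq : HasDerivAt (fun t : ℝ => t ^ 2) (2 * t) t := by simpa using hasDerivAt_pow 2 t
  -- The coefficient `7/10` makes the leading terms of the required inequality equal at `t = 0`, as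
  -- for a stationary curve leaving the axis orthogonally. With the next coefficient `9/40` the
  -- remaining polynomial is nonnegative up to `t² = 9/10`.
  have hρ : HasDerivAt (fun t => C - 19 / 80 * log (1 - t ^ 2) + 9 / 80 * t ^ 2)
      (t * (7 / 10 - 9 / 40 * t ^ 2) / (1 - t ^ 2)) t := by
    refine ((((hsq.const_sub 1).log hv.ne').const_mul (19 / 80)).const_sub C).add
      (hsq.const_mul (9 / 80)) |>.congr_deriv ?_
    field_simp
    ring
  have hσ : HasDerivAt (fun t => t * (7 / 10 - 9 / 40 * t ^ 2) / (1 - t ^ 2))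
      (((7 / 10 - 9 / 40 * t ^ 2) * (1 - t ^ 2) + 19 / 20 * t ^ 2) / (1 - t ^ 2) ^ 2) t := by
    refine (((hasDerivAt_id t).mul ((hsq.const_mul (9 / 40)).const_sub (7 / 10))).div
      (hsq.const_sub 1) hv.ne').congr_deriv ?_
    simp only [id, Pi.mul_apply]
    field_simp
    ring
  have hZ : HasDerivAt (fun t => (t * (7 / 10 - 9 / 40 * t ^ 2) / (1 - t ^ 2)) ^ 2 +
      5 / (5 + t ^ 2) ^ 2) (2 * (t * (7 / 10 - 9 / 40 * t ^ 2) / (1 - t ^ 2)) *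
        (((7 / 10 - 9 / 40 * t ^ 2) * (1 - t ^ 2) + 19 / 20 * t ^ 2) / (1 - t ^ 2) ^ 2) -
          20 * t / (5 + t ^ 2) ^ 3) t := by
    refine ((hσ.pow 2).add ((hasDerivAt_const t (5 : ℝ)).div ((hsq.const_add 5).pow 2)
      (show (5 + t ^ 2) ^ 2 ≠ 0 by positivity))).congr_deriv ?_
    simp only [Pi.pow_apply]
    push_cast
    field_simp
    ring
  have hZ0 : 0 < (t * (7 / 10 - 9 / 40 * t ^ 2) / (1 - t ^ 2)) ^ 2 + 5 / (5 + t ^ 2) ^ 2 := by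
    positivity
  refine exists_hasDerivAt_speed_le hρ (hasDerivAt_id t) hσ hZ (by simp) hZ0 h0 ?_
  have hp := axis_polynomial_nonneg (sq_nonneg t) h1
  have hfac : 0 ≤ 10 * t / ((5 + t ^ 2) ^ 4 * (1 - t ^ 2) ^ 2) := by positivity
  rw [← sub_nonneg]
  refine (mul_nonneg hfac hp).trans_eq ?_
  field_simp
  ring

/-- The hypersurface joining the cone, in the coordinate `s = log R`. -/
theorem exists_potential_near_cone {a s : ℝ} (ha : 0 < a) (hs : s ≤ 0)
    (hu : a * (exp (-s) ^ 4 - exp (-s) ^ 3) ≤ 1 / 10)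
    (hd : a * (4 * exp (-s) ^ 4 - 3 * exp (-s) ^ 3) ≤ 1) :
    ∃ E', HasDerivAt (fun s => 25 * √5 / 7 * (exp (7 * s) *
        (√(1 - a * (exp (-s) ^ 4 - exp (-s) ^ 3)) /
          (5 + √(1 - a * (exp (-s) ^ 4 - exp (-s) ^ 3)) ^ 2) ^ 3) *
        (1 / √(1 + 5 * (a * (4 * exp (-s) ^ 4 - 3 * exp (-s) ^ 3)) ^ 2 /
          (4 * (1 - a * (exp (-s) ^ 4 - exp (-s) ^ 3)) *
            (6 - a * (exp (-s) ^ 4 - exp (-s) ^ 3)) ^ 2))))) E' s ∧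
      speed 1 5 (fun s => exp s * slopeX √(1 - a * (exp (-s) ^ 4 - exp (-s) ^ 3)))
        (fun s => exp s * slopeY √(1 - a * (exp (-s) ^ 4 - exp (-s) ^ 3))) s ≤ E' := by
  have hz1 : 1 ≤ exp (-s) := one_le_exp (by linarith)
  have hexp : HasDerivAt (fun s => exp (-s)) (-exp (-s)) s := by
    simpa using (hasDerivAt_neg s).exp
  -- For `α = 7` the Jacobi equation of the cone is `u'' + 7u' + 12u = 0`, with exponents -3 and -4.
  -- The function `u = 1 - w²` is the decaying combination that vanishes at `s = 0`, and `d = -u'`.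
  have hud : HasDerivAt (fun s => a * (exp (-s) ^ 4 - exp (-s) ^ 3))
      (-(a * (4 * exp (-s) ^ 4 - 3 * exp (-s) ^ 3))) s := by
    refine (((hexp.pow 4).sub (hexp.pow 3)).const_mul a).congr_deriv ?_
    push_cast
    ring
  have hdd : HasDerivAt (fun s => a * (4 * exp (-s) ^ 4 - 3 * exp (-s) ^ 3))
      (12 * (a * (exp (-s) ^ 4 - exp (-s) ^ 3)) -
        7 * (a * (4 * exp (-s) ^ 4 - 3 * exp (-s) ^ 3))) s := by
    refine ((((hexp.pow 4).const_mul 4).sub ((hexp.pow 3).const_mul 3)).const_mul a).congr_deriv ?_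
    push_cast
    ring
  have hu0 : 0 ≤ a * (exp (-s) ^ 4 - exp (-s) ^ 3) :=
    mul_nonneg ha.le (sub_nonneg.2 (pow_le_pow_right₀ hz1 (by norm_num)))
  have h4u : 4 * (a * (exp (-s) ^ 4 - exp (-s) ^ 3)) ≤
      a * (4 * exp (-s) ^ 4 - 3 * exp (-s) ^ 3) := by
    have : 0 < a * exp (-s) ^ 3 := by positivity
    linarith
  have hd0 : 0 < a * (4 * exp (-s) ^ 4 - 3 * exp (-s) ^ 3) := by
    have : 0 < a * exp (-s) ^ 3 := by positivity
    linarith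
  set u : ℝ → ℝ := fun s => a * (exp (-s) ^ 4 - exp (-s) ^ 3) with hu_def
  set d : ℝ → ℝ := fun s => a * (4 * exp (-s) ^ 4 - 3 * exp (-s) ^ 3) with hd_def
  change u s ≤ 1 / 10 at hu
  change d s ≤ 1 at hd
  change 0 ≤ u s at hu0
  change 4 * u s ≤ d s at h4u
  change 0 < d s at hd0
  change HasDerivAt u (-d s) s at hud
  change HasDerivAt d (12 * u s - 7 * d s) s at hdd
  change ∃ E', HasDerivAt (fun s => 25 * √5 / 7 * (exp (7 * s) *
    (√(1 - u s) / (5 + √(1 - u s) ^ 2) ^ 3) *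
      (1 / √(1 + 5 * d s ^ 2 / (4 * (1 - u s) * (6 - u s) ^ 2))))) E' s ∧
    speed 1 5 (fun s => exp s * slopeX √(1 - u s)) (fun s => exp s * slopeY √(1 - u s)) s ≤ E'
  clear_value u d
  have hv : 0 < 1 - u s := by linarith
  have hg : 0 < 6 - u s := by linarith
  have hw : HasDerivAt (fun s => √(1 - u s)) (d s / (2 * √(1 - u s))) s := by
    simpa using (hud.const_sub 1).sqrt hv.ne'
  have hZ : HasDerivAt (fun s => 1 + 5 * d s ^ 2 / (4 * (1 - u s) * (6 - u s) ^ 2))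
      (5 * d s / (4 * (1 - u s) * (6 - u s) ^ 2) *
        (2 * (12 * u s - 7 * d s) - d s ^ 2 / (1 - u s) - 2 * d s ^ 2 / (6 - u s))) s := by
    refine ((((hdd.pow 2).const_mul 5).div (((hud.const_sub 1).const_mul 4).mul
      ((hud.const_sub 6).pow 2)) (show 4 * (1 - u s) * (6 - u s) ^ 2 ≠ 0 by positivity)).const_add 1).congr_deriv ?_
    simp only [Pi.pow_apply, Pi.mul_apply]
    push_cast
    field_simp
    ring
  have hr0 : 0 < √(1 - u s) := sqrt_pos.2 hv
  have hr1 : √(1 - u s) ^ 2 = 1 - u s := sq_sqrt hv.le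
  have hZ0 : 0 < 1 + 5 * d s ^ 2 / (4 * (1 - u s) * (6 - u s) ^ 2) := by positivity
  refine exists_hasDerivAt_speed_le (ρ := id) (σ := fun _ => 1) (hasDerivAt_id s) hw
    (hasDerivAt_const s 1) hZ ?_ hZ0 hr0.le ?_
  · simp only [div_pow, mul_pow, hr1]
    rw [show 5 + (1 - u s) = 6 - u s by ring]
    field_simp
    ring
  -- By the Jacobi equation only terms of second and higher order in `u, d` remain beside the common
  -- factor `hfac`. The term `d²/2` outweighs the negative ones, since `35/100 + 1/8 < 1/2`.
  · have hslack : 0 ≤ (1 - u s) * d s ^ 2 / (6 - u s) + d s ^ 2 / 2 - 2 * u s ^ 2 * (1 - u s) -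
        5 * d s ^ 2 * (7 * d s - 2 * u s * (6 - u s)) / (4 * (6 - u s) ^ 2) := by
      have e1 : 5 * d s ^ 2 * (7 * d s - 2 * u s * (6 - u s)) / (4 * (6 - u s) ^ 2) ≤
          d s ^ 2 * (35 / 100) := by
        rw [div_le_iff₀ (by positivity)]
        have : 0 ≤ u s * (6 - u s) := by positivity
        have h7 : 5 * (7 * d s - 2 * u s * (6 - u s)) ≤ 35 / 100 * (4 * (6 - u s) ^ 2) := by
          nlinarith
        nlinarith [mul_le_mul_of_nonneg_left h7 (sq_nonneg (d s))]
      have e2 : 2 * u s ^ 2 * (1 - u s) ≤ d s ^ 2 * (1 / 8) := by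
        have : u s ^ 2 ≤ d s ^ 2 / 16 := by nlinarith
        nlinarith [sq_nonneg (u s)]
      have e3 : 0 ≤ (1 - u s) * d s ^ 2 / (6 - u s) := by positivity
      nlinarith [sq_nonneg (d s)]
    have hfac : 0 ≤ 5 * d s / (2 * (6 - u s) ^ 2 * (1 - u s)) / √(1 - u s) := by positivity
    rw [← sub_nonneg]
    refine (mul_nonneg hfac hslack).trans_eq ?_
    have hA : 5 + √(1 - u s) ^ 2 = 6 - u s := by rw [hr1]; ring
    have hww : √(1 - u s) * (d s / (2 * √(1 - u s))) = d s / 2 := by field_simp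
    rw [hA, hww]
    have hv' : u s = 1 - √(1 - u s) ^ 2 := by rw [hr1]; ring
    generalize √(1 - u s) = r at hr0 hr1 hv' ⊢
    rw [← hr1]
    have hg' : 6 - u s = 5 + r ^ 2 := by rw [hv']; ring
    rw [hg', hv']
    field_simp
    ring

theorem slopeX_one : slopeX 1 = radX 1 5 := by
  rw [slopeX, radX, Nat.cast_one, sqrt_div zero_le_one]
  norm_num

theorem slopeY_one : slopeY 1 = radY 1 5 := by
  rw [slopeY, radY, sqrt_div (by norm_num)]
  norm_num

theorem radX_mul_radY_pow : radX 1 5 ^ 1 * radY 1 5 ^ 5 = 25 * √5 / 216 := by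
  have h5 : √5 ^ 2 = (5 : ℝ) := sq_sqrt (by norm_num)
  have h6 : √6 ^ 2 = (6 : ℝ) := sq_sqrt (by norm_num)
  have h6' : √6 ≠ (0 : ℝ) := (sqrt_pos.2 (by norm_num)).ne'
  rw [← slopeX_one, ← slopeY_one, slopeX, slopeY]
  norm_num
  field_simp
  linear_combination 216 * (√5 ^ 2 + 5) * h5 - 25 * (√6 ^ 4 + 6 * √6 ^ 2 + 36) * h6

/-- A competitor for the cone over `S¹ × S⁵`. -/
theorem exists_curves_one_five : ∃ (x₁ y₁ x₂ y₂ : ℝ → ℝ) (a₁ b₁ a₂ b₂ : ℝ),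
    SmoothCurve x₁ y₁ a₁ b₁ ∧ SmoothCurve x₂ y₂ a₂ b₂ ∧ x₁ a₁ = 0 ∧ x₁ b₁ = x₂ a₂ ∧
    y₁ b₁ = y₂ a₂ ∧ x₂ b₂ = radX 1 5 ∧ y₂ b₂ = radY 1 5 ∧
    (∫ t in Icc a₁ b₁, speed 1 5 x₁ y₁ t) + ∫ t in Icc a₂ b₂, speed 1 5 x₂ y₂ t <
      radX 1 5 ^ 1 * radY 1 5 ^ 5 / 7 := by
  -- The arcs meet at `R = 1/101`, `w² = 9/10`: `a` is fixed by `u = 1/10` at that radius, and `C`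
  -- by the radius of the first arc. At the ratio 101 one has `-u'/u = 4 + 1/100`, close enough to 4
  -- for the comparison of angles in `hj`.
  obtain ⟨L, hL⟩ : ∃ L : ℝ, L = log 101 := ⟨_, rfl⟩
  have hL0 : 0 < L := hL ▸ log_pos (by norm_num)
  have heL : exp L = 101 := hL ▸ exp_log (by norm_num)
  obtain ⟨C, hC⟩ : ∃ C : ℝ, C = -L + 19 / 80 * log (1 / 10) - 81 / 800 := ⟨_, rfl⟩
  obtain ⟨a, ha⟩ : ∃ a : ℝ, a = 1 / (1000 * 101 ^ 3) := ⟨_, rfl⟩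
  have ha0 : 0 < a := by rw [ha]; positivity
  have hb2 : √(9 / 10) ^ 2 = (9 / 10 : ℝ) := sq_sqrt (by norm_num)
  have hb0 : 0 < √(9 / 10 : ℝ) := sqrt_pos.2 (by norm_num)
  have hz : ∀ s ∈ Icc (-L) 0, 1 ≤ exp (-s) ∧ exp (-s) ≤ 101 := fun s hs =>
    ⟨one_le_exp (by linarith [hs.2]), by rw [← heL]; exact exp_le_exp.2 (by linarith [hs.1])⟩
  have hu : ∀ s ∈ Icc (-L) 0, a * (exp (-s) ^ 4 - exp (-s) ^ 3) ≤ 1 / 10 := fun s hs => by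
    obtain ⟨h1, h2⟩ := hz s hs
    calc a * (exp (-s) ^ 4 - exp (-s) ^ 3) = a * (exp (-s) ^ 3 * (exp (-s) - 1)) := by ring
      _ ≤ a * (101 ^ 3 * (101 - 1)) := by
        have : 0 ≤ exp (-s) - 1 := by linarith
        gcongr
      _ = 1 / 10 := by rw [ha]; norm_num
  have hd : ∀ s ∈ Icc (-L) 0, a * (4 * exp (-s) ^ 4 - 3 * exp (-s) ^ 3) ≤ 1 := fun s hs => by
    obtain ⟨h1, h2⟩ := hz s hs
    calc a * (4 * exp (-s) ^ 4 - 3 * exp (-s) ^ 3) = a * (exp (-s) ^ 3 * (4 * exp (-s) - 3)) := by ring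
      _ ≤ a * (101 ^ 3 * (4 * 101 - 3)) := by
        have : 0 ≤ 4 * exp (-s) - 3 := by linarith
        gcongr
      _ ≤ 1 := by rw [ha]; norm_num
  have ht : ∀ t ∈ Icc 0 √(9 / 10 : ℝ), t ^ 2 ≤ 9 / 10 := fun t ht => by
    rw [← hb2]
    exact pow_le_pow_left₀ ht.1 ht.2 2
  have hc₁ : SmoothCurve (fun t => exp (C - 19 / 80 * log (1 - t ^ 2) + 9 / 80 * t ^ 2) * slopeX t)
      (fun t => exp (C - 19 / 80 * log (1 - t ^ 2) + 9 / 80 * t ^ 2) * slopeY t) 0 √(9 / 10) := by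
    have h : ∀ t ∈ Icc 0 √(9 / 10 : ℝ), ContDiffAt ℝ ∞
        (fun t => exp (C - 19 / 80 * log (1 - t ^ 2) + 9 / 80 * t ^ 2)) t := fun t h => by
      have h1 : 1 - t ^ 2 ≠ 0 := by linarith [ht t h]
      have h2 : ContDiffAt ℝ ∞ (fun t : ℝ => log (1 - t ^ 2)) t :=
        ContDiffAt.log (by fun_prop) h1
      fun_prop
    exact ⟨hb0.le, fun t h' => (h t h').mul contDiff_slopeX.contDiffAt,
      fun t h' => (h t h').mul contDiff_slopeY.contDiffAt⟩
  have hc₂ : SmoothCurve (fun s => exp s * slopeX √(1 - a * (exp (-s) ^ 4 - exp (-s) ^ 3)))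
      (fun s => exp s * slopeY √(1 - a * (exp (-s) ^ 4 - exp (-s) ^ 3))) (-L) 0 := by
    have h : ∀ s ∈ Icc (-L) 0, ContDiffAt ℝ ∞
        (fun s => √(1 - a * (exp (-s) ^ 4 - exp (-s) ^ 3))) s := fun s h =>
      ContDiffAt.sqrt (by fun_prop) (ne_of_gt (by linarith [hu s h]))
    exact ⟨by linarith, fun s h' => contDiff_exp.contDiffAt.mul
        (contDiff_slopeX.contDiffAt.comp s (h s h')),
      fun s h' => contDiff_exp.contDiffAt.mul (contDiff_slopeY.contDiffAt.comp s (h s h'))⟩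
  have hb : C - 19 / 80 * log (1 - √(9 / 10) ^ 2) + 9 / 80 * √(9 / 10) ^ 2 = -L := by
    rw [hb2, hC]
    norm_num
    ring
  have hz4 : exp (- -L) = 101 := by rw [neg_neg, heL]
  have huL : 1 - a * ((101 : ℝ) ^ 4 - 101 ^ 3) = 9 / 10 := by rw [ha]; norm_num
  choose! E₁ hE₁ hle₁ using fun t (h : t ∈ Icc 0 √(9 / 10 : ℝ)) =>
    exists_potential_near_axis C t h.1 (ht t h)
  choose! E₂ hE₂ hle₂ using fun s (h : s ∈ Icc (-L) 0) =>
    exists_potential_near_cone ha0 h.2 (hu s h) (hd s h)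
  have l₁ := hc₁.integral_speed_le hE₁ hle₁
  have l₂ := hc₂.integral_speed_le hE₂ hle₂
  refine ⟨_, _, _, _, _, _, _, _, hc₁, hc₂, by simp [slopeX], ?_, ?_, ?_, ?_, ?_⟩
  · simp only [hb, hz4, huL]
  · simp only [hb, hz4, huL]
  · simp [slopeX_one]
  · simp [slopeY_one]
  · rw [hb, hb2] at l₁
    rw [hz4, huL, hb2] at l₂
    simp only [neg_zero, mul_zero, exp_zero, one_pow, sub_self, sub_zero, sqrt_one, mul_one, one_mul,
      show (4 : ℝ) - 3 = 1 by norm_num] at l₂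
    rw [radX_mul_radY_pow]
    -- At the corner the first arc makes at least as large an angle with the ray as the second, so
    -- the end value of its primitive is at most the initial value of the other one.
    have hj : √(9 / 10) * (7 / 10 - 9 / 40 * (9 / 10)) / (1 - 9 / 10) /
        √((√(9 / 10) * (7 / 10 - 9 / 40 * (9 / 10)) / (1 - 9 / 10)) ^ 2 + 5 / (5 + 9 / 10) ^ 2) ≤
        1 / √(1 + 5 * (a * (4 * 101 ^ 4 - 3 * 101 ^ 3)) ^ 2 /
          (4 * (9 / 10) * (6 - a * (101 ^ 4 - 101 ^ 3)) ^ 2)) := by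
      have e1 : (√(9 / 10) * (7 / 10 - 9 / 40 * (9 / 10)) / (1 - 9 / 10)) ^ 2 =
          (356409 / 16000 : ℝ) := by
        rw [div_pow, mul_pow, hb2]
        norm_num
      rw [div_le_div_iff₀ (sqrt_pos.2 (by rw [e1]; norm_num)) (sqrt_pos.2 (by positivity)), one_mul]
      refine le_sqrt_of_sq_le ?_
      rw [mul_pow, sq_sqrt (by positivity), e1, ha]
      norm_num
    -- Strictness comes from the far end: the second arc meets the ray at a nonzero angle, as `d = a
    -- > 0` there, so its primitive stays below the area of the cone.
    have hend : 1 / √(1 + 5 * a ^ 2 / (4 * 6 ^ 2)) < 1 := by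
      rw [div_lt_one (sqrt_pos.2 (by positivity)), lt_sqrt zero_le_one, one_pow]
      exact lt_add_of_pos_right _ (by positivity)
    have hk : 0 ≤ 25 * √5 / 7 * (exp (7 * -L) * (√(9 / 10) / (5 + 9 / 10) ^ 3)) := by positivity
    have hk' : (0 : ℝ) < 25 * √5 / 7 / 216 := by positivity
    have m1 := mul_le_mul_of_nonneg_left hj hk
    have m2 := mul_lt_mul_of_pos_left hend hk'
    generalize 1 / √(1 + 5 * a ^ 2 / (4 * 6 ^ 2)) = q at l₂ m2
    have e0 : (0 : ℝ) / (5 + 0 ^ 2) ^ 3 = 0 := zero_div _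
    rw [e0, mul_zero, zero_mul, mul_zero, sub_zero] at l₁
    rw [mul_assoc] at m1
    linarith

theorem speed_comm (m n : ℕ) (x y : ℝ → ℝ) : speed n m y x = speed m n x y := by
  ext t
  rw [speed, speed, add_comm, mul_comm (|y t| ^ n)]

theorem SmoothCurve.symm {x y : ℝ → ℝ} {a b : ℝ} (h : SmoothCurve x y a b) : SmoothCurve y x a b :=
  ⟨h.le, h.snd, h.fst⟩

theorem not_isMassMinimizing_one_five : ¬ IsMassMinimizing (truncatedCone 1 5) := by
  obtain ⟨x₁, y₁, x₂, y₂, a₁, b₁, a₂, b₂, h₁, h₂, hs, hx, hy, hxe, hye, hl⟩ := exists_curves_one_five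
  refine not_isMassMinimizing_of_curves le_rfl (by norm_num) h₁ h₂ (Or.inl hs) hx hy hxe hye ?_
  convert hl using 2
  norm_num

theorem not_isMassMinimizing_five_one : ¬ IsMassMinimizing (truncatedCone 5 1) := by
  obtain ⟨x₁, y₁, x₂, y₂, a₁, b₁, a₂, b₂, h₁, h₂, hs, hx, hy, hxe, hye, hl⟩ := exists_curves_one_five
  have e1 : radX 5 1 = radY 1 5 := by rw [radX, radY, add_comm]
  have e2 : radY 5 1 = radX 1 5 := by rw [radX, radY, add_comm]
  refine not_isMassMinimizing_of_curves (by norm_num) le_rfl h₁.symm h₂.symm (Or.inr hs) hy hx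
    (hye.trans e1.symm) (hxe.trans e2.symm) ?_
  simp only [speed_comm 1 5]
  rw [e1, e2, mul_comm (radY 1 5 ^ 5)]
  convert hl using 2
  norm_num

end LopsidedCone

/-! ### Admissible exponents and Lawson's inequality -/

section LawsonInequality

theorem quadratic_form_nonneg {a b c u v : ℝ} (ha : 0 ≤ a) (hb : 0 ≤ b) (hu : 0 ≤ u) (hv : 0 ≤ v)
    (h : 0 ≤ c ∨ c ^ 2 ≤ 4 * a * b) : 0 ≤ a * u ^ 2 + b * v ^ 2 + c * (u * v) := by
  rcases h with h | h
  · positivity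
  · have h1 : |c| ≤ 2 * (√a * √b) := by
      refine abs_le_of_sq_le_sq ?_ (by positivity)
      rw [mul_pow, mul_pow, sq_sqrt ha, sq_sqrt hb]
      linarith
    have h2 : -(2 * (√a * √b)) ≤ c := (abs_le.1 h1).1
    have h3 := mul_le_mul_of_nonneg_right h2 (mul_nonneg hu hv)
    have h4 := sq_nonneg (√a * u - √b * v)
    have e : (√a * u - √b * v) ^ 2 = √a ^ 2 * u ^ 2 + √b ^ 2 * v ^ 2 -
      2 * (√a * √b) * (u * v) := by ring
    rw [e, sq_sqrt ha, sq_sqrt hb] at h4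
    linarith

/-- The admissible exponents of Lawson's potential. -/
structure IsLawsonExponent (m n : ℕ) (β : ℝ) : Prop where
  half_lt : 1 / 2 < β
  fst_pos : 0 < m * β - (m + 1) / 2
  fst_lt : m * β - (m + 1) / 2 < m
  snd_pos : 0 < n * β - (n + 1) / 2
  snd_lt : n * β - (n + 1) / 2 < n
  le : ∀ u v : ℝ, 0 ≤ u → 0 ≤ v → u + v = 1 →
    4 * (β / (m + n + 1)) ^ 2 * (n * u + m * v) ≤
      (2 * β - 1) * (u * v + 4 * (β / (m + n + 1)) ^ 2 * (n * u - m * v) ^ 2)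

theorem IsLawsonExponent.symm {m n : ℕ} {β : ℝ} (h : IsLawsonExponent m n β) :
    IsLawsonExponent n m β where
  half_lt := h.half_lt
  fst_pos := h.snd_pos
  fst_lt := h.snd_lt
  snd_pos := h.fst_pos
  snd_lt := h.fst_lt
  le u v hu hv huv := by
    have := h.le v u hv hu (by linarith)
    rw [add_comm (n : ℝ) m]
    linarith [this, show (n * v - m * u : ℝ) ^ 2 = (m * u - n * v) ^ 2 by ring, mul_comm u v,
      congrArg (fun z => (2 * β - 1) * (u * v + 4 * (β / (m + n + 1)) ^ 2 * z))
        (show (n * v - m * u : ℝ) ^ 2 = (m * u - n * v) ^ 2 by ring)]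

/-- Homogenizing with `u + v = 1` turns the condition into nonnegativity of a quadratic form on the
quadrant: either the mixed coefficient is nonnegative or the discriminant is nonpositive. -/
theorem isLawsonExponent_one {m n : ℕ} (hm : 2 ≤ m) (hn : 2 ≤ n) (hN : 6 ≤ m + n) :
    IsLawsonExponent m n 1 := by
  have hm' : (2 : ℝ) ≤ m := by exact_mod_cast hm
  have hn' : (2 : ℝ) ≤ n := by exact_mod_cast hn
  have hN' : (6 : ℝ) ≤ m + n := by exact_mod_cast hN
  refine ⟨by norm_num, by linarith, by linarith, by linarith, by linarith, fun u v hu hv huv => ?_⟩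
  have key : 0 ≤ 4 * (n ^ 2 - n) * u ^ 2 + 4 * (m ^ 2 - m) * v ^ 2 +
      ((m + n - 1) ^ 2 - 8 * m * n) * (u * v) := by
    refine quadratic_form_nonneg (by nlinarith) (by nlinarith) hu hv ?_
    by_cases h : 8 * (m * n : ℝ) ≤ (m + n - 1) ^ 2
    · left
      linarith
    · right
      push Not at h
      -- This is the discriminant condition divided by `m + n - 1`. In the present case `8mn > (m +
      -- n - 1)²`, which implies it once `m + n ≥ 9`; the finitely many smaller pairs are checked
      -- directly.
      have h3 : ((m : ℝ) + n - 1) ^ 3 ≤ 16 * (m * n) * (m + n - 5) := by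
        by_cases h9 : 9 ≤ m + n
        · have h9' : (9 : ℝ) ≤ m + n := by exact_mod_cast h9
          nlinarith [sq_nonneg ((m : ℝ) + n - 1)]
        · have hm6 : m ≤ 6 := by omega
          have hn6 : n ≤ 6 := by omega
          interval_cases m <;> interval_cases n <;> first | omega | norm_num
      nlinarith
  rw [← sub_nonneg]
  have e : (2 * 1 - 1) * (u * v + 4 * (1 / (m + n + 1)) ^ 2 * (n * u - m * v) ^ 2) -
      4 * (1 / (m + n + 1)) ^ 2 * (n * u + m * v) = (1 / (m + n + 1)) ^ 2 *
      (4 * (n ^ 2 - n) * u ^ 2 + 4 * (m ^ 2 - m) * v ^ 2 +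
        ((m + n - 1) ^ 2 - 8 * m * n) * (u * v)) := by
    have hu' : u = 1 - v := by linarith
    have : (m : ℝ) + n + 1 ≠ 0 := by positivity
    rw [hu']
    field_simp
    ring
  rw [e]
  positivity

/-- For `m = 1` the value `β = 1` would give the exponent `mβ - (m+1)/2 = 0`, and the field would
not decay at the axis `X = 0`; a larger `β` is required. -/
theorem isLawsonExponent_five_fourths {n : ℕ} (hn : 6 ≤ n) : IsLawsonExponent 1 n (5 / 4) := by
  have hn' : (6 : ℝ) ≤ n := by exact_mod_cast hn
  refine ⟨by norm_num, by norm_num, by norm_num, by linarith, by linarith,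
    fun u v hu hv huv => ?_⟩
  have key : 0 ≤ (3 / 2 * n ^ 2 - n) * u ^ 2 + 1 / 2 * v ^ 2 +
      (6 / 25 * (n + 2) ^ 2 - 4 * n - 1) * (u * v) := by
    refine quadratic_form_nonneg (by nlinarith) (by norm_num) hu hv ?_
    by_cases h : 13 ≤ n
    · left
      have h' : (13 : ℝ) ≤ n := by exact_mod_cast h
      nlinarith
    · right
      have : n ≤ 12 := by omega
      interval_cases n <;> norm_num
  rw [← sub_nonneg]
  have e : (2 * (5 / 4) - 1) * (u * v + 4 * (5 / 4 / ((1 : ℕ) + n + 1)) ^ 2 *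
      (n * u - (1 : ℕ) * v) ^ 2) - 4 * (5 / 4 / ((1 : ℕ) + n + 1)) ^ 2 * (n * u + (1 : ℕ) * v) =
      25 / 4 * (1 / (n + 2)) ^ 2 * ((3 / 2 * n ^ 2 - n) * u ^ 2 + 1 / 2 * v ^ 2 +
      (6 / 25 * (n + 2) ^ 2 - 4 * n - 1) * (u * v)) := by
    have hu' : u = 1 - v := by linarith
    have h1 : (n : ℝ) + 2 ≠ 0 := by positivity
    rw [hu', Nat.cast_one, show (1 : ℝ) + n + 1 = n + 2 by ring]
    field_simp
    ring
  rw [e]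
  positivity

theorem exists_isLawsonExponent {m n : ℕ} (hm : 1 ≤ m) (hn : 1 ≤ n) (hN : 6 ≤ m + n)
    (h15 : ¬ (m = 1 ∧ n = 5)) (h51 : ¬ (m = 5 ∧ n = 1)) : ∃ β, IsLawsonExponent m n β := by
  by_cases hm1 : m = 1
  · subst hm1
    exact ⟨5 / 4, isLawsonExponent_five_fourths (by omega)⟩
  by_cases hn1 : n = 1
  · subst hn1
    exact ⟨5 / 4, (isLawsonExponent_five_fourths (by omega)).symm⟩
  exact ⟨1, isLawsonExponent_one (by omega) (by omega) hN⟩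

/-- A function on `(0, 1)` whose derivative has the sign of `a - v` is largest at `a`. -/
theorem le_of_deriv_sign {f f' : ℝ → ℝ} {a v : ℝ} (ha : a ∈ Ioo (0 : ℝ) 1) (hv : v ∈ Ioo (0 : ℝ) 1)
    (hf : ∀ v ∈ Ioo (0 : ℝ) 1, HasDerivAt f (f' v) v)
    (hle : ∀ v ∈ Ioo (0 : ℝ) 1, v ≤ a → 0 ≤ f' v) (hge : ∀ v ∈ Ioo (0 : ℝ) 1, a ≤ v → f' v ≤ 0) :
    f v ≤ f a := by
  rcases le_total v a with h | h
  · have hs : Icc v a ⊆ Ioo 0 1 := fun t ht => ⟨hv.1.trans_le ht.1, ht.2.trans_lt ha.2⟩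
    refine monotoneOn_of_deriv_nonneg (convex_Icc v a)
      (fun t ht => (hf t (hs ht)).continuousAt.continuousWithinAt)
      (fun t ht => (hf t (hs (interior_subset ht))).differentiableAt.differentiableWithinAt)
      (fun t ht => ?_) (left_mem_Icc.2 h) (right_mem_Icc.2 h) h
    have ht' := interior_subset ht
    rw [(hf t (hs ht')).deriv]
    exact hle t (hs ht') ht'.2
  · have hs : Icc a v ⊆ Ioo 0 1 := fun t ht => ⟨ha.1.trans_le ht.1, ht.2.trans_lt hv.2⟩
    refine antitoneOn_of_deriv_nonpos (convex_Icc a v)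
      (fun t ht => (hf t (hs ht)).continuousAt.continuousWithinAt)
      (fun t ht => (hf t (hs (interior_subset ht))).differentiableAt.differentiableWithinAt)
      (fun t ht => ?_) (left_mem_Icc.2 h) (right_mem_Icc.2 h) h
    have ht' := interior_subset ht
    rw [(hf t (hs ht')).deriv]
    exact hge t (hs ht') ht'.1

/-- Up to a constant, the left side is the logarithm of the squared norm of the undeformed field, as
a function of `v = sin² θ`. Its derivative is `nu - mv` times a factor that the admissibility
condition makes nonnegative, so the maximum is on the cone. -/
theorem IsLawsonExponent.log_le {m n : ℕ} {β : ℝ} (h : IsLawsonExponent m n β) (hm : 1 ≤ m)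
    (hn : 1 ≤ n) {v : ℝ} (hv : v ∈ Ioo (0 : ℝ) 1) :
    ((2 * β - 1) * m - 1) * log (1 - v) + ((2 * β - 1) * n - 1) * log v +
      log ((1 - v) * v + 4 * (β / (m + n + 1)) ^ 2 * (n * (1 - v) - m * v) ^ 2) ≤
    (2 * β - 1) * (m * log (m / (m + n)) + n * log (n / (m + n))) := by
  have hm0 : (0 : ℝ) < m := by positivity
  have hn0 : (0 : ℝ) < n := by positivity
  have hN0 : (0 : ℝ) < m + n := by positivity
  have ha : (n : ℝ) / (m + n) ∈ Ioo (0 : ℝ) 1 :=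
    ⟨by positivity, (div_lt_one hN0).2 (by linarith)⟩
  set k : ℝ := (β / (m + n + 1)) ^ 2 with hk
  have hk0 : 0 ≤ k := sq_nonneg _
  have hpos : ∀ v ∈ Ioo (0 : ℝ) 1, 0 < (1 - v) * v + 4 * k * (n * (1 - v) - m * v) ^ 2 := by
    intro v hv
    have := mul_pos (sub_pos.2 hv.2) hv.1
    positivity
  have key := le_of_deriv_sign (f := fun v => ((2 * β - 1) * m - 1) * log (1 - v) +
    ((2 * β - 1) * n - 1) * log v + log ((1 - v) * v + 4 * k * (n * (1 - v) - m * v) ^ 2))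
    (f' := fun v => (n * (1 - v) - m * v) * (((2 * β - 1) * ((1 - v) * v + 4 * k *
      (n * (1 - v) - m * v) ^ 2) - 4 * k * (n * (1 - v) + m * v)) / ((1 - v) * v *
        ((1 - v) * v + 4 * k * (n * (1 - v) - m * v) ^ 2)))) ha hv ?_ ?_ ?_
  · refine key.trans_eq ?_
    have e1 : 1 - (n : ℝ) / (m + n) = m / (m + n) := by field_simp; ring
    have e2 : (n : ℝ) * (m / (m + n)) - m * (n / (m + n)) = 0 := by ring
    simp only [e1, e2]
    rw [zero_pow two_ne_zero, mul_zero, add_zero, log_mul (by positivity) (by positivity)]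
    ring
  · intro v hv
    have h1 : HasDerivAt (fun v : ℝ => 1 - v) (-1) v := by
      simpa using (hasDerivAt_id v).const_sub 1
    have h2 : HasDerivAt (fun v : ℝ => (1 - v) * v + 4 * k * (n * (1 - v) - m * v) ^ 2)
        (1 - 2 * v - 8 * k * (n * (1 - v) - m * v) * (m + n)) v := by
      refine ((h1.mul (hasDerivAt_id v)).add ((((h1.const_mul (n : ℝ)).sub
        ((hasDerivAt_id v).const_mul (m : ℝ))).pow 2).const_mul (4 * k))).congr_deriv ?_
      simp only [id, Pi.sub_apply]
      push_cast
      ring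
    have hp := hpos v hv
    have h0 : 0 < 1 - v := sub_pos.2 hv.2
    have hv0 := hv.1
    refine (((h1.log h0.ne').const_mul _).add ((hasDerivAt_log hv.1.ne').const_mul _)).add
      (h2.log hp.ne') |>.congr_deriv ?_
    field_simp
    ring
  · intro v hv hva
    have hp := hpos v hv
    have h0 : 0 < 1 - v := sub_pos.2 hv.2
    have hv0 := hv.1
    have hq : 0 ≤ n * (1 - v) - m * v := by
      rw [le_div_iff₀ hN0] at hva
      linarith
    refine mul_nonneg hq (div_nonneg (sub_nonneg.2 ?_) (by positivity))
    exact h.le (1 - v) v h0.le hv0.le (by ring)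
  · intro v hv hva
    have hp := hpos v hv
    have h0 : 0 < 1 - v := sub_pos.2 hv.2
    have hv0 := hv.1
    have hq : n * (1 - v) - m * v ≤ 0 := by
      rw [div_le_iff₀ hN0] at hva
      linarith
    refine mul_nonpos_of_nonpos_of_nonneg hq (div_nonneg (sub_nonneg.2 ?_) (by positivity))
    exact h.le (1 - v) v h0.le hv0.le (by ring)

end LawsonInequality

/-! ### Deforming the exponents near the axes -/

section Profile

/-- The power `v ^ (c + κ θ / 2)` of `v = sin² θ`. -/
def profile (c : ℝ) (κ : ℝ → ℝ) (v : ℝ) : ℝ := v ^ (c + κ (arcsin √v) / 2)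

/-- The standard cutoff with value `A` near zero. -/
def cutoff (A δ : ℝ) (θ : ℝ) : ℝ := A * smoothTransition (2 - 2 * θ / δ)

theorem contDiff_cutoff (A δ : ℝ) : ContDiff ℝ ∞ (cutoff A δ) := by
  refine contDiff_const.mul (smoothTransition.contDiff.comp ?_)
  exact contDiff_const.sub ((contDiff_const.mul contDiff_id).div_const δ)

theorem cutoff_eq {A δ θ : ℝ} (hδ : 0 < δ) (h : θ ≤ δ / 2) : cutoff A δ θ = A := by
  rw [cutoff, smoothTransition.one_of_one_le, mul_one]
  rw [le_sub_comm, div_le_iff₀ hδ]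
  linarith

theorem cutoff_eq_zero {A δ θ : ℝ} (hδ : 0 < δ) (h : δ ≤ θ) : cutoff A δ θ = 0 := by
  rw [cutoff, smoothTransition.zero_of_nonpos, mul_zero]
  rw [sub_nonpos, le_div_iff₀ hδ]
  linarith

theorem cutoff_nonneg {A : ℝ} (hA : 0 ≤ A) (δ θ : ℝ) : 0 ≤ cutoff A δ θ :=
  mul_nonneg hA (smoothTransition.nonneg _)

theorem cutoff_le {A : ℝ} (hA : 0 ≤ A) (δ θ : ℝ) : cutoff A δ θ ≤ A :=
  mul_le_of_le_one_right hA (smoothTransition.le_one _)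

theorem isCutoff_cutoff {A δ : ℝ} (hA : 0 ≤ A) (hδ : 0 < δ) : IsCutoff (cutoff A δ) δ where
  smooth := contDiff_cutoff A δ
  antitone θ θ' h := by
    refine mul_le_mul_of_nonneg_left (smoothTransition.monotone ?_) hA
    gcongr
  const θ h := by rw [cutoff_eq hδ h, cutoff_eq hδ (by positivity)]
  zero θ h := cutoff_eq_zero hδ h

theorem deriv_cutoff_eq_zero {A δ θ : ℝ} (hA : 0 ≤ A) (hδ : 0 < δ) (h : δ ≤ θ) :
    deriv (cutoff A δ) θ = 0 := by
  refine IsLocalMin.deriv_eq_zero (Eventually.of_forall fun t => ?_)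
  simp only [cutoff_eq_zero hδ h]
  exact cutoff_nonneg hA δ t

/-- The cutoffs are rescalings of one function, so `δ |κ'|` is bounded independently of `δ`. -/
theorem exists_abs_deriv_cutoff_le (A : ℝ) :
    ∃ M, 0 ≤ M ∧ ∀ δ > 0, ∀ θ ∈ Icc 0 δ, δ * |deriv (cutoff A δ) θ| ≤ M := by
  have hc : Continuous (deriv smoothTransition) :=
    (smoothTransition.contDiff (n := 1)).continuous_deriv le_rfl
  obtain ⟨M, hM⟩ := (isCompact_Icc (a := (0 : ℝ)) (b := 2)).exists_bound_of_continuousOn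
    hc.continuousOn
  have hM0 : 0 ≤ M := (norm_nonneg _).trans (hM 0 ⟨le_rfl, zero_le_two⟩)
  refine ⟨|A| * (M * 2), by positivity, fun δ hδ θ hθ => ?_⟩
  have h1 : HasDerivAt (fun θ => 2 - 2 * θ / δ) (-(2 / δ)) θ := by
    simpa using (((hasDerivAt_id θ).const_mul 2).div_const δ).const_sub 2
  have h2 : HasDerivAt smoothTransition (deriv smoothTransition (2 - 2 * θ / δ)) (2 - 2 * θ / δ) :=
    ((smoothTransition.contDiff (n := 1)).differentiable one_ne_zero _).hasDerivAt
  have h3 : HasDerivAt (fun θ => smoothTransition (2 - 2 * θ / δ))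
      (deriv smoothTransition (2 - 2 * θ / δ) * -(2 / δ)) θ :=
    HasDerivAt.comp (h₂ := smoothTransition) (h := fun θ => 2 - 2 * θ / δ) θ h2 h1
  have h3 : HasDerivAt (cutoff A δ) (A * (deriv smoothTransition (2 - 2 * θ / δ) * -(2 / δ))) θ :=
    h3.const_mul A
  have h4 : |deriv smoothTransition (2 - 2 * θ / δ)| ≤ M := by
    refine hM _ ⟨?_, ?_⟩
    · rw [sub_nonneg, div_le_iff₀ hδ]
      linarith [hθ.2]
    · have := hθ.1
      exact sub_le_self _ (by positivity)
  rw [h3.deriv, abs_mul, abs_mul, abs_neg, abs_of_pos (div_pos two_pos hδ)]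
  calc δ * (|A| * (|deriv smoothTransition (2 - 2 * θ / δ)| * (2 / δ)))
      = |A| * (|deriv smoothTransition (2 - 2 * θ / δ)| * 2) := by field_simp
    _ ≤ _ := by gcongr

/-- Near zero the profile is the integer power `vⁿ`, also for negative `v`, where `√v = 0`. Beyond
the cutoff it is `v^c` with `v > 0`, and in between `√v < 1`, where the arcsine is smooth. -/
theorem contDiff_profile {n : ℕ} {c A δ : ℝ} (hδ : 0 < δ) (hδ' : δ < π / 2) (hA : c + A / 2 = n) :
    ContDiff ℝ ∞ (profile c (cutoff A δ)) := by
  have hθ : Continuous fun v => arcsin √v := continuous_arcsin.comp continuous_sqrt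
  rw [contDiff_iff_contDiffAt]
  intro v
  rcases lt_or_ge (arcsin √v) (δ / 2) with h | h
  · have : profile c (cutoff A δ) =ᶠ[𝓝 v] fun w => w ^ n := by
      filter_upwards [hθ.continuousAt.eventually_lt continuousAt_const h] with w hw
      rw [profile, cutoff_eq hδ hw.le, hA, rpow_natCast]
    exact (contDiff_id.pow n).contDiffAt.congr_of_eventuallyEq this
  have hpos : ∀ w, 0 < arcsin √w → 0 < w := fun w hw => by
    by_contra hw0
    rw [sqrt_eq_zero_of_nonpos (not_lt.1 hw0), arcsin_zero] at hw
    exact lt_irrefl _ hw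
  have hv0 : 0 < v := hpos v (by linarith)
  rcases lt_or_ge δ (arcsin √v) with h' | h'
  · have : profile c (cutoff A δ) =ᶠ[𝓝 v] fun w => w ^ c := by
      filter_upwards [continuousAt_const.eventually_lt hθ.continuousAt h'] with w hw
      rw [profile, cutoff_eq_zero hδ hw.le, zero_div, add_zero]
    exact (contDiffAt_id.rpow_const_of_ne hv0.ne').congr_of_eventuallyEq this
  · have hv1 : √v < 1 := by
      by_contra hv1
      rw [arcsin_of_one_le (not_lt.1 hv1)] at h'
      linarith
    have h1 : ContDiffAt ℝ ∞ (fun w => arcsin √w) v :=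
      (contDiffAt_arcsin (by linarith [sqrt_nonneg v]) hv1.ne).comp v (contDiffAt_id.sqrt hv0.ne')
    have h2 : ContDiffAt ℝ ∞ (fun w => cutoff A δ (arcsin √w)) v :=
      (contDiff_cutoff A δ).contDiffAt.comp v h1
    exact contDiffAt_id.rpow (contDiffAt_const.add (h2.div_const 2)) hv0.ne'

theorem profile_eq_rpow {c A δ v : ℝ} (hδ : 0 < δ) (h : δ ≤ arcsin √v) :
    profile c (cutoff A δ) v = v ^ c := by
  rw [profile, cutoff_eq_zero hδ h, zero_div, add_zero]

theorem profile_zero {n : ℕ} {c A δ : ℝ} (hn : 1 ≤ n) (hδ : 0 < δ) (hA : c + A / 2 = n) :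
    profile c (cutoff A δ) 0 = 0 := by
  rw [profile, sqrt_zero, arcsin_zero, cutoff_eq hδ (by positivity), hA, rpow_natCast,
    zero_pow (by omega)]

/-- The correction to the logarithmic derivative of the profile. -/
def profileCorrection (A δ v : ℝ) : ℝ :=
  (1 - v) * cutoff A δ (arcsin √v) +
    1 / 2 * (√v * √(1 - v)) * deriv (cutoff A δ) (arcsin √v) * log v

theorem hasDerivAt_arcsin_sqrt {v : ℝ} (hv : v ∈ Ioo (0 : ℝ) 1) :
    HasDerivAt (fun v => arcsin √v) (1 / (2 * (√v * √(1 - v)))) v := by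
  have h1 : √v < 1 := by rw [sqrt_lt' one_pos]; simpa using hv.2
  have h2 : -1 < √v := by linarith [sqrt_nonneg v]
  refine ((hasDerivAt_arcsin h2.ne' h1.ne).comp v (hasDerivAt_sqrt hv.1.ne')).congr_deriv ?_
  rw [sq_sqrt hv.1.le]
  have := sqrt_pos.2 hv.1
  have := sqrt_pos.2 (sub_pos.2 hv.2)
  field_simp

theorem deriv_profile {c A δ v : ℝ} (hv : v ∈ Ioo (0 : ℝ) 1) :
    2 * (1 - v) * v * deriv (profile c (cutoff A δ)) v =
      profile c (cutoff A δ) v * (2 * c * (1 - v) + profileCorrection A δ v) := by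
  have hκ : HasDerivAt (cutoff A δ) (deriv (cutoff A δ) (arcsin √v)) (arcsin √v) :=
    ((contDiff_cutoff A δ).differentiable (by simp) _).hasDerivAt
  have h := (hasDerivAt_id v).rpow (((hκ.comp v (hasDerivAt_arcsin_sqrt hv)).div_const 2).const_add c)
    hv.1
  have h1 := sqrt_pos.2 hv.1
  have h2 := sqrt_pos.2 (sub_pos.2 hv.2)
  have e1 : √v ^ 2 = v := sq_sqrt hv.1.le
  have e2 : √(1 - v) ^ 2 = 1 - v := sq_sqrt (sub_pos.2 hv.2).le
  have hd : deriv (profile c (cutoff A δ)) v = _ := h.deriv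
  have hv0 := hv.1
  rw [hd]
  simp only [id, Function.comp_apply, rpow_sub_one hv.1.ne', profile, profileCorrection]
  generalize v ^ (c + cutoff A δ (arcsin √v) / 2) = P
  generalize deriv (cutoff A δ) (arcsin √v) = K
  generalize √(1 - v) = b at h2 e2 ⊢
  generalize cutoff A δ (arcsin √v) = k
  generalize √v = a at h1 e1 ⊢
  field_simp
  rw [← e2]
  linear_combination (-P * K * log v * b ^ 2) * e1

/-- The correction is at most `A + M |log v|` with `M` independent of `δ`, and `v^c (1 + |log v|)`
tends to zero because `c > 0`. Deforming the exponent therefore does little harm close to the axis.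
-/
theorem exists_forall_profile_mul_le {c : ℝ} (hc : 0 < c) {A D B : ℝ} (hA : 0 ≤ A) (hD : 0 ≤ D)
    (hB : 0 < B) : ∃ δ₁ > 0, ∀ δ, 0 < δ → δ < δ₁ → ∀ v ∈ Ioo (0 : ℝ) 1, arcsin √v < δ →
      profile c (cutoff A δ) v * (D + |profileCorrection A δ v|) ≤ B := by
  obtain ⟨M, hM0, hM⟩ := exists_abs_deriv_cutoff_le A
  have hlim : Tendsto (fun v : ℝ => (D + A) * v ^ c + M * |log v * v ^ c|) (𝓝[>] 0) (𝓝 0) := by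
    have h1 : Tendsto (fun v : ℝ => v ^ c) (𝓝[>] 0) (𝓝 0) := by
      have := (continuousAt_rpow_const 0 c (Or.inr hc.le)).tendsto
      rw [zero_rpow hc.ne'] at this
      exact this.mono_left nhdsWithin_le_nhds
    have h2 := (h1.const_mul (D + A)).add
      ((tendsto_log_mul_rpow_nhdsGT_zero hc).abs.const_mul M)
    simpa using h2
  obtain ⟨ε, hε, hball⟩ := mem_nhdsGT_iff_exists_Ioo_subset.1 (hlim.eventually_le_const hB)
  rw [mem_Ioi] at hε
  refine ⟨√ε, sqrt_pos.2 hε, fun δ hδ hδ₁ v hv hvδ => ?_⟩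
  have hθ0 : 0 ≤ arcsin √v := arcsin_nonneg.2 (sqrt_nonneg _)
  have hs1 : √v ≤ 1 := sqrt_le_one.2 hv.2.le
  have hsin : √v ≤ arcsin √v := by
    conv_lhs => rw [← sin_arcsin (by linarith [sqrt_nonneg v]) hs1]
    exact sin_le hθ0
  have hvε : v < ε := (sqrt_lt_sqrt_iff hv.1.le).1 (by linarith)
  have hb := hball ⟨hv.1, hvε⟩
  rw [mem_ofPred_eq] at hb
  have hκ0 := cutoff_nonneg hA δ (arcsin √v)
  have hP : profile c (cutoff A δ) v ≤ v ^ c :=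
    rpow_le_rpow_of_exponent_ge hv.1 hv.2.le (by linarith)
  have hP0 : 0 ≤ v ^ c := rpow_nonneg hv.1.le c
  have hcorr : |profileCorrection A δ v| ≤ A + M * |log v| := by
    refine (abs_add_le _ _).trans (add_le_add ?_ ?_)
    · have h1 : 0 ≤ 1 - v := sub_nonneg.2 hv.2.le
      rw [abs_of_nonneg (mul_nonneg h1 hκ0)]
      exact (mul_le_of_le_one_left hκ0 (by linarith [hv.1])).trans (cutoff_le hA _ _)
    · rw [abs_mul, abs_mul]
      refine mul_le_mul_of_nonneg_right ?_ (abs_nonneg _)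
      refine le_trans ?_ (hM δ hδ (arcsin √v) ⟨hθ0, hvδ.le⟩)
      refine mul_le_mul_of_nonneg_right ?_ (abs_nonneg _)
      have h2 : √(1 - v) ≤ 1 := sqrt_le_one.2 (by linarith [hv.1])
      -- The factor `√v` of order `δ` compensates the derivative of the cutoff, which is of order
      -- `1/δ`.
      have h3 : √v * √(1 - v) ≤ δ := by
        calc √v * √(1 - v) ≤ √v * 1 := by gcongr
          _ ≤ δ := by linarith
      rw [abs_of_nonneg (by positivity)]
      linarith [mul_nonneg (sqrt_nonneg v) (sqrt_nonneg (1 - v))]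
  calc profile c (cutoff A δ) v * (D + |profileCorrection A δ v|)
      ≤ v ^ c * (D + (A + M * |log v|)) := by gcongr
    _ = (D + A) * v ^ c + M * |log v * v ^ c| := by
      rw [abs_mul, abs_of_nonneg hP0]
      ring
    _ ≤ B := hb

theorem profileCorrection_eq_zero {A δ v : ℝ} (hA : 0 ≤ A) (hδ : 0 < δ) (h : δ ≤ arcsin √v) :
    profileCorrection A δ v = 0 := by
  rw [profileCorrection, cutoff_eq_zero hδ h, deriv_cutoff_eq_zero hA hδ h]
  simp

end Profile

/-! ### Divergence-free fields from a potential -/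

section PotentialField

variable {m n : ℕ}

/-- The orthogonal projection to the first factor. -/
def partX (m n : ℕ) : Amb m n →L[ℝ] Amb m n :=
  LinearMap.toContinuousLinearMap ((inclX m n).comp (projX m n))

/-- The orthogonal projection to the second factor. -/
def partY (m n : ℕ) : Amb m n →L[ℝ] Amb m n :=
  LinearMap.toContinuousLinearMap ((inclY m n).comp (projY m n))

theorem partX_apply (z : Amb m n) : partX m n z = inclX m n (projX m n z) := rfl

theorem partY_apply (z : Amb m n) : partY m n z = inclY m n (projY m n z) := rfl

theorem sum_inner_ambBasis (T : Amb m n → Amb m n) :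
    ∑ i, inner ℝ (ambBasis m n i) (T (ambBasis m n i)) =
      ∑ j, T (EuclideanSpace.single j 1) j := by
  rw [← (coordEquiv m n).sum_comp]
  refine Finset.sum_congr rfl fun i _ => ?_
  have : ambBasis m n i = EuclideanSpace.single (coordEquiv m n i) 1 := by
    simp [ambBasis]
  rw [this, EuclideanSpace.inner_single_left]
  simp

theorem trace_partX : ∑ i, inner ℝ (ambBasis m n i) (partX m n (ambBasis m n i)) = m + 1 := by
  rw [sum_inner_ambBasis fun z => partX m n z, Fintype.sum_sum_type]
  simp [partX_apply, projX_apply]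

theorem trace_partY : ∑ i, inner ℝ (ambBasis m n i) (partY m n (ambBasis m n i)) = n + 1 := by
  rw [sum_inner_ambBasis fun z => partY m n z, Fintype.sum_sum_type]
  simp [partY_apply, projY_apply]

theorem sum_inner_smul_ambBasis (l : Amb m n →L[ℝ] ℝ) (w : Amb m n) :
    ∑ i, inner ℝ (ambBasis m n i) (l (ambBasis m n i) • w) = l w := by
  conv_rhs => rw [← (ambBasis m n).sum_repr' w, map_sum]
  refine Finset.sum_congr rfl fun i _ => ?_
  rw [inner_smul_right, map_smul, smul_eq_mul, mul_comm]

/-- The coefficient of the first component of the divergence-free field with potential `g`. -/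
def coeffX (m n : ℕ) (g : Amb m n → ℝ) (z : Amb m n) : ℝ :=
  (n + 1) * g z + fderiv ℝ g z (partY m n z)

/-- The coefficient of the second component of the divergence-free field with potential `g`. -/
def coeffY (m n : ℕ) (g : Amb m n → ℝ) (z : Amb m n) : ℝ :=
  -((m + 1) * g z + fderiv ℝ g z (partX m n z))

/-- The divergence-free vector field with potential `g`. -/
def potField (m n : ℕ) (g : Amb m n → ℝ) (z : Amb m n) : Amb m n :=
  coeffX m n g z • partX m n z + coeffY m n g z • partY m n z

theorem contDiffAt_potField {g : Amb m n → ℝ} {z : Amb m n} (hg : ContDiffAt ℝ ∞ g z) :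
    ContDiffAt ℝ ∞ (potField m n g) z := by
  have hX : ContDiffAt ℝ ∞ (fun z => partX m n z) z := (partX m n).contDiff.contDiffAt
  have hY : ContDiffAt ℝ ∞ (fun z => partY m n z) z := (partY m n).contDiff.contDiffAt
  have hd : ContDiffAt ℝ ∞ (fderiv ℝ g) z := hg.fderiv_right (by norm_cast)
  exact (((contDiffAt_const.mul hg).add (hd.clm_apply hY)).smul hX).add
    (((contDiffAt_const.mul hg).add (hd.clm_apply hX)).neg.smul hY)

/-- The divergence is `(m+1)a + X·∇a + (n+1)b + Y·∇b` for the two coefficients `a, b`. Terms with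
`g` and its first derivatives cancel in pairs, and the second derivatives cancel by symmetry. -/
theorem div_potField {g : Amb m n → ℝ} {z : Amb m n} (hg : ContDiffAt ℝ ∞ g z) :
    ∃ W' : Amb m n →L[ℝ] Amb m n, HasFDerivAt (potField m n g) W' z ∧
      ∑ i, inner ℝ (ambBasis m n i) (W' (ambBasis m n i)) = 0 := by
  have hg1 : HasFDerivAt g (fderiv ℝ g z) z := (hg.differentiableAt (by simp)).hasFDerivAt
  have hg2 : HasFDerivAt (fderiv ℝ g) (fderiv ℝ (fderiv ℝ g) z) z :=
    ((hg.fderiv_right (m := 1) (by norm_cast)).differentiableAt one_ne_zero).hasFDerivAt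
  have hsymm := (hg.isSymmSndFDerivAt two_le_smooth).eq (partX m n z) (partY m n z)
  have hXX : ∀ w, partX m n (partY m n w) = 0 := fun w => by simp [partX_apply, partY_apply]
  have hYX : ∀ w, partY m n (partX m n w) = 0 := fun w => by simp [partX_apply, partY_apply]
  have ha : HasFDerivAt (coeffX m n g) _ z :=
    (hg1.const_mul ((n : ℝ) + 1)).add (hg2.clm_apply (partY m n).hasFDerivAt)
  have hb : HasFDerivAt (coeffY m n g) _ z :=
    ((hg1.const_mul ((m : ℝ) + 1)).add (hg2.clm_apply (partX m n).hasFDerivAt)).neg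
  refine ⟨_, (ha.smul (partX m n).hasFDerivAt).add (hb.smul (partY m n).hasFDerivAt), ?_⟩
  -- The derivative of a product of a function and a projection is a multiple of the projection plus
  -- a rank-one map, so both traces are explicit.
  have key : ∀ (c : ℝ) (P : Amb m n →L[ℝ] Amb m n) (l : Amb m n →L[ℝ] ℝ) (w : Amb m n),
      ∑ i, inner ℝ (ambBasis m n i) ((c • P + l.smulRight w) (ambBasis m n i)) =
        c * ∑ i, inner ℝ (ambBasis m n i) (P (ambBasis m n i)) + l w := fun c P l w => by
    rw [← sum_inner_smul_ambBasis l w, Finset.mul_sum, ← Finset.sum_add_distrib]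
    refine Finset.sum_congr rfl fun i _ => ?_
    rw [add_apply, smul_apply, inner_add_right, inner_smul_right]
    rfl
  have split : ∀ P Q : Amb m n →L[ℝ] Amb m n, ∑ i, inner ℝ (ambBasis m n i)
      ((P + Q) (ambBasis m n i)) = ∑ i, inner ℝ (ambBasis m n i) (P (ambBasis m n i)) +
        ∑ i, inner ℝ (ambBasis m n i) (Q (ambBasis m n i)) := fun P Q => by
    simp only [add_apply, inner_add_right, Finset.sum_add_distrib]
  rw [split]
  rw [key, key, trace_partX, trace_partY]
  simp only [neg_apply, add_apply,
    smul_apply, ContinuousLinearMap.comp_apply,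
    ContinuousLinearMap.flip_apply, smul_eq_mul, hXX, hYX, map_zero]
  rw [hsymm, coeffX, coeffY]
  ring

/-- The homogeneous potential `C ‖z‖⁻¹ E₁(sin² θ) E₂(cos² θ)`. -/
def conePotential (m n : ℕ) (C : ℝ) (E₁ E₂ : ℝ → ℝ) (z : Amb m n) : ℝ :=
  C * ‖z‖⁻¹ * (E₁ (‖projY m n z‖ ^ 2 / ‖z‖ ^ 2) * E₂ (‖projX m n z‖ ^ 2 / ‖z‖ ^ 2))

theorem contDiffAt_conePotential {E₁ E₂ : ℝ → ℝ} (h₁ : ContDiff ℝ ∞ E₁) (h₂ : ContDiff ℝ ∞ E₂)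
    (C : ℝ) {z : Amb m n} (hz : z ≠ 0) : ContDiffAt ℝ ∞ (conePotential m n C E₁ E₂) z := by
  have hz' : ‖z‖ ≠ 0 := norm_ne_zero_iff.2 hz
  have hn : ContDiffAt ℝ ∞ (fun z : Amb m n => ‖z‖) z := contDiffAt_id.norm ℝ hz
  have hq : ∀ {k : ℕ} (P : Amb m n → EuclideanSpace ℝ (Fin k)), ContDiff ℝ ∞ P →
      ContDiffAt ℝ ∞ (fun z => ‖P z‖ ^ 2 / ‖z‖ ^ 2) z := fun P hP =>
    (hP.norm_sq ℝ).contDiffAt.div (hn.pow 2) (pow_ne_zero 2 hz')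
  have k1 : ContDiffAt ℝ ∞ (fun z => E₁ (‖projY m n z‖ ^ 2 / ‖z‖ ^ 2)) z :=
    h₁.contDiffAt.comp z (hq _ contDiff_projY)
  have k2 : ContDiffAt ℝ ∞ (fun z => E₂ (‖projX m n z‖ ^ 2 / ‖z‖ ^ 2)) z :=
    h₂.contDiffAt.comp z (hq _ contDiff_projX)
  exact (contDiffAt_const.mul (hn.inv hz')).mul (k1.mul k2)

/-- The derivative of `E₁(v) E₂(1 - v)`. -/
def mixedDeriv (E₁ E₂ : ℝ → ℝ) (v u : ℝ) : ℝ := deriv E₁ v * E₂ u - E₁ v * deriv E₂ u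

/-- Differentiation along a line through `z` reduces everything to the derivatives of `‖X‖²` and
`‖Y‖²`. The gradient has only radial components in the two factors. -/
theorem fderiv_conePotential {E₁ E₂ : ℝ → ℝ} (h₁ : ContDiff ℝ ∞ E₁) (h₂ : ContDiff ℝ ∞ E₂)
    (C : ℝ) {z : Amb m n} (hz : z ≠ 0) {u v : ℝ} (hu : u = ‖projX m n z‖ ^ 2 / ‖z‖ ^ 2)
    (hv : v = ‖projY m n z‖ ^ 2 / ‖z‖ ^ 2) (w : Amb m n) :
    fderiv ℝ (conePotential m n C E₁ E₂) z w = C * (‖z‖ ^ 3)⁻¹ *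
      ((-(E₁ v * E₂ u) - 2 * v * mixedDeriv E₁ E₂ v u) * inner ℝ (projX m n z) (projX m n w) +
        (-(E₁ v * E₂ u) + 2 * u * mixedDeriv E₁ E₂ v u) * inner ℝ (projY m n z) (projY m n w)) := by
  have hline : HasDerivAt (fun t : ℝ => z + t • w) w 0 := by
    simpa using ((hasDerivAt_id (0 : ℝ)).smul_const w).const_add z
  have hg : HasFDerivAt (conePotential m n C E₁ E₂) (fderiv ℝ (conePotential m n C E₁ E₂) z)
      (z + (0 : ℝ) • w) := by
    rw [zero_smul, add_zero]
    exact ((contDiffAt_conePotential h₁ h₂ C hz).differentiableAt (by simp)).hasFDerivAt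
  have hd := hg.comp_hasDerivAt (0 : ℝ) hline
  refine hd.unique ?_
  have hX : HasDerivAt (fun t : ℝ => ‖projX m n (z + t • w)‖ ^ 2)
      (2 * inner ℝ (projX m n z) (projX m n w)) 0 := by
    have : HasDerivAt (fun t : ℝ => projX m n (z + t • w)) (projX m n w) 0 := by
      simpa using ((hasDerivAt_id (0 : ℝ)).smul_const (projX m n w)).const_add (projX m n z)
    simpa using this.norm_sq
  have hY : HasDerivAt (fun t : ℝ => ‖projY m n (z + t • w)‖ ^ 2)
      (2 * inner ℝ (projY m n z) (projY m n w)) 0 := by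
    have : HasDerivAt (fun t : ℝ => projY m n (z + t • w)) (projY m n w) 0 := by
      simpa using ((hasDerivAt_id (0 : ℝ)).smul_const (projY m n w)).const_add (projY m n z)
    simpa using this.norm_sq
  have hr0 : ‖z‖ ≠ 0 := norm_ne_zero_iff.2 hz
  have hsq := norm_sq_eq_projX_add_projY z
  have hS : HasDerivAt (fun t : ℝ => ‖z + t • w‖ ^ 2)
      (2 * inner ℝ (projX m n z) (projX m n w) + 2 * inner ℝ (projY m n z) (projY m n w)) 0 := by
    simp only [norm_sq_eq_projX_add_projY]
    exact hX.add hY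
  have hN : HasDerivAt (fun t : ℝ => ‖z + t • w‖)
      ((inner ℝ (projX m n z) (projX m n w) + inner ℝ (projY m n z) (projY m n w)) / ‖z‖) 0 := by
    have := hS.sqrt (by simpa using hr0)
    simp only [sqrt_sq (norm_nonneg _), zero_smul, add_zero] at this
    refine this.congr_deriv ?_
    field_simp
  have hV := hY.div hS (by simpa using hr0)
  have hU := hX.div hS (by simpa using hr0)
  have e₁ : HasDerivAt E₁ (deriv E₁ v) (‖projY m n (z + (0 : ℝ) • w)‖ ^ 2 / ‖z + (0 : ℝ) • w‖ ^ 2) := by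
    rw [zero_smul, add_zero, ← hv]
    exact (h₁.differentiable (by simp) v).hasDerivAt
  have e₂ : HasDerivAt E₂ (deriv E₂ u) (‖projX m n (z + (0 : ℝ) • w)‖ ^ 2 / ‖z + (0 : ℝ) • w‖ ^ 2) := by
    rw [zero_smul, add_zero, ← hu]
    exact (h₂.differentiable (by simp) u).hasDerivAt
  have hE₁ := HasDerivAt.comp (h₂ := E₁) (0 : ℝ) e₁ hV
  have hE₂ := HasDerivAt.comp (h₂ := E₂) (0 : ℝ) e₂ hU
  refine (((hN.inv (by simpa using hr0)).const_mul C).mul (hE₁.mul hE₂)).congr_deriv ?_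
  simp only [Pi.mul_apply, Pi.inv_apply, Pi.div_apply, Function.comp_apply, zero_smul, add_zero,
    ← hu, ← hv, mixedDeriv]
  have hX2 : ‖projX m n z‖ ^ 2 = u * ‖z‖ ^ 2 := by rw [hu]; field_simp
  have hY2 : ‖projY m n z‖ ^ 2 = v * ‖z‖ ^ 2 := by rw [hv]; field_simp
  have huv : u = 1 - v := by
    have : (u + v - 1) * ‖z‖ ^ 2 = 0 := by linear_combination -hX2 - hY2 - hsq
    have := (mul_eq_zero.1 this).resolve_right (pow_ne_zero 2 hr0)
    linarith
  rw [hX2, hY2]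
  generalize E₁ v = a₁
  generalize E₂ u = a₂
  generalize deriv E₁ v = b₁
  generalize deriv E₂ u = b₂
  rw [huv]
  field_simp
  ring

end PotentialField

/-! ### The norm of the deformed Lawson field -/

section LawsonField

variable {m n : ℕ}

theorem sq_norm_projX_add_sq_norm_projY_div {z : Amb m n} (hz : z ≠ 0) :
    ‖projX m n z‖ ^ 2 / ‖z‖ ^ 2 + ‖projY m n z‖ ^ 2 / ‖z‖ ^ 2 = 1 := by
  rw [← add_div, ← norm_sq_eq_projX_add_projY, div_self (pow_ne_zero 2 (norm_ne_zero_iff.2 hz))]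

section Homogeneous

variable {E₁ E₂ : ℝ → ℝ} {C u v : ℝ} {z : Amb m n}

theorem coeffX_conePotential (h₁ : ContDiff ℝ ∞ E₁) (h₂ : ContDiff ℝ ∞ E₂) (hz : z ≠ 0)
    (hu : u = ‖projX m n z‖ ^ 2 / ‖z‖ ^ 2) (hv : v = ‖projY m n z‖ ^ 2 / ‖z‖ ^ 2) :
    coeffX m n (conePotential m n C E₁ E₂) z =
      C * ‖z‖⁻¹ * ((n + 1 - v) * (E₁ v * E₂ u) + 2 * u * v * mixedDeriv E₁ E₂ v u) := by
  have hr0 : ‖z‖ ≠ 0 := norm_ne_zero_iff.2 hz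
  rw [coeffX, fderiv_conePotential h₁ h₂ C hz hu hv, conePotential, ← hu, ← hv, partY_apply,
    projX_inclY, projY_inclY, inner_zero_right, real_inner_self_eq_norm_sq,
    show ‖projY m n z‖ ^ 2 = v * ‖z‖ ^ 2 by rw [hv]; field_simp]
  field_simp
  ring

theorem coeffY_conePotential (h₁ : ContDiff ℝ ∞ E₁) (h₂ : ContDiff ℝ ∞ E₂) (hz : z ≠ 0)
    (hu : u = ‖projX m n z‖ ^ 2 / ‖z‖ ^ 2) (hv : v = ‖projY m n z‖ ^ 2 / ‖z‖ ^ 2) :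
    coeffY m n (conePotential m n C E₁ E₂) z =
      -(C * ‖z‖⁻¹ * ((m + 1 - u) * (E₁ v * E₂ u) - 2 * u * v * mixedDeriv E₁ E₂ v u)) := by
  have hr0 : ‖z‖ ≠ 0 := norm_ne_zero_iff.2 hz
  rw [coeffY, fderiv_conePotential h₁ h₂ C hz hu hv, conePotential, ← hu, ← hv, partX_apply,
    projX_inclX, projY_inclX, inner_zero_right, real_inner_self_eq_norm_sq,
    show ‖projX m n z‖ ^ 2 = u * ‖z‖ ^ 2 by rw [hu]; field_simp]
  field_simp
  ring

theorem norm_sq_potField (g : Amb m n → ℝ) (z : Amb m n) : ‖potField m n g z‖ ^ 2 =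
    coeffX m n g z ^ 2 * ‖projX m n z‖ ^ 2 + coeffY m n g z ^ 2 * ‖projY m n z‖ ^ 2 := by
  rw [norm_sq_eq_projX_add_projY, potField, partX_apply, partY_apply]
  simp [norm_smul, mul_pow]

/-- The two squares come from the derivatives of the potential on the quadrant in the directions of
`R` and `θ`. The norm does not depend on `R`. -/
theorem norm_sq_potField_conePotential (h₁ : ContDiff ℝ ∞ E₁) (h₂ : ContDiff ℝ ∞ E₂) (hz : z ≠ 0)
    (hu : u = ‖projX m n z‖ ^ 2 / ‖z‖ ^ 2) (hv : v = ‖projY m n z‖ ^ 2 / ‖z‖ ^ 2) :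
    ‖potField m n (conePotential m n C E₁ E₂) z‖ ^ 2 =
      C ^ 2 * (u * v * ((m + n + 1) * (E₁ v * E₂ u)) ^ 2 +
        (E₁ v * E₂ u * ((n + 1) * u - (m + 1) * v) + 2 * u * v * mixedDeriv E₁ E₂ v u) ^ 2) := by
  have hr0 : ‖z‖ ≠ 0 := norm_ne_zero_iff.2 hz
  have huv : u + v = 1 := by rw [hu, hv, sq_norm_projX_add_sq_norm_projY_div hz]
  rw [norm_sq_potField, coeffX_conePotential h₁ h₂ hz hu hv, coeffY_conePotential h₁ h₂ hz hu hv,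
    show ‖projX m n z‖ ^ 2 = u * ‖z‖ ^ 2 by rw [hu]; field_simp,
    show ‖projY m n z‖ ^ 2 = v * ‖z‖ ^ 2 by rw [hv]; field_simp]
  generalize mixedDeriv E₁ E₂ v u = M
  generalize E₁ v * E₂ u = H
  obtain rfl : u = 1 - v := by linarith
  field_simp
  ring

end Homogeneous

/-- The exponent of `sin² θ` (or `cos² θ`) in the potential `conePotential`. -/
def lawsonExponent (n : ℕ) (β : ℝ) : ℝ := n * β - (n + 1) / 2

/-- The cutoff function by which the exponent `2 n β` is deformed. -/
def lawsonCutoff (n : ℕ) (β δ : ℝ) : ℝ → ℝ := cutoff (2 * (n - lawsonExponent n β)) δ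

/-- The factor of the deformed potential that depends on `sin² θ` (or `cos² θ`). -/
def lawsonProfile (n : ℕ) (β δ : ℝ) : ℝ → ℝ := profile (lawsonExponent n β) (lawsonCutoff n β δ)

/-- The constant `√τ / (α τ^β)`. -/
def lawsonConst (m n : ℕ) (β : ℝ) : ℝ := √(tauConst m n) / ((m + n + 1) * tauConst m n ^ β)

/-- The deformed potential in the form used for the divergence-free field. -/
def lawsonPotential (m n : ℕ) (β δ ε : ℝ) : Amb m n → ℝ :=
  conePotential m n (lawsonConst m n β) (lawsonProfile n β δ) (lawsonProfile m β ε)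

/-- The correction to the logarithmic derivative of the profile. -/
def lawsonCorrection (n : ℕ) (β δ v : ℝ) : ℝ :=
  profileCorrection (2 * (n - lawsonExponent n β)) δ v

theorem tauConst_eq (hm : 1 ≤ m) (hn : 1 ≤ n) :
    tauConst m n = ((m : ℝ) / (m + n)) ^ m * ((n : ℝ) / (m + n)) ^ n := by
  rw [tauConst, cos_coneAngle hm n, sin_coneAngle hm n, pow_mul, pow_mul, radX, radY,
    sq_sqrt (by positivity), sq_sqrt (by positivity)]

theorem tauConst_pos (hm : 1 ≤ m) (hn : 1 ≤ n) : 0 < tauConst m n := by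
  have : (0 : ℝ) < m := by positivity
  have : (0 : ℝ) < n := by positivity
  rw [tauConst_eq hm hn]
  positivity

theorem lawsonConst_pos (hm : 1 ≤ m) (hn : 1 ≤ n) (β : ℝ) : 0 < lawsonConst m n β := by
  have := tauConst_pos hm hn
  have := rpow_pos_of_pos this β
  rw [lawsonConst]
  positivity

theorem sq_lawsonConst (hm : 1 ≤ m) (hn : 1 ≤ n) (β : ℝ) :
    lawsonConst m n β ^ 2 * (m + n + 1) ^ 2 = tauConst m n ^ (1 - 2 * β) := by
  have h := tauConst_pos hm hn
  have h' := rpow_pos_of_pos h β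
  rw [lawsonConst, div_pow, sq_sqrt h.le, rpow_sub h, rpow_one, mul_comm 2 β, rpow_mul h.le,
    rpow_two]
  field_simp

section Bounds

variable {β δ ε : ℝ}

theorem IsLawsonExponent.cutoff_height_nonneg (h : IsLawsonExponent m n β) :
    0 ≤ 2 * (n - lawsonExponent n β) := by
  have := h.snd_lt
  rw [lawsonExponent]
  linarith

theorem contDiff_lawsonProfile (hδ : 0 < δ) (hδ' : δ < π / 2) :
    ContDiff ℝ ∞ (lawsonProfile n β δ) :=
  contDiff_profile (n := n) hδ hδ' (by ring)

theorem lawsonProfile_zero (hn : 1 ≤ n) (hδ : 0 < δ) : lawsonProfile n β δ 0 = 0 :=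
  profile_zero hn hδ (by ring)

theorem lawsonProfile_eq_rpow {v : ℝ} (hδ : 0 < δ) (h : δ ≤ arcsin √v) :
    lawsonProfile n β δ v = v ^ lawsonExponent n β := profile_eq_rpow hδ h

theorem arcsin_sqrt_eq_pi_div_two_sub {u v : ℝ} (hu : 0 ≤ u) (huv : u + v = 1) :
    arcsin √u = π / 2 - arcsin √v := by
  rw [← arccos, arcsin_eq_arccos (sqrt_nonneg _), sq_sqrt hu, show 1 - u = v by linarith]

/-- The second summand of the squared norm of the field. -/
theorem lawson_radial_eq {u v : ℝ} (hv : v ∈ Ioo (0 : ℝ) 1) (huv : u + v = 1) :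
    lawsonProfile n β δ v * lawsonProfile m β ε u * ((n + 1) * u - (m + 1) * v) +
      2 * u * v * mixedDeriv (lawsonProfile n β δ) (lawsonProfile m β ε) v u =
    lawsonProfile n β δ v * lawsonProfile m β ε u *
      (2 * β * (n * u - m * v) + lawsonCorrection n β δ v - lawsonCorrection m β ε u) := by
  have hu : u ∈ Ioo (0 : ℝ) 1 := ⟨by linarith [hv.2], by linarith [hv.1]⟩
  have d₁ := deriv_profile (c := lawsonExponent n β) (A := 2 * (n - lawsonExponent n β)) (δ := δ) hv
  have d₂ := deriv_profile (c := lawsonExponent m β) (A := 2 * (m - lawsonExponent m β)) (δ := ε) hu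
  change 2 * (1 - v) * v * deriv (lawsonProfile n β δ) v = lawsonProfile n β δ v *
    (_ + lawsonCorrection n β δ v) at d₁
  change 2 * (1 - u) * u * deriv (lawsonProfile m β ε) u = lawsonProfile m β ε u *
    (_ + lawsonCorrection m β ε u) at d₂
  rw [mixedDeriv]
  obtain rfl : u = 1 - v := by linarith
  rw [sub_sub_cancel] at d₂
  simp only [lawsonExponent] at d₁ d₂
  linear_combination lawsonProfile m β ε (1 - v) * d₁ - lawsonProfile n β δ v * d₂

/-- The exponentiated form of `IsLawsonExponent.log_le`: the bound on the squared norm where no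
cutoff acts. -/
theorem lawson_log_eq {u v : ℝ} (h : IsLawsonExponent m n β) (hm : 1 ≤ m) (hn : 1 ≤ n)
    (hv : v ∈ Ioo (0 : ℝ) 1) (huv : u + v = 1) :
    tauConst m n ^ (1 - 2 * β) * (v ^ lawsonExponent n β * u ^ lawsonExponent m β) ^ 2 *
      (u * v + 4 * (β / (m + n + 1)) ^ 2 * (n * u - m * v) ^ 2) ≤ 1 := by
  obtain rfl : u = 1 - v := by linarith
  have hu : 0 < 1 - v := by linarith [hv.2]
  have hv0 := hv.1
  have hm0 : (0 : ℝ) < m := by positivity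
  have hn0 : (0 : ℝ) < n := by positivity
  have hτ := tauConst_pos hm hn
  have hQ : 0 < (1 - v) * v + 4 * (β / (m + n + 1)) ^ 2 * (n * (1 - v) - m * v) ^ 2 := by
    have := mul_pos hu hv0
    positivity
  have h1 : 0 < tauConst m n ^ (1 - 2 * β) := rpow_pos_of_pos hτ _
  have h2 : 0 < v ^ lawsonExponent n β := rpow_pos_of_pos hv0 _
  have h3 : 0 < (1 - v) ^ lawsonExponent m β := rpow_pos_of_pos hu _
  rw [← log_nonpos_iff (by positivity), log_mul (by positivity) (by positivity),
    log_mul (by positivity) (by positivity), log_pow, log_mul (by positivity) (by positivity),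
    log_rpow hτ, log_rpow hv0, log_rpow hu, tauConst_eq hm hn,
    log_mul (by positivity) (by positivity), log_pow, log_pow]
  have := h.log_le hm hn hv
  simp only [lawsonExponent]
  push_cast
  linarith

theorem lawson_norm_le_middle {u v : ℝ} (h : IsLawsonExponent m n β) (hm : 1 ≤ m) (hn : 1 ≤ n)
    (hδ : 0 < δ) (hε : 0 < ε) (hv : v ∈ Ioo (0 : ℝ) 1) (huv : u + v = 1)
    (hδv : δ ≤ arcsin √v) (hεu : ε ≤ arcsin √u) :
    lawsonConst m n β ^ 2 * (u * v * ((m + n + 1) * (lawsonProfile n β δ v * lawsonProfile m β ε u)) ^ 2 +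
      (lawsonProfile n β δ v * lawsonProfile m β ε u *
        (2 * β * (n * u - m * v) + lawsonCorrection n β δ v - lawsonCorrection m β ε u)) ^ 2) ≤ 1 := by
  rw [lawsonProfile_eq_rpow hδ hδv, lawsonProfile_eq_rpow hε hεu, lawsonCorrection, lawsonCorrection,
    profileCorrection_eq_zero h.cutoff_height_nonneg hδ hδv,
    profileCorrection_eq_zero h.symm.cutoff_height_nonneg hε hεu]
  refine le_of_eq_of_le ?_ (lawson_log_eq h hm hn hv huv)
  rw [← sq_lawsonConst hm hn]
  have : (m + n + 1 : ℝ) ≠ 0 := by positivity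
  field_simp
  ring

/-- Cutoff angles below `π/4` keep the two deformed regions apart, so near one axis the other
profile is a pure power at most one without correction. The remaining factor is then made small by
decreasing `δ`. -/
theorem exists_lawson_norm_le_near (h : IsLawsonExponent m n β) (hm : 1 ≤ m) (hn : 1 ≤ n) :
    ∃ δ₁ > 0, ∀ δ ε, 0 < δ → δ < δ₁ → δ < π / 4 → 0 < ε → ε < π / 4 → ∀ u v : ℝ,
      v ∈ Ioo (0 : ℝ) 1 → u + v = 1 → arcsin √v < δ →
    lawsonConst m n β ^ 2 * (u * v * ((m + n + 1) * (lawsonProfile n β δ v * lawsonProfile m β ε u)) ^ 2 +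
      (lawsonProfile n β δ v * lawsonProfile m β ε u *
        (2 * β * (n * u - m * v) + lawsonCorrection n β δ v - lawsonCorrection m β ε u)) ^ 2) ≤ 1 := by
  have hC := lawsonConst_pos hm hn β
  have hβ : 0 < β := by linarith [h.half_lt]
  -- `D` bounds the sum of the undeformed derivatives in `R` and `θ`, and `B` absorbs the
  -- normalizing constant.
  obtain ⟨δ₁, hδ₁, H⟩ := exists_forall_profile_mul_le (c := lawsonExponent n β) h.snd_pos
    (A := 2 * (n - lawsonExponent n β)) (D := (m + n + 1) + 2 * β * (m + n))
    (B := (lawsonConst m n β)⁻¹) h.cutoff_height_nonneg (by positivity) (by positivity)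
  refine ⟨δ₁, hδ₁, fun δ ε hδ hδδ hδπ hε hεπ u v hv huv hθ => ?_⟩
  have hu : u ∈ Ioo (0 : ℝ) 1 := ⟨by linarith [hv.2], by linarith [hv.1]⟩
  have hεu : ε ≤ arcsin √u := by
    rw [arcsin_sqrt_eq_pi_div_two_sub hu.1.le huv]
    linarith
  have hE2 : lawsonProfile m β ε u ≤ 1 := by
    rw [lawsonProfile_eq_rpow hε hεu]
    exact rpow_le_one hu.1.le hu.2.le h.fst_pos.le
  have hE2' : 0 ≤ lawsonProfile m β ε u := rpow_nonneg hu.1.le _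
  have hE1' : 0 ≤ lawsonProfile n β δ v := rpow_nonneg hv.1.le _
  have hb := H δ hδ hδδ v hv hθ
  change lawsonProfile n β δ v * (_ + |lawsonCorrection n β δ v|) ≤ _ at hb
  rw [show lawsonCorrection m β ε u = 0 from
    profileCorrection_eq_zero h.symm.cutoff_height_nonneg hε hεu, sub_zero]
  generalize lawsonProfile n β δ v = a at *
  generalize lawsonProfile m β ε u = b at *
  generalize lawsonCorrection n β δ v = e at *
  generalize lawsonConst m n β = C at *
  have hab : C * (a * b * ((m + n + 1) + 2 * β * (m + n) + |e|)) ≤ 1 := by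
    have : a * b * ((m + n + 1) + 2 * β * (m + n) + |e|) ≤ C⁻¹ := by
      refine le_trans ?_ hb
      rw [mul_right_comm]
      exact mul_le_of_le_one_right (by positivity) hE2
    calc _ ≤ C * C⁻¹ := by gcongr
      _ = 1 := mul_inv_cancel₀ hC.ne'
  have huv1 : u * v ≤ 1 := mul_le_one₀ hu.2.le hv.1.le hv.2.le
  have hlin : |2 * β * (n * u - m * v) + e| ≤ 2 * β * (m + n) + |e| := by
    refine (abs_add_le _ _).trans (add_le_add_left ?_ _)
    rw [abs_mul, abs_of_pos (by positivity : 0 < 2 * β)]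
    refine mul_le_mul_of_nonneg_left ?_ (by positivity)
    have h1 : (n : ℝ) * u ≤ n := mul_le_of_le_one_right (by positivity) hu.2.le
    have h2 : (m : ℝ) * v ≤ m := mul_le_of_le_one_right (by positivity) hv.2.le
    have h3 : 0 ≤ (n : ℝ) * u := mul_nonneg (by positivity) hu.1.le
    have h4 : 0 ≤ (m : ℝ) * v := mul_nonneg (by positivity) hv.1.le
    rw [abs_le]
    constructor <;> linarith
  have hq : u * v * (m + n + 1 : ℝ) ^ 2 + (2 * β * (n * u - m * v) + e) ^ 2 ≤
      ((m + n + 1) + 2 * β * (m + n) + |e|) ^ 2 := by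
    have h1 : (2 * β * (n * u - m * v) + e) ^ 2 ≤ (2 * β * (m + n) + |e|) ^ 2 := by
      rw [← sq_abs]
      gcongr
    have h2 : u * v * (m + n + 1 : ℝ) ^ 2 ≤ (m + n + 1 : ℝ) ^ 2 :=
      mul_le_of_le_one_left (by positivity) huv1
    have h3 : 0 ≤ (m + n + 1 : ℝ) * (2 * β * (m + n) + |e|) := by positivity
    linarith
  calc _ = (C * (a * b)) ^ 2 * (u * v * (m + n + 1 : ℝ) ^ 2 + (2 * β * (n * u - m * v) + e) ^ 2) := by
        ring
    _ ≤ (C * (a * b)) ^ 2 * ((m + n + 1) + 2 * β * (m + n) + |e|) ^ 2 := by gcongr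
    _ = (C * (a * b * ((m + n + 1) + 2 * β * (m + n) + |e|))) ^ 2 := by ring
    _ ≤ 1 := pow_le_one₀ (by positivity) hab

/-- For small cutoff angles the field has norm at most one. -/
theorem exists_norm_potField_le_one (h : IsLawsonExponent m n β) (hm : 1 ≤ m) (hn : 1 ≤ n) :
    ∃ δ ε, 0 < δ ∧ δ < coneAngle m n ∧ 0 < ε ∧ ε < π / 2 - coneAngle m n ∧
      ∀ z ≠ 0, ‖potField m n (lawsonPotential m n β δ ε) z‖ ≤ 1 := by
  obtain ⟨δ₁, hδ₁, H₁⟩ := exists_lawson_norm_le_near h hm hn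
  obtain ⟨δ₂, hδ₂, H₂⟩ := exists_lawson_norm_le_near h.symm hn hm
  have hang : 0 < coneAngle m n := by
    have : (0 : ℝ) < m := by positivity
    have : (0 : ℝ) < n := by positivity
    exact arctan_pos.2 (sqrt_pos.2 (by positivity))
  have hang' : 0 < π / 2 - coneAngle m n := sub_pos.2 (arctan_lt_pi_div_two _)
  obtain ⟨δ, hδ, hδ'⟩ := exists_between (lt_min hδ₁ (lt_min hang (by positivity : 0 < π / 4)))
  obtain ⟨ε, hε, hε'⟩ := exists_between (lt_min hδ₂ (lt_min hang' (by positivity : 0 < π / 4)))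
  rw [lt_min_iff, lt_min_iff] at hδ' hε'
  refine ⟨δ, ε, hδ, hδ'.2.1, hε, hε'.2.1, fun z hz => ?_⟩
  have hπ := pi_pos
  obtain ⟨u, hu⟩ : ∃ u, u = ‖projX m n z‖ ^ 2 / ‖z‖ ^ 2 := ⟨_, rfl⟩
  obtain ⟨v, hv⟩ : ∃ v, v = ‖projY m n z‖ ^ 2 / ‖z‖ ^ 2 := ⟨_, rfl⟩
  have huv : u + v = 1 := by rw [hu, hv, sq_norm_projX_add_sq_norm_projY_div hz]
  have hu0 : 0 ≤ u := by rw [hu]; positivity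
  have hv0 : 0 ≤ v := by rw [hv]; positivity
  rw [← sq_le_one_iff₀ (norm_nonneg _), lawsonPotential,
    norm_sq_potField_conePotential (contDiff_lawsonProfile hδ (by linarith))
      (contDiff_lawsonProfile hε (by linarith)) hz hu hv]
  -- On the axes the field vanishes, since the profiles are positive integer powers near zero; this
  -- excludes the points where logarithms are unavailable.
  rcases hv0.eq_or_lt with rfl | hv0
  · simp [lawsonProfile_zero hn hδ]
  rcases hu0.eq_or_lt with rfl | hu0
  · simp [lawsonProfile_zero hm hε]
  have hvI : v ∈ Ioo (0 : ℝ) 1 := ⟨hv0, by linarith⟩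
  have huI : u ∈ Ioo (0 : ℝ) 1 := ⟨hu0, by linarith⟩
  rw [lawson_radial_eq hvI huv]
  rcases lt_or_ge (arcsin √v) δ with h1 | h1
  · exact H₁ δ ε hδ hδ'.1 hδ'.2.2 hε hε'.2.2 u v hvI huv h1
  rcases lt_or_ge (arcsin √u) ε with h2 | h2
  -- Near the other axis the same estimate applies with `m` and `n` interchanged; the normalizing
  -- constant is symmetric.
  · refine le_of_eq_of_le ?_ (H₂ ε δ hε hε'.1 hε'.2.2 hδ hδ'.2.2 v u huI (by linarith) h2)
    have hC : lawsonConst n m β ^ 2 = lawsonConst m n β ^ 2 := by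
      have h3 := sq_lawsonConst hm hn β
      have h4 := sq_lawsonConst hn hm β
      have : tauConst n m = tauConst m n := by
        rw [tauConst_eq hm hn, tauConst_eq hn hm, mul_comm, add_comm (n : ℝ)]
      rw [this, ← h3, add_comm (n : ℝ)] at h4
      exact mul_right_cancel₀ (by positivity) h4
    rw [hC]
    ring
  · exact lawson_norm_le_middle h hm hn hδ hε hvI huv h1 h2

end Bounds

end LawsonField

/-! ### The calibration properties of the form -/

section Calibration

variable {m n : ℕ} {β δ ε : ℝ}

theorem norm_of_mem_coneOver_link (hm : 1 ≤ m) {z : Amb m n} (hz : z ∈ coneOver (link m n)) :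
    ‖projX m n z‖ = ‖z‖ * radX m n ∧ ‖projY m n z‖ = ‖z‖ * radY m n := by
  obtain ⟨t, ht, x, ⟨hX, hY⟩, rfl⟩ := hz
  have hx : ‖x‖ = 1 := by
    rw [← sq_eq_sq₀ (norm_nonneg _) zero_le_one, norm_sq_eq_projX_add_projY, hX, hY,
      radX_sq_add_radY_sq hm, one_pow]
  simp only [map_smul, norm_smul, hX, hY, hx, mul_one, and_self]

theorem sq_radX (m n : ℕ) : radX m n ^ 2 = m / (m + n) := sq_sqrt (by positivity)

theorem sq_radY (m n : ℕ) : radY m n ^ 2 = n / (m + n) := sq_sqrt (by positivity)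

theorem div_sq_of_mem_coneOver_link (hm : 1 ≤ m) {z : Amb m n} (hz : z ∈ coneOver (link m n))
    (hz0 : z ≠ 0) : (m : ℝ) / (m + n) = ‖projX m n z‖ ^ 2 / ‖z‖ ^ 2 ∧
      (n : ℝ) / (m + n) = ‖projY m n z‖ ^ 2 / ‖z‖ ^ 2 := by
  have hr0 : ‖z‖ ≠ 0 := norm_ne_zero_iff.2 hz0
  obtain ⟨hX, hY⟩ := norm_of_mem_coneOver_link hm hz
  rw [hX, hY, mul_pow, mul_pow, sq_radX, sq_radY]
  constructor <;> field_simp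

theorem arcsin_sqrt_cone (hm : 1 ≤ m) (n : ℕ) : arcsin √((n : ℝ) / (m + n)) = coneAngle m n := by
  rw [show √((n : ℝ) / (m + n)) = radY m n from rfl, ← sin_coneAngle hm n, arcsin_sin]
  · exact (neg_pi_div_two_lt_arctan _).le
  · exact (arctan_lt_pi_div_two _).le

theorem arcsin_sqrt_cone' (hm : 1 ≤ m) (n : ℕ) :
    arcsin √((m : ℝ) / (m + n)) = π / 2 - coneAngle m n := by
  rw [← arcsin_sqrt_cone hm n, arcsin_sqrt_eq_pi_div_two_sub (by positivity)]
  have : (0 : ℝ) < m + n := by positivity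
  field_simp

/-- Each factor `w (w^c)²` equals `(w^k)^(2β-1)`, and on the cone their product is `τ^(2β-1)`. The
constants in the potential are the normalization that makes this value one. -/
theorem lawson_cone_value (β : ℝ) (hm : 1 ≤ m) (hn : 1 ≤ n) {u v : ℝ}
    (hu : u = m / (m + n)) (hv : v = n / (m + n)) :
    tauConst m n ^ (1 - 2 * β) * (u * v * (v ^ lawsonExponent n β * u ^ lawsonExponent m β) ^ 2)
      = 1 := by
  have hm0 : (0 : ℝ) < m := by positivity
  have hn0 : (0 : ℝ) < n := by positivity
  have hu0 : 0 < u := by rw [hu]; positivity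
  have hv0 : 0 < v := by rw [hv]; positivity
  have key : ∀ {w : ℝ} (k : ℕ), 0 < w → w * (w ^ lawsonExponent k β) ^ 2 = (w ^ k) ^ (2 * β - 1) := by
    intro w k hw
    rw [← rpow_natCast _ 2, ← rpow_mul hw.le, ← rpow_natCast w k, ← rpow_mul hw.le, mul_comm,
      ← rpow_add_one hw.ne']
    congr 1
    push_cast
    rw [lawsonExponent]
    ring
  have hτ := tauConst_pos hm hn
  calc _ = tauConst m n ^ (1 - 2 * β) * ((u * (u ^ lawsonExponent m β) ^ 2) *
        (v * (v ^ lawsonExponent n β) ^ 2)) := by ring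
    _ = tauConst m n ^ (1 - 2 * β) * tauConst m n ^ (2 * β - 1) := by
        rw [key m hu0, key n hv0, ← mul_rpow (by positivity) (by positivity), tauConst_eq hm hn,
          hu, hv]
    _ = 1 := by
        rw [← rpow_add hτ]
        simp

/-- On the cone the field is normal to the cone and has norm one. -/
theorem potField_lawsonPotential_of_mem_cone (h : IsLawsonExponent m n β) (hm : 1 ≤ m) (hn : 1 ≤ n)
    (hδ : 0 < δ) (hδ' : δ < coneAngle m n) (hε : 0 < ε) (hε' : ε < π / 2 - coneAngle m n)
    {z : Amb m n} (hz : z ∈ coneOver (link m n)) (hz0 : z ≠ 0) :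
    (∃ c : ℝ, potField m n (lawsonPotential m n β δ ε) z = c • coneNormal m n z) ∧
      ‖potField m n (lawsonPotential m n β δ ε) z‖ = 1 := by
  obtain ⟨hu, hv⟩ := div_sq_of_mem_coneOver_link hm hz hz0
  have hm0 : (0 : ℝ) < m := by positivity
  have hn0 : (0 : ℝ) < n := by positivity
  have hang : coneAngle m n < π / 2 := arctan_lt_pi_div_two _
  have hE₁ : ContDiff ℝ ∞ (lawsonProfile n β δ) := contDiff_lawsonProfile hδ (by linarith)
  have hE₂ : ContDiff ℝ ∞ (lawsonProfile m β ε) := contDiff_lawsonProfile hε (by linarith)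
  have hδv : δ ≤ arcsin √((n : ℝ) / (m + n)) := by rw [arcsin_sqrt_cone hm]; exact hδ'.le
  have hεu : ε ≤ arcsin √((m : ℝ) / (m + n)) := by rw [arcsin_sqrt_cone' hm]; exact hε'.le
  obtain ⟨u, hu'⟩ : ∃ u : ℝ, u = m / (m + n) := ⟨_, rfl⟩
  obtain ⟨v, hv'⟩ : ∃ v : ℝ, v = n / (m + n) := ⟨_, rfl⟩
  rw [← hu'] at hu hεu
  rw [← hv'] at hv hδv
  have huv : u + v = 1 := by rw [hu', hv']; field_simp
  have hu0 : 0 < u := by rw [hu']; positivity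
  have hvI : v ∈ Ioo (0 : ℝ) 1 := ⟨by rw [hv']; positivity, by linarith⟩
  have hrad := lawson_radial_eq (m := m) (n := n) (β := β) (δ := δ) (ε := ε) hvI huv
  rw [show n * u - m * v = 0 by rw [hu', hv']; ring, lawsonCorrection, lawsonCorrection,
    profileCorrection_eq_zero h.cutoff_height_nonneg hδ hδv,
    profileCorrection_eq_zero h.symm.cutoff_height_nonneg hε hεu, mul_zero, add_zero, sub_zero,
    mul_zero] at hrad
  -- On the cone the derivative in `θ` vanishes, so the gradient of the potential on the quadrant is
  -- radial; the field, which is that gradient turned by a right angle, is normal to the cone.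
  constructor
  · refine ⟨-(lawsonConst m n β * ‖z‖⁻¹ * (lawsonProfile n β δ v * lawsonProfile m β ε u) *
      ((m + n + 1) / (m + n))), ?_⟩
    rw [potField, lawsonPotential, coeffX_conePotential hE₁ hE₂ hz0 hu hv,
      coeffY_conePotential hE₁ hE₂ hz0 hu hv, coneNormal, partX_apply, partY_apply, map_smul, map_smul,
      smul_add, smul_smul, smul_smul]
    have h1 : 2 * u * v * mixedDeriv (lawsonProfile n β δ) (lawsonProfile m β ε) v u =
      -(lawsonProfile n β δ v * lawsonProfile m β ε u * ((n + 1) * u - (m + 1) * v)) := by linarith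
    rw [h1]
    congr 2
    · rw [hu', hv']
      field_simp
      ring
    · rw [hu', hv']
      field_simp
      ring
  · rw [← sq_eq_sq₀ (norm_nonneg _) zero_le_one, lawsonPotential,
      norm_sq_potField_conePotential hE₁ hE₂ hz0 hu hv, hrad, lawsonProfile_eq_rpow hδ hδv,
      lawsonProfile_eq_rpow hε hεu]
    have key := lawson_cone_value β hm hn hu' hv'
    rw [← sq_lawsonConst hm hn] at key
    linear_combination key

/-- The cone lies in the zero set of `n‖X‖² - m‖Y‖²`, whose derivative is a multiple of the pairing
with `coneNormal`. Uniqueness of derivatives within a set, on its tangent cone, gives zero. -/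
theorem inner_coneNormal_of_mem_tangentCone (hm : 1 ≤ m) {z y : Amb m n}
    (hz : z ∈ coneOver (link m n)) (hy : y ∈ tangentConeAt ℝ (coneOver (link m n)) z) :
    inner ℝ (coneNormal m n z) y = 0 := by
  have hq : ∀ w ∈ coneOver (link m n), (n : ℝ) * ‖projX m n w‖ ^ 2 - m * ‖projY m n w‖ ^ 2 = 0 := by
    intro w hw
    obtain ⟨hX, hY⟩ := norm_of_mem_coneOver_link hm hw
    rw [hX, hY, mul_pow, mul_pow]
    linear_combination -‖w‖ ^ 2 * mul_radY_sq_eq m n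
  have hX : HasFDerivAt (fun w => projX m n w) (LinearMap.toContinuousLinearMap (projX m n)) z :=
    (LinearMap.toContinuousLinearMap (projX m n)).hasFDerivAt
  have hY : HasFDerivAt (fun w => projY m n w) (LinearMap.toContinuousLinearMap (projY m n)) z :=
    (LinearMap.toContinuousLinearMap (projY m n)).hasFDerivAt
  have hX2 := hX.norm_sq
  have hY2 := hY.norm_sq
  have hd := ((hX2.const_mul (n : ℝ)).sub (hY2.const_mul (m : ℝ))).hasFDerivWithinAt
    (s := coneOver (link m n))
  have h0 : HasFDerivWithinAt (fun w => (n : ℝ) * ‖projX m n w‖ ^ 2 - m * ‖projY m n w‖ ^ 2)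
      (0 : Amb m n →L[ℝ] ℝ) (coneOver (link m n)) z :=
    (hasFDerivWithinAt_const (0 : ℝ) z (coneOver (link m n))).congr hq (hq z hz)
  have := HasFDerivWithinAt.unique_on hd h0 hy
  simp only [sub_apply, smul_apply, ContinuousLinearMap.comp_apply, innerSL_apply_apply, zero_apply,
    smul_eq_mul, LinearMap.coe_toContinuousLinearMap', nsmul_eq_mul] at this
  rw [inner_eq_projX_add_projY, coneNormal]
  simp only [map_add, projX_inclX, projX_inclY, projY_inclX, projY_inclY, add_zero, zero_add,
    inner_smul_left, map_neg, conj_trivial]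
  push_cast at this
  linarith

theorem inner_coneNormal_of_mem_span (hm : 1 ≤ m) {z y : Amb m n} (hz : z ∈ coneOver (link m n))
    (hy : y ∈ Submodule.span ℝ (tangentConeAt ℝ (coneOver (link m n)) z)) :
    inner ℝ (coneNormal m n z) y = 0 := by
  induction hy using Submodule.span_induction with
  | mem y hy => exact inner_coneNormal_of_mem_tangentCone hm hz hy
  | zero => exact inner_zero_right _
  | add x y _ _ hx hy => rw [inner_add_right, hx, hy, add_zero]
  | smul c x _ hx => rw [inner_smul_right, hx, mul_zero]

/-- The potential is even and homogeneous of degree -1, so the field is odd and homogeneous of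
degree 0. It has opposite values at opposite points of a line through the origin. -/
theorem potField_conePotential_smul {E₁ E₂ : ℝ → ℝ} (h₁ : ContDiff ℝ ∞ E₁) (h₂ : ContDiff ℝ ∞ E₂)
    (C : ℝ) {z : Amb m n} (hz : z ≠ 0) {t : ℝ} (ht : t ≠ 0) :
    potField m n (conePotential m n C E₁ E₂) (t • z) =
      (|t|⁻¹ * t) • potField m n (conePotential m n C E₁ E₂) z := by
  have hq : ∀ {k : ℕ} (P : Amb m n →ₗ[ℝ] EuclideanSpace ℝ (Fin k)),
      ‖P z‖ ^ 2 / ‖z‖ ^ 2 = ‖P (t • z)‖ ^ 2 / ‖t • z‖ ^ 2 := fun P => by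
    rw [map_smul, norm_smul, norm_smul, mul_pow, mul_pow,
      mul_div_mul_left _ _ (pow_ne_zero 2 (norm_ne_zero_iff.2 ht))]
  rw [potField, potField, coeffX_conePotential h₁ h₂ (smul_ne_zero ht hz) (hq _) (hq _),
    coeffY_conePotential h₁ h₂ (smul_ne_zero ht hz) (hq _) (hq _),
    coeffX_conePotential h₁ h₂ hz rfl rfl, coeffY_conePotential h₁ h₂ hz rfl rfl, map_smul,
    map_smul, norm_smul, mul_inv, Real.norm_eq_abs, smul_add, smul_smul, smul_smul, smul_smul,
    smul_smul]
  congr 2 <;> ring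

/-- A form which is constant, up to a nonzero odd sign, on punctured lines has no limit at `0`. -/
theorem not_tendsto_of_smul {E F : Type*} [NormedAddCommGroup E] [NormedSpace ℝ E]
    [NormedAddCommGroup F] [NormedSpace ℝ F] {Φ : E → F} {z : E} (hz : z ≠ 0) (hΦ : Φ z ≠ 0)
    (h : ∀ t : ℝ, t ≠ 0 → Φ (t • z) = (|t|⁻¹ * t) • Φ z) :
    ¬ ∃ L, Tendsto Φ (𝓝[≠] 0) (𝓝 L) := by
  rintro ⟨L, hL⟩
  have hline : ∀ s : Set ℝ, s ⊆ {0}ᶜ → Tendsto (fun t : ℝ => t • z) (𝓝[s] 0) (𝓝[≠] 0) := by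
    intro s hs
    refine tendsto_nhdsWithin_iff.2 ⟨?_, ?_⟩
    · have : ContinuousAt (fun t : ℝ => t • z) 0 := by fun_prop
      simpa [ContinuousAt] using this.tendsto.mono_left nhdsWithin_le_nhds
    · filter_upwards [self_mem_nhdsWithin] with t ht
      exact smul_ne_zero (hs ht) hz
  have h1 : L = Φ z := by
    refine tendsto_nhds_unique (hL.comp (hline (Ioi 0) fun t ht => (mem_Ioi.1 ht).ne'))
      (tendsto_const_nhds.congr' ?_)
    filter_upwards [self_mem_nhdsWithin] with t ht
    have ht : 0 < t := ht
    rw [Function.comp_apply, h t ht.ne', abs_of_pos ht, inv_mul_cancel₀ ht.ne', one_smul]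
  have h2 : L = -Φ z := by
    refine tendsto_nhds_unique (hL.comp (hline (Iio 0) fun t ht => (mem_Iio.1 ht).ne))
      (tendsto_const_nhds.congr' ?_)
    filter_upwards [self_mem_nhdsWithin] with t ht
    have ht : t < 0 := ht
    rw [Function.comp_apply, h t ht.ne, abs_of_neg ht, inv_neg, neg_mul, inv_mul_cancel₀ ht.ne,
      neg_one_smul]
  have h3 : (2 : ℝ) • Φ z = 0 := by
    rw [two_smul]
    exact add_eq_zero_iff_eq_neg.2 (h1.symm.trans h2)
  exact hΦ ((smul_eq_zero.1 h3).resolve_left two_ne_zero)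

/-- The calibrating form, the contraction of the volume form with the field. -/
def lawsonForm (m n : ℕ) (β δ ε : ℝ) : DiffForm (Amb m n) (m + n + 1) := fun z =>
  fluxForm (ambBasis m n) (potField m n (lawsonPotential m n β δ ε) z)

theorem exists_mem_cone_fluxForm_ne_zero (hm : 1 ≤ m) (hn : 1 ≤ n) :
    ∃ z ∈ coneOver (link m n), z ≠ 0 ∧ fluxForm (ambBasis m n) (coneNormal m n z) ≠ 0 := by
  obtain ⟨p, hp⟩ : ∃ p : Fin (m + n + 1) → ℝ, p ∈ openSlab (m + n) 0 1 ∧ 0 < p (Fin.last _) :=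
    ⟨fun _ => 1 / 2, by constructor <;> norm_num [openSlab], by norm_num⟩
  refine ⟨coneChart m n p, ?_, ?_, ?_⟩
  · refine ⟨p (Fin.last _), hp.2.le, orbPoint m n (radX m n) (radY m n) (Fin.init p), ⟨?_, ?_⟩, ?_⟩
    · rw [projX_orbPoint, norm_smul, norm_stereo, mul_one, Real.norm_eq_abs,
        abs_of_pos (radX_pos hm)]
    · rw [projY_orbPoint, norm_smul, norm_stereo, mul_one, Real.norm_eq_abs,
        abs_of_pos (radY_pos hn)]
    · rw [coneChart_eq_orbitChart, orbitChart, orbPoint, orbPoint, smul_add, smul_smul, smul_smul]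
  · rw [← norm_ne_zero_iff, norm_coneChart hm hp.2.le]
    exact hp.2.ne'
  · intro h0
    have h := abs_fluxForm_coneNormal hm hn hp.1
    rw [map_smul, h0, smul_zero] at h
    change |(0 : ℝ)| = _ at h
    rw [abs_zero] at h
    have := radX_pos (n := n) hm
    have := radY_pos (m := m) hn
    have := orbJacobian_pos (m := m) (n := n) (Fin.init p)
    have := hp.2
    exact absurd h (by positivity)

/-- All properties of the form are properties of the field: smoothness, zero divergence, norm at
most one, being a unit normal on the cone, and oddness with a nonzero value. -/
theorem isCalibration_lawsonForm (h : IsLawsonExponent m n β) (hm : 1 ≤ m) (hn : 1 ≤ n)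
    (hδ : 0 < δ) (hδ' : δ < coneAngle m n) (hε : 0 < ε) (hε' : ε < π / 2 - coneAngle m n)
    (hW : ∀ z ≠ 0, ‖potField m n (lawsonPotential m n β δ ε) z‖ ≤ 1) :
    IsCalibrationSingularOnlyAtZero (lawsonForm m n β δ ε) (coneOver (link m n)) := by
  have hang : coneAngle m n < π / 2 := arctan_lt_pi_div_two _
  have hang' : 0 < coneAngle m n := hδ.trans hδ'
  have hE₁ : ContDiff ℝ ∞ (lawsonProfile n β δ) := contDiff_lawsonProfile hδ (by linarith)
  have hE₂ : ContDiff ℝ ∞ (lawsonProfile m β ε) := contDiff_lawsonProfile hε (by linarith)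
  have hg : ∀ z ≠ 0, ContDiffAt ℝ ∞ (lawsonPotential m n β δ ε) z := fun z hz =>
    contDiffAt_conePotential hE₁ hE₂ _ hz
  refine ⟨fun z hz => ?_, fun z hz => ?_, fun z hz => ?_, fun z hz hz0 v hv hvt => ?_, ?_⟩
  · exact ((fluxForm (ambBasis m n)).contDiff.contDiffAt.comp z
      (contDiffAt_potField (hg z hz))).contDiffWithinAt
  · obtain ⟨W', hW', hdiv⟩ := div_potField (hg z hz)
    exact extDeriv_fluxForm_eq_zero _ hW' hdiv
  · exact (comass_fluxForm_le _ _).trans (hW z hz)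
  · obtain ⟨⟨c, hc⟩, h1⟩ := potField_lawsonPotential_of_mem_cone h hm hn hδ hδ' hε hε' hz hz0
    rw [lawsonForm, abs_fluxForm_eq _ _ _ (fun i j hij => hv.2 hij), h1]
    · simp [hv.1]
    · intro i
      rw [hc, inner_smul_left, inner_coneNormal_of_mem_span hm hz (hvt i), mul_zero]
  · obtain ⟨z, hz, hz0, hzn⟩ := exists_mem_cone_fluxForm_ne_zero hm hn
    obtain ⟨⟨c, hc⟩, h1⟩ := potField_lawsonPotential_of_mem_cone h hm hn hδ hδ' hε hε' hz hz0
    refine not_tendsto_of_smul hz0 ?_ (fun t ht => ?_)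
    · rw [lawsonForm, hc, map_smul]
      refine smul_ne_zero ?_ hzn
      rintro rfl
      rw [hc, zero_smul, norm_zero] at h1
      exact zero_ne_one h1
    · rw [lawsonForm, lawsonForm, lawsonPotential, potField_conePotential_smul hE₁ hE₂ _ hz0 ht,
        map_smul]

end Calibration

/-! ### Identification with the form of the deformed potential -/

section PotentialForm

variable {m n : ℕ}

theorem hasFDerivAt_norm_pow_succ {E F : Type*} [NormedAddCommGroup E] [InnerProductSpace ℝ E]
    [NormedAddCommGroup F] [NormedSpace ℝ F] (P : F →L[ℝ] E) {z : F} (hz : P z ≠ 0) (k : ℕ) :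
    HasFDerivAt (fun w => ‖P w‖ ^ (k + 1))
      (((k + 1) * ‖P z‖ ^ k * ‖P z‖⁻¹) • (innerSL ℝ (P z)).comp P) z := by
  have hz' : ‖P z‖ ≠ 0 := norm_ne_zero_iff.2 hz
  have h1 : HasFDerivAt (fun w => √(‖P w‖ ^ 2)) _ z :=
    (P.hasFDerivAt.norm_sq).sqrt (pow_ne_zero 2 hz')
  simp only [sqrt_sq (norm_nonneg _)] at h1
  refine (h1.pow (k + 1)).congr_fderiv ?_
  ext w
  simp only [smul_apply, smul_eq_mul, ContinuousLinearMap.comp_apply, innerSL_apply_apply,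
    nsmul_eq_mul, Nat.add_sub_cancel]
  push_cast
  field_simp

/-- If the function `√τ f` on the quadrant pulls back to `‖X‖^(m+1) ‖Y‖^(n+1) g` with `g` depending
on `‖X‖` and `‖Y‖` only, then its form is the contraction of the volume form with the field of
potential `g`. -/
theorem potentialForm_eq_fluxForm (hm : 1 ≤ m) (hn : 1 ≤ n) {f : ℝ × ℝ → ℝ} {g : Amb m n → ℝ}
    {z : Amb m n} (hX : projX m n z ≠ 0) (hY : projY m n z ≠ 0) (hg : DifferentiableAt ℝ g z)
    {P Q : ℝ} (hPQ : ∀ w, fderiv ℝ g z w = P * inner ℝ (projX m n z) (projX m n w) +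
      Q * inner ℝ (projY m n z) (projY m n w))
    (hf : f ∘ orbitMap m n =ᶠ[𝓝 z] fun w =>
      (√(tauConst m n))⁻¹ * (‖projX m n w‖ ^ (m + 1) * ‖projY m n w‖ ^ (n + 1) * g w)) :
    potentialForm m n f z = (fluxForm (ambBasis m n) (potField m n g z)).toAlternatingMap := by
  have ha : ‖projX m n z‖ ≠ 0 := norm_ne_zero_iff.2 hX
  have hb : ‖projY m n z‖ ≠ 0 := norm_ne_zero_iff.2 hY
  have hs : √(tauConst m n) ≠ 0 := (sqrt_pos.2 (tauConst_pos hm hn)).ne'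
  have dX := hasFDerivAt_norm_pow_succ (LinearMap.toContinuousLinearMap (projX m n)) hX m
  have dY := hasFDerivAt_norm_pow_succ (LinearMap.toContinuousLinearMap (projY m n)) hY n
  have hd := (((dX.mul dY).mul hg.hasFDerivAt).const_mul (√(tauConst m n))⁻¹).congr_of_eventuallyEq hf
  -- The two coefficients are the partial derivatives of the function on the quadrant in `‖X‖` and
  -- `‖Y‖`. The powers of the norms contribute `(m+1) g` and `(n+1) g`, which explains these terms
  -- in `coeffY` and `coeffX`.
  rw [potentialForm, wedge_orbitForm z hX hY _
    (-((√(tauConst m n))⁻¹ * ‖projX m n z‖ ^ m * ‖projY m n z‖ ^ (n + 1) * coeffY m n g z))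
    ((√(tauConst m n))⁻¹ * ‖projX m n z‖ ^ (m + 1) * ‖projY m n z‖ ^ n * coeffX m n g z)]
  · rw [← ContinuousAlternatingMap.toAlternatingMap_smul, ← map_smul]
    congr 2
    rw [potField, partX_apply, partY_apply, orbitVolume, smul_add, map_smul, map_smul, smul_smul,
      smul_smul]
    congr 2
    · field_simp
      ring
    · field_simp
      ring
  · intro w
    have hc : coeffX m n g z = (n + 1) * g z + Q * ‖projY m n z‖ ^ 2 := by
      rw [coeffX, hPQ, partY_apply, projX_inclY, projY_inclY, inner_zero_right,
        real_inner_self_eq_norm_sq, mul_zero, zero_add]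
    have hc' : coeffY m n g z = -((m + 1) * g z + P * ‖projX m n z‖ ^ 2) := by
      rw [coeffY, hPQ, partX_apply, projX_inclX, projY_inclX, inner_zero_right,
        real_inner_self_eq_norm_sq, mul_zero, add_zero]
    rw [hd.fderiv, hc, hc', inner_smul_left, inner_smul_left]
    simp only [ContinuousLinearMap.coe_coe, Pi.mul_apply, smul_apply, add_apply, smul_eq_mul,
      ContinuousLinearMap.comp_apply, innerSL_apply_apply, LinearMap.coe_toContinuousLinearMap', hPQ,
      conj_trivial]
    field_simp
    ring

/-- With `‖X‖ = R cos θ` and `‖Y‖ = R sin θ`, the powers `‖X‖^(m+1) ‖Y‖^(n+1) R⁻¹` account for `R^α`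
and for `m + 1`, `n + 1` of the trigonometric exponents. The profiles carry the rest, the second one
through `cos θ = sin (π/2 - θ)`. -/
theorem deformedPotential_comp_orbitMap (hm : 1 ≤ m) (hn : 1 ≤ n) (β δ ε : ℝ) {w : Amb m n}
    (hX : projX m n w ≠ 0) (hY : projY m n w ≠ 0) :
    deformedPotential m n β (lawsonCutoff n β δ) (lawsonCutoff m β ε) (orbitMap m n w) =
      (√(tauConst m n))⁻¹ * (‖projX m n w‖ ^ (m + 1) * ‖projY m n w‖ ^ (n + 1) *
        lawsonPotential m n β δ ε w) := by
  have ha : 0 < ‖projX m n w‖ := norm_pos_iff.2 hX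
  have hb : 0 < ‖projY m n w‖ := norm_pos_iff.2 hY
  have hτ := tauConst_pos hm hn
  have hr2 := norm_sq_eq_projX_add_projY w
  have hr : 0 < ‖w‖ := by
    refine norm_pos_iff.2 ?_
    rintro rfl
    exact hX (map_zero _)
  simp only [deformedPotential, orbitMap, lawsonPotential, conePotential, lawsonConst]
  rw [← hr2, sqrt_sq hr.le]
  generalize ‖projX m n w‖ = a at *
  generalize ‖projY m n w‖ = b at *
  generalize ‖w‖ = r at *
  obtain ⟨θ, hθ⟩ : ∃ θ, θ = arctan (b / a) := ⟨_, rfl⟩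
  have hsq : √(1 + (b / a) ^ 2) = r / a := by
    rw [show 1 + (b / a) ^ 2 = (r / a) ^ 2 by
      rw [div_pow, div_pow, hr2]
      field_simp]
    exact sqrt_sq (by positivity)
  have hcos : cos θ = a / r := by rw [hθ, cos_arctan, hsq, one_div_div]
  have hsin : sin θ = b / r := by rw [hθ, sin_arctan, hsq]; field_simp
  have hθ1 : -(π / 2) < θ := hθ ▸ neg_pi_div_two_lt_arctan _
  have hθ2 : θ < π / 2 := hθ ▸ arctan_lt_pi_div_two _
  have hθ0 : 0 < θ := hθ ▸ arctan_pos.2 (by positivity)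
  rw [← hθ, show b ^ 2 / r ^ 2 = sin θ ^ 2 by rw [hsin, div_pow],
    show a ^ 2 / r ^ 2 = cos θ ^ 2 by rw [hcos, div_pow],
    show a = r * cos θ by rw [hcos]; field_simp, show b = r * sin θ by rw [hsin]; field_simp]
  have hc0 : 0 < cos θ := by rw [hcos]; positivity
  have hs0 : 0 < sin θ := by rw [hsin]; positivity
  rw [lawsonProfile, lawsonProfile, profile, profile, sqrt_sq hs0.le, sqrt_sq hc0.le,
    arcsin_sin hθ1.le hθ2.le, ← sin_pi_div_two_sub,
    arcsin_sin (by linarith) (by linarith), sin_pi_div_two_sub]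
  -- This is where the shift `-(k+1)/2` and the halved cutoff in the profile come from: `2kβ + c =
  -- (k+1) + 2 (kβ - (k+1)/2 + c/2)`.
  have key : ∀ {s : ℝ} (k : ℕ) (c : ℝ), 0 < s →
      s ^ (2 * k * β + c) = s ^ (k + 1) * (s ^ 2) ^ (lawsonExponent k β + c / 2) := by
    intro s k c hs
    rw [← rpow_natCast s 2, ← rpow_mul hs.le, ← rpow_natCast, ← rpow_add hs]
    congr 1
    push_cast
    rw [lawsonExponent]
    ring
  rw [key m _ hc0, key n _ hs0]
  have hs : 0 < √(tauConst m n) := sqrt_pos.2 hτ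
  have := rpow_pos_of_pos hτ β
  field_simp
  ring

theorem lawsonForm_eq_potentialForm (hm : 1 ≤ m) (hn : 1 ≤ n) {β δ ε : ℝ}
    (hδ : 0 < δ) (hδ' : δ < π / 2) (hε : 0 < ε) (hε' : ε < π / 2)
    {z : Amb m n} (hX : projX m n z ≠ 0) (hY : projY m n z ≠ 0) :
    (lawsonForm m n β δ ε z).toAlternatingMap = potentialForm m n
      (deformedPotential m n β (lawsonCutoff n β δ) (lawsonCutoff m β ε)) z := by
  have hz : z ≠ 0 := by
    rintro rfl
    exact hX (map_zero _)
  have hE₁ : ContDiff ℝ ∞ (lawsonProfile n β δ) := contDiff_lawsonProfile hδ hδ'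
  have hE₂ : ContDiff ℝ ∞ (lawsonProfile m β ε) := contDiff_lawsonProfile hε hε'
  have hP := fun w => fderiv_conePotential hE₁ hE₂ (lawsonConst m n β) hz rfl rfl w
  simp only [mul_add, ← mul_assoc] at hP
  refine (potentialForm_eq_fluxForm hm hn hX hY
    ((contDiffAt_conePotential hE₁ hE₂ _ hz).differentiableAt (by simp)) hP ?_).symm
  have hX' := contDiff_projX.continuous.continuousAt.eventually_ne hX
  have hY' := contDiff_projY.continuous.continuousAt.eventually_ne hY
  filter_upwards [hX', hY'] with w hwX hwY
  exact deformedPotential_comp_orbitMap hm hn β δ ε hwX hwY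

end PotentialForm

end
theorem mainTheorem2 (m n : ℕ) (hm : 1 ≤ m) (hn : 1 ≤ n)
    (hmin : IsMassMinimizing (truncatedCone m n)) :
    ∃ Φ : DiffForm (Amb m n) (m + n + 1),
      IsCalibrationSingularOnlyAtZero Φ (coneOver (link m n)) ∧
      ∃ (β : ℝ) (κ η : ℝ → ℝ) (δ ε : ℝ),
        0 < δ ∧ δ < coneAngle m n ∧ IsCutoff κ δ ∧
        0 < ε ∧ ε < π / 2 - coneAngle m n ∧ IsCutoff η ε ∧
        ∀ x : Amb m n, projX m n x ≠ 0 → projY m n x ≠ 0 →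
          (Φ x).toAlternatingMap = potentialForm m n (deformedPotential m n β κ η) x := by
  have hN : 6 ≤ m + n := by
    by_contra! hN
    exact not_isMassMinimizing_of_add_le_five hm hn (by omega) hmin
  have h15 : ¬ (m = 1 ∧ n = 5) := by
    rintro ⟨rfl, rfl⟩
    exact not_isMassMinimizing_one_five hmin
  have h51 : ¬ (m = 5 ∧ n = 1) := by
    rintro ⟨rfl, rfl⟩
    exact not_isMassMinimizing_five_one hmin
  obtain ⟨β, h⟩ := exists_isLawsonExponent hm hn hN h15 h51
  obtain ⟨δ, ε, hδ, hδ', hε, hε', hW⟩ := exists_norm_potField_le_one h hm hn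
  have h1 : coneAngle m n < π / 2 := arctan_lt_pi_div_two _
  have h2 : 0 < coneAngle m n := hδ.trans hδ'
  exact ⟨lawsonForm m n β δ ε, isCalibration_lawsonForm h hm hn hδ hδ' hε hε' hW, β,
    lawsonCutoff n β δ, lawsonCutoff m β ε, δ, ε, hδ, hδ',
    isCutoff_cutoff h.cutoff_height_nonneg hδ, hε, hε',
    isCutoff_cutoff h.symm.cutoff_height_nonneg hε,
    fun x hX hY => lawsonForm_eq_potentialForm hm hn hδ (by linarith) hε (by linarith) hX hY⟩
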